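/- Let $\kappa\le 0$ and $\tau\in\mathbb R$. Let $\lambda=\left(1+\frac{\kappa}{4}(x^2+y^2)\right)^{-1}$, let $\mathbb M^2(\kappa)=\{(x,y)\in\mathbb R^2: 1+\frac{\kappa}{4}(x^2+y^2)>0\}$ carry the metric $\lambda^2(dx^2+dy^2)$, and let $\mathbb E(\kappa,\tau)=\mathbb M^2(\kappa)\times\mathbb R$ carry the Riemannian metric for which $E_1=\frac{\partial_x}{\lambda}-\tau y\,\partial_z$, $E_2=\frac{\partial_y}{\lambda}+\tau x\,\partial_z$, $E_3=\partial_z$ is an orthonormal frame. Thus $\mathbb E(0,0)=\mathbb R^3$ and $\mathbb E(0,\tau)=\mathrm{Nil}_3(\tau)$ for $\tau\ne0$. Denote by $D_R(0)$ the geodesic disk of radius $R$ of $\mathbb M^2(\kappa)$ centred at the origin, and by $B_R(p_0)$ the geodesic ball of radius $R$ of $\mathbb E(\kappa,\tau)$ centred at $p_0$. Boundaries of subsets of $\mathbb M^2(\kappa)$ are taken in $\mathbb M^2(\kappa)$, and the length of a boundary is its one-dimensional Hausdorff measure with respect to the metric of $\mathbb M^2(\kappa)$. A surface $\Sigma\subset\mathbb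 E(\kappa,\tau)$ has extrinsic area growth of order at most $f(R)$ if $\limsup_{R\to\infty}\operatorname{area}(\Sigma\cap B_R(p_0))/f(R)<\infty$ for every $p_0\in\mathbb E(\kappa,\tau)$. **Theorem.** Let $\Omega\subset\mathbb M^2(\kappa)$ be a domain, let $u\in C^2(\Omega)$, and suppose that the graph $\Sigma=\{(x,y,u(x,y)):(x,y)\in\Omega\}\subset\mathbb E(\kappa,\tau)$ is minimal, i.e. has mean curvature zero. Suppose that at least one of the following conditions holds: (i) $u$ extends continuously to $\partial\Omega$ with zero boundary values; (ii) there is $K>0$ such that $\operatorname{length}(\partial(\Omega\cap D_R(0)))\le K\operatorname{length}(\partial D_R(0))$ for all sufficiently large $R$. Then: (a) if $\kappa=0$ and $\tau=0$ (so $\mathbb E(\kappa,\tau)=\mathbb R^3$), then $\Sigma$ has extrinsic area growth of order at most $R^2$; (b) if $\kappa=0$ and $\tau\neq0$ (so $\mathbb E(\kappa,\tau)=\mathrm{Nil}_3(\tau)$), then $\Sigma$ has extrinsic area growth of order at most $R^3$; (c) if $\kappa<0$, then $\Sigma$ has extrinsic area growth of order at most $R\,e^{R\sqrt{-\kappa}}$.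 -/

import Mathlib

open Set Filter Topology MeasureTheory
open scoped ENNReal

noncomputable section

namespace EKT

/-! Riemannian geometry in one global coordinate chart of dimension `n`. -/

/-- Coordinate space. -/
abbrev Coord (n : ℕ) : Type := EuclideanSpace ℝ (Fin n)

/-- A metric tensor in coordinates: `g p v w` is the product of `v` and `w`, tangent at `p`. -/
abbrev MetricField (n : ℕ) : Type := Coord n → Coord n → Coord n → ℝ

/-- The coordinate vector field `∂_i`. -/
def coordVec {n : ℕ} (i : Fin n) : Coord n := EuclideanSpace.single i 1

/-- Partial derivative in the `i`-th coordinate. -/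
def pd {n : ℕ} {F : Type*} [NormedAddCommGroup F] [NormedSpace ℝ F]
    (i : Fin n) (f : Coord n → F) (p : Coord n) : F :=
  fderiv ℝ f p (coordVec i)

/-- Length of a curve parametrized by `[0,1]`. -/
def curveLength {n : ℕ} (g : MetricField n) (γ : ℝ → Coord n) : ℝ≥0∞ :=
  ∫⁻ t in Icc (0 : ℝ) 1, ENNReal.ofReal
    (√(g (γ t) (derivWithin γ (Icc 0 1) t) (derivWithin γ (Icc 0 1) t)))

/-- `γ : [0,1] → U` is a `C¹` curve in `U` from `p` to `q`. -/
structure IsCurveFromTo {n : ℕ} (U : Set (Coord n)) (p q : Coord n) (γ : ℝ → Coord n) :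
    Prop where
  contDiffOn : ContDiffOn ℝ 1 γ (Icc 0 1)
  mem : ∀ t ∈ Icc (0 : ℝ) 1, γ t ∈ U
  source : γ 0 = p
  target : γ 1 = q

/-- Riemannian distance of `(U, g)`: the infimum of the lengths of curves in `U`. -/
def riemDist {n : ℕ} (U : Set (Coord n)) (g : MetricField n) (p q : Coord n) : ℝ≥0∞ :=
  ⨅ (γ : ℝ → Coord n) (_ : IsCurveFromTo U p q γ), curveLength g γ

/-- The open geodesic ball of radius `R` centred at `p` in `(U, g)`. -/
def geodesicBall {n : ℕ} (U : Set (Coord n)) (g : MetricField n) (p : Coord n) (R : ℝ) :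
    Set (Coord n) :=
  {q ∈ U | riemDist U g p q < ENNReal.ofReal R}

/-- Christoffel symbols of the first kind, `g(∇_{∂_i} ∂_j, ∂_k)` for the Levi-Civita
connection `∇` of `g`. -/
def christoffel {n : ℕ} (g : MetricField n) (i j k : Fin n) (p : Coord n) : ℝ :=
  (1 / 2) * (pd i (fun q => g q (coordVec j) (coordVec k)) p
    + pd j (fun q => g q (coordVec i) (coordVec k)) p
    - pd k (fun q => g q (coordVec i) (coordVec j)) p)

/-- First fundamental form of a parametrized surface `F`. -/
def firstForm {n : ℕ} (g : MetricField n) (F : Coord 2 → Coord n) (a b : Fin 2)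
    (p : Coord 2) : ℝ :=
  g (F p) (pd a F p) (pd b F p)

/-- Determinant of the first fundamental form. -/
def gramDet {n : ℕ} (g : MetricField n) (F : Coord 2 → Coord n) (p : Coord 2) : ℝ :=
  firstForm g F 0 0 p * firstForm g F 1 1 p - firstForm g F 0 1 p ^ 2

/-- Second fundamental form of a parametrized surface `F` in the normal direction `ν`,
that is, `g(∇_{F_a} F_b, ν)`. -/
def secondForm {n : ℕ} (g : MetricField n) (F : Coord 2 → Coord n) (ν : Coord n)
    (a b : Fin 2) (p : Coord 2) : ℝ :=
  g (F p) (pd a (pd b F) p) ν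
    + ∑ i, ∑ j, ∑ k, christoffel g i j k (F p) * (pd a F p) i * (pd b F p) j * ν k

/-- Mean curvature of a parametrized surface `F` with respect to the unit normal `ν`: half
the trace of the second fundamental form with respect to the first one. -/
def meanCurvature {n : ℕ} (g : MetricField n) (F : Coord 2 → Coord n) (ν : Coord n)
    (p : Coord 2) : ℝ :=
  (firstForm g F 1 1 p * secondForm g F ν 0 0 p
    - 2 * firstForm g F 0 1 p * secondForm g F ν 0 1 p
    + firstForm g F 0 0 p * secondForm g F ν 1 1 p) / (2 * gramDet g F p)

/-- `ν` is a unit normal at the point `F p` of the parametrized surface `F`. -/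
def IsUnitNormal {n : ℕ} (g : MetricField n) (F : Coord 2 → Coord n) (p : Coord 2)
    (ν : Coord n) : Prop :=
  (∀ a : Fin 2, g (F p) (pd a F p) ν = 0) ∧ g (F p) ν ν = 1

/-- Area of the part of an injectively parametrized surface `F : Ω → (U, g)` that lies
in the set `B`. -/
def surfaceArea {n : ℕ} (g : MetricField n) (Ω : Set (Coord 2)) (F : Coord 2 → Coord n)
    (B : Set (Coord n)) : ℝ≥0∞ :=
  ∫⁻ p in {p ∈ Ω | F p ∈ B}, ENNReal.ofReal (√(gramDet g F p))

/-! The surface `𝕄²(κ)` and the space `𝔼(κ,τ)`. -/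

/-- The conformal factor `λ = (1 + κ/4 (x² + y²))⁻¹`. -/
def conf (κ x y : ℝ) : ℝ := (1 + κ / 4 * (x ^ 2 + y ^ 2))⁻¹

/-- The points of `𝕄²(κ)`, for `κ ≤ 0`: the plane or an open disk. -/
def baseSet (κ : ℝ) : Set (Coord 2) := {p | 0 < 1 + κ / 4 * (p 0 ^ 2 + p 1 ^ 2)}

/-- The metric `λ² (dx² + dy²)` of `𝕄²(κ)`. -/
def baseMetric (κ : ℝ) : MetricField 2 := fun p v w =>
  conf κ (p 0) (p 1) ^ 2 * (v 0 * w 0 + v 1 * w 1)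

/-- The geodesic disk `D_R(0)` of `𝕄²(κ)`. -/
def disk (κ R : ℝ) : Set (Coord 2) := geodesicBall (baseSet κ) (baseMetric κ) 0 R

/-- The boundary, relative to `𝕄²(κ)`, of a subset of `𝕄²(κ)`. -/
def bdry (κ : ℝ) (S : Set (Coord 2)) : Set (Coord 2) := frontier S ∩ baseSet κ

/-- Length in `𝕄²(κ)`: the one-dimensional Hausdorff measure, with the length element
`λ ds` of the conformal metric, where `ds` is the Euclidean one. -/
def baseLength (κ : ℝ) (S : Set (Coord 2)) : ℝ≥0∞ :=
  ∫⁻ p in S, ENNReal.ofReal (conf κ (p 0) (p 1)) ∂(Measure.hausdorffMeasure 1)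

/-- The points of `𝔼(κ,τ)`. -/
def spaceSet (κ : ℝ) : Set (Coord 3) := {p | 0 < 1 + κ / 4 * (p 0 ^ 2 + p 1 ^ 2)}

/-- The components of the vector `v`, tangent at `p`, in the frame
`E₁ = ∂_x/λ - τ y ∂_z`, `E₂ = ∂_y/λ + τ x ∂_z`, `E₃ = ∂_z`. -/
def frameCoeff (κ τ : ℝ) (p v : Coord 3) : Fin 3 → ℝ :=
  ![conf κ (p 0) (p 1) * v 0, conf κ (p 0) (p 1) * v 1,
    v 2 + τ * conf κ (p 0) (p 1) * (p 1 * v 0 - p 0 * v 1)]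

/-- The metric of `𝔼(κ,τ)`: the one for which `E₁, E₂, E₃` is an orthonormal frame. -/
def spaceMetric (κ τ : ℝ) : MetricField 3 := fun p v w =>
  ∑ i, frameCoeff κ τ p v i * frameCoeff κ τ p w i

/-- `frameCoeff` does give the components in the frame `E₁, E₂, E₃`. -/
theorem sum_frameCoeff (κ τ : ℝ) (p v : Coord 3) (hp : p ∈ spaceSet κ) :
    frameCoeff κ τ p v 0 • !₂[(conf κ (p 0) (p 1))⁻¹, 0, -τ * p 1]
      + frameCoeff κ τ p v 1 • !₂[0, (conf κ (p 0) (p 1))⁻¹, τ * p 0]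
      + frameCoeff κ τ p v 2 • !₂[(0 : ℝ), 0, 1] = v := by
  have h : conf κ (p 0) (p 1) ≠ 0 := inv_ne_zero (ne_of_gt hp)
  ext i
  fin_cases i <;> simp [frameCoeff] <;> field_simp <;> ring

/-- The geodesic ball `B_R(p₀)` of `𝔼(κ,τ)`. -/
def ball (κ τ : ℝ) (p₀ : Coord 3) (R : ℝ) : Set (Coord 3) :=
  geodesicBall (spaceSet κ) (spaceMetric κ τ) p₀ R

/-- The parametrization `(x,y) ↦ (x, y, u(x,y))` of the graph of `u`. -/
def graphMap (u : Coord 2 → ℝ) (p : Coord 2) : Coord 3 := !₂[p 0, p 1, u p]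

/-- The graph of `u` is a minimal graph in `𝔼(κ,τ)` over the domain `Ω ⊆ 𝕄²(κ)`: the
function `u` is of class `C²` on `Ω` and the mean curvature vanishes. -/
structure IsMinimalGraph (κ τ : ℝ) (Ω : Set (Coord 2)) (u : Coord 2 → ℝ) : Prop where
  isOpen : IsOpen Ω
  isConnected : IsConnected Ω
  subset : Ω ⊆ baseSet κ
  contDiffOn : ContDiffOn ℝ 2 u Ω
  meanCurvature_eq_zero : ∀ p ∈ Ω, ∀ ν : Coord 3,
    IsUnitNormal (spaceMetric κ τ) (graphMap u) p ν →
      meanCurvature (spaceMetric κ τ) (graphMap u) ν p = 0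

/-- The function `u` extends continuously by zero to the boundary of `Ω` in `𝕄²(κ)`. -/
def HasZeroBoundaryValues (κ : ℝ) (Ω : Set (Coord 2)) (u : Coord 2 → ℝ) : Prop :=
  ∀ q ∈ bdry κ Ω, Tendsto u (𝓝[Ω] q) (𝓝 0)

/-- For some `K > 0`, `length ∂(Ω ∩ D_R(0)) ≤ K length ∂D_R(0)` for all large `R`. -/
def HasControlledBoundaryLength (κ : ℝ) (Ω : Set (Coord 2)) : Prop :=
  ∃ K : ℝ, 0 < K ∧ ∀ᶠ R in atTop,
    baseLength κ (bdry κ (Ω ∩ disk κ R)) ≤ ENNReal.ofReal K * baseLength κ (bdry κ (disk κ R))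

/-- The graph of `u` over `Ω` has extrinsic area growth of order at most `f` in `𝔼(κ,τ)`,
whatever the centre of the geodesic balls is. -/
def ExtrinsicAreaGrowthAtMost (κ τ : ℝ) (Ω : Set (Coord 2)) (u : Coord 2 → ℝ)
    (f : ℝ → ℝ) : Prop :=
  ∀ p₀ ∈ spaceSet κ,
    limsup (fun R : ℝ => surfaceArea (spaceMetric κ τ) Ω (graphMap u) (ball κ τ p₀ R)
      / ENNReal.ofReal (f R)) atTop < ∞

end EKT

end

open Set Filter Topology MeasureTheory
open scoped ENNReal

noncomputable section

namespace EKT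


/-! ### The minimal surface equation in divergence form -/

/-! With a = u_x + τλy, b = u_y − τλx and V² = λ² + a² + b², the area element of the graph is λV dx
dy, and minimality says that the field X = (λ/V)(a, b) is divergence free
(`IsMinimalGraph.div_flux`). Since |X| ≤ λ, there is a pointwise bound λV ≤ X·∇u + λ²(1 + |τ||p|)
(`area_le_flux`). Test the equation with ηT(u), where η is a cutoff with values in [0,1] and T is a
truncation with 0 ≤ T' ≤ 1, T' = 1 for |u| ≤ h, and |T| ≤ 2h. The result (`area_estimate`) is ∫ η
T'(u) λV ≤ ∫ λ²(1 + |τ||p|) + 2h ∫ λ|∇η|. The last integral is the total variation of η for the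
metric of 𝕄²(κ). So the area over a disk of the part with |u| ≤ h is controlled by the weighted area
of the disk and by h times a length.

The two hypotheses are two ways to give ηT(u) compact support in Ω. Under (i), η only cuts off at
the disk and T vanishes also near zero; the set u = 0 is harmless because ∇u = 0 almost everywhere
on it (`area_le_of_zeroBoundary`). Under (ii), η is a product of cutoffs of small balls covering the
boundary of Ω ∩ D_R, whose total variation is at most a constant times the length of that boundary
plus one (`exists_weighted_cover`, `area_le_of_length`).

A geodesic ball of radius R projects into a disk of radius R + d, and its height is O((1 + |τ|ρ)R),
where ρ is the coordinate radius of that disk (`ball_subset`). The area is therefore O((1 +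
|τ|ρ)·area(D) + (1 + |τ|ρ)R·(length(∂D) + 1)). For κ = 0 one has ρ ~ R, which gives R² if τ = 0 and
R³ otherwise; for κ < 0 the coordinate radius stays bounded while area and length are of order
e^{√(−κ)R}, and the height contributes the factor R. -/

/-- The conformal factor as a function on coordinate space. -/
def lam (κ : ℝ) {n : ℕ} [NeZero n] (p : Coord n) : ℝ := conf κ (p 0) (p 1)

theorem conf_pos {κ x y : ℝ} (h : 0 < 1 + κ / 4 * (x ^ 2 + y ^ 2)) : 0 < conf κ x y :=
  inv_pos.2 h

/-- The derivative of the conformal factor along the coordinate directions. -/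
def dlam (κ x y L : ℝ) {n : ℕ} [NeZero n] (i : Fin n) : ℝ :=
  -κ / 2 * L ^ 2 * (x * coordVec i 0 + y * coordVec i 1)

theorem hasFDerivAt_coord {n : ℕ} (i : Fin n) (p : Coord n) :
    HasFDerivAt (fun q : Coord n => q i) (EuclideanSpace.proj i : Coord n →L[ℝ] ℝ) p :=
  (EuclideanSpace.proj i : Coord n →L[ℝ] ℝ).hasFDerivAt

theorem hasFDerivAt_conf {n : ℕ} [NeZero n] {κ : ℝ} {p : Coord n}
    (hp : 0 < 1 + κ / 4 * (p 0 ^ 2 + p 1 ^ 2)) :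
    HasFDerivAt (fun q : Coord n => conf κ (q 0) (q 1))
      ((-κ / 2 * conf κ (p 0) (p 1) ^ 2) •
        (p 0 • (EuclideanSpace.proj 0 : Coord n →L[ℝ] ℝ) +
          p 1 • (EuclideanSpace.proj 1 : Coord n →L[ℝ] ℝ))) p := by
  have h0 := hasFDerivAt_coord (0 : Fin n) p
  have h1 := hasFDerivAt_coord (1 : Fin n) p
  have h2 := ((((h0.pow 2).add (h1.pow 2)).const_mul (κ / 4)).const_add 1)
  have h3 := (hasDerivAt_inv hp.ne').comp_hasFDerivAt p h2
  refine h3.congr_fderiv ?_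
  ext v
  simp [conf]
  ring

/-- The matrix of the coframe: the component along `E_m` of `∂_j`. -/
def coframe (τ x y L : ℝ) (m j : Fin 3) : ℝ :=
  ![![L, 0, 0], ![0, L, 0], ![τ * L * y, -(τ * L * x), 1]] m j

/-- The derivative in direction `∂_i` of the component along `E_m` of `∂_j`. -/
def dcoframe (κ τ x y L : ℝ) (i m j : Fin 3) : ℝ :=
  ![![dlam κ x y L i, 0, 0], ![0, dlam κ x y L i, 0],
    ![τ * (dlam κ x y L i * y + L * coordVec i 1),
      -(τ * (dlam κ x y L i * x + L * coordVec i 0)), 0]] m j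

theorem frameCoeff_coordVec (κ τ : ℝ) (q : Coord 3) (m j : Fin 3) :
    frameCoeff κ τ q (coordVec j) m = coframe τ (q 0) (q 1) (conf κ (q 0) (q 1)) m j := by
  fin_cases m <;> fin_cases j <;> simp [frameCoeff, coframe, coordVec]

theorem exists_hasFDerivAt_frameCoeff {κ τ : ℝ} {p : Coord 3} (hp : p ∈ spaceSet κ)
    (m j : Fin 3) :
    ∃ D : Coord 3 →L[ℝ] ℝ, HasFDerivAt (fun q => frameCoeff κ τ q (coordVec j) m) D p ∧
      ∀ i, D (coordVec i) = dcoframe κ τ (p 0) (p 1) (conf κ (p 0) (p 1)) i m j := by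
  have hL := hasFDerivAt_conf (n := 3) hp
  have h0 := hasFDerivAt_coord (0 : Fin 3) p
  have h1 := hasFDerivAt_coord (1 : Fin 3) p
  have hx := ((hL.mul h0).const_mul τ).neg
  have hy := (hL.mul h1).const_mul τ
  simp only [frameCoeff_coordVec]
  fin_cases m <;> fin_cases j
  · exact ⟨_, hL, fun i => by simp [dcoframe, dlam]; ring⟩
  · exact ⟨0, by simpa [coframe] using hasFDerivAt_const _ _, fun i => by simp [dcoframe]⟩
  · exact ⟨0, by simpa [coframe] using hasFDerivAt_const _ _, fun i => by simp [dcoframe]⟩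
  · exact ⟨0, by simpa [coframe] using hasFDerivAt_const _ _, fun i => by simp [dcoframe]⟩
  · exact ⟨_, hL, fun i => by simp [dcoframe, dlam]; ring⟩
  · exact ⟨0, by simpa [coframe] using hasFDerivAt_const _ _, fun i => by simp [dcoframe]⟩
  · refine ⟨_, hy.congr_of_eventuallyEq (.of_forall fun q => ?_), fun i => ?_⟩
    · simp [coframe]; ring
    · simp [dcoframe, dlam]; ring
  · refine ⟨_, hx.congr_of_eventuallyEq (.of_forall fun q => ?_), fun i => ?_⟩
    · simp [coframe]; ring
    · simp [dcoframe, dlam]; ring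
  · exact ⟨0, by simpa [coframe] using hasFDerivAt_const _ _, fun i => by simp [dcoframe]⟩

theorem pd_spaceMetric {κ τ : ℝ} {p : Coord 3} (hp : p ∈ spaceSet κ) (i j k : Fin 3) :
    pd i (fun q => spaceMetric κ τ q (coordVec j) (coordVec k)) p =
      ∑ m, (coframe τ (p 0) (p 1) (conf κ (p 0) (p 1)) m j *
          dcoframe κ τ (p 0) (p 1) (conf κ (p 0) (p 1)) i m k +
        coframe τ (p 0) (p 1) (conf κ (p 0) (p 1)) m k *
          dcoframe κ τ (p 0) (p 1) (conf κ (p 0) (p 1)) i m j) := by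
  choose D hD hD' using fun m j => exists_hasFDerivAt_frameCoeff (τ := τ) hp m j
  have h := HasFDerivAt.fun_sum (u := Finset.univ) fun m _ => (hD m j).mul (hD m k)
  rw [pd, show (fun q => spaceMetric κ τ q (coordVec j) (coordVec k)) = fun q =>
    ∑ m, frameCoeff κ τ q (coordVec j) m * frameCoeff κ τ q (coordVec k) m from rfl]
  erw [h.fderiv]
  simp [hD', frameCoeff_coordVec]

/-- The linear part of the parametrization of a graph. -/
def graphLin : Coord 2 →L[ℝ] Coord 3 :=
  LinearMap.toContinuousLinearMap
    { toFun := fun p => !₂[p 0, p 1, 0]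
      map_add' := fun p q => by ext i; fin_cases i <;> simp
      map_smul' := fun c p => by ext i; fin_cases i <;> simp }

theorem graphLin_apply (p : Coord 2) : graphLin p = !₂[p 0, p 1, 0] := rfl

theorem graphMap_eq (u : Coord 2 → ℝ) (p : Coord 2) :
    graphMap u p = graphLin p + u p • (coordVec 2 : Coord 3) := by
  ext i; fin_cases i <;> simp [graphMap, graphLin_apply, coordVec]

theorem pd_graphMap {u : Coord 2 → ℝ} {p : Coord 2} (hu : DifferentiableAt ℝ u p) (b : Fin 2) :
    pd b (graphMap u) p = graphLin (coordVec b) + pd b u p • (coordVec 2 : Coord 3) := by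
  have h := (graphLin.hasFDerivAt (x := p)).add (hu.hasFDerivAt.smul_const (coordVec 2 : Coord 3))
  have h2 : graphMap u = fun p => graphLin p + u p • (coordVec 2 : Coord 3) :=
    funext (graphMap_eq u)
  rw [pd, h2]
  erw [h.fderiv]
  simp [pd]

theorem differentiableAt_pd {u : Coord 2 → ℝ} {p : Coord 2} (hu : ContDiffAt ℝ 2 u p)
    (b : Fin 2) : DifferentiableAt ℝ (pd b u) p := by
  have : ContDiffAt ℝ 1 (fderiv ℝ u) p := hu.fderiv_right (by norm_num)
  exact (this.differentiableAt (by norm_num)).clm_apply (differentiableAt_const _)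

theorem pd_pd_graphMap {u : Coord 2 → ℝ} {Ω : Set (Coord 2)} (hΩ : IsOpen Ω)
    (hu : ContDiffOn ℝ 2 u Ω) {p : Coord 2} (hp : p ∈ Ω) (a b : Fin 2) :
    pd a (pd b (graphMap u)) p = pd a (pd b u) p • (coordVec 2 : Coord 3) := by
  have h1 : pd b (graphMap u) =ᶠ[𝓝 p] fun q =>
      graphLin (coordVec b) + pd b u q • (coordVec 2 : Coord 3) := by
    filter_upwards [hΩ.mem_nhds hp] with q hq
    exact pd_graphMap ((hu.contDiffAt (hΩ.mem_nhds hq)).differentiableAt (by norm_num)) b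
  have h2 := differentiableAt_pd (hu.contDiffAt (hΩ.mem_nhds hp)) b
  rw [pd, h1.fderiv_eq]
  have h3 := (h2.hasFDerivAt.smul_const (coordVec 2 : Coord 3)).const_add
    (graphLin (coordVec b))
  rw [h3.fderiv]
  simp [pd]

theorem pd_comm {u : Coord 2 → ℝ} {p : Coord 2} (hu : ContDiffAt ℝ 2 u p) (a b : Fin 2) :
    pd a (pd b u) p = pd b (pd a u) p := by
  have h : IsSymmSndFDerivAt ℝ u p := hu.isSymmSndFDerivAt (by simp)
  have hd : DifferentiableAt ℝ (fderiv ℝ u) p :=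
    (hu.fderiv_right (m := 1) (by norm_num)).differentiableAt (by norm_num)
  have key : ∀ a b : Fin 2, pd a (pd b u) p =
      fderiv ℝ (fderiv ℝ u) p (coordVec a) (coordVec b) := by
    intro a b
    have := (hd.hasFDerivAt.clm_apply (hasFDerivAt_const (coordVec b : Coord 2) p)).fderiv
    simp only [pd] at *
    erw [this]
    simp
  rw [key, key]
  exact h _ _

/-- The horizontal components of the generalized gradient of `u`, times `λ`. -/
def gradX (κ τ : ℝ) (u : Coord 2 → ℝ) (p : Coord 2) : ℝ := pd 0 u p + τ * lam κ p * p 1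

/-- The second component, see `gradX`. -/
def gradY (κ τ : ℝ) (u : Coord 2 → ℝ) (p : Coord 2) : ℝ := pd 1 u p - τ * lam κ p * p 0

/-- The factor `V` for which the area element of the graph is `λ V dx dy`. -/
def slope (κ τ : ℝ) (u : Coord 2 → ℝ) (p : Coord 2) : ℝ :=
  √(lam κ p ^ 2 + gradX κ τ u p ^ 2 + gradY κ τ u p ^ 2)

/-- The coordinates of `λ² Gu / W`, the divergence free vector field of a minimal graph. -/
def fluxX (κ τ : ℝ) (u : Coord 2 → ℝ) (p : Coord 2) : ℝ :=
  lam κ p * gradX κ τ u p / slope κ τ u p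

/-- The second component, see `fluxX`. -/
def fluxY (κ τ : ℝ) (u : Coord 2 → ℝ) (p : Coord 2) : ℝ :=
  lam κ p * gradY κ τ u p / slope κ τ u p

/-- The first fundamental form of a graph. -/
theorem firstForm_graphMap (κ τ : ℝ) {u : Coord 2 → ℝ} {p : Coord 2}
    (hu : DifferentiableAt ℝ u p) :
    firstForm (spaceMetric κ τ) (graphMap u) 0 0 p = lam κ p ^ 2 + gradX κ τ u p ^ 2 ∧
    firstForm (spaceMetric κ τ) (graphMap u) 0 1 p = gradX κ τ u p * gradY κ τ u p ∧
    firstForm (spaceMetric κ τ) (graphMap u) 1 1 p = lam κ p ^ 2 + gradY κ τ u p ^ 2 := by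
  refine ⟨?_, ?_, ?_⟩ <;>
  · simp only [firstForm, pd_graphMap hu, spaceMetric, frameCoeff, Fin.sum_univ_three, graphMap,
      graphLin_apply, coordVec, gradX, gradY, lam]
    simp [-mul_eq_mul_left_iff, -mul_eq_mul_right_iff]
    ring

theorem slope_sq (κ τ : ℝ) (u : Coord 2 → ℝ) (p : Coord 2) :
    slope κ τ u p ^ 2 = lam κ p ^ 2 + gradX κ τ u p ^ 2 + gradY κ τ u p ^ 2 :=
  Real.sq_sqrt (by positivity)

theorem slope_pos {κ : ℝ} (τ : ℝ) (u : Coord 2 → ℝ) {p : Coord 2} (hp : p ∈ baseSet κ) :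
    0 < slope κ τ u p := by
  have : 0 < lam κ p := conf_pos hp
  exact Real.sqrt_pos.2 (by positivity)

/-- The determinant collapses: (λ² + a²)(λ² + b²) − a²b² = λ²(λ² + a² + b²). -/
theorem gramDet_graphMap (κ τ : ℝ) {u : Coord 2 → ℝ} {p : Coord 2}
    (hu : DifferentiableAt ℝ u p) :
    gramDet (spaceMetric κ τ) (graphMap u) p = (lam κ p * slope κ τ u p) ^ 2 := by
  obtain ⟨h1, h2, h3⟩ := firstForm_graphMap κ τ hu
  rw [gramDet, h1, h2, h3, mul_pow (lam κ p), slope_sq]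
  ring


/-- The normal vector `(-a, -b, λ² + τ λ (y a - x b))` of a graph. -/
def graphNormal (κ τ : ℝ) (u : Coord 2 → ℝ) (p : Coord 2) : Coord 3 :=
  !₂[-gradX κ τ u p, -gradY κ τ u p,
    lam κ p ^ 2 + τ * lam κ p * (p 1 * gradX κ τ u p - p 0 * gradY κ τ u p)]

/-- In the orthonormal frame `graphNormal` has the components λ(−a, −b, λ), because the twist term
in its last coordinate cancels. Its length is therefore λV. -/
theorem isUnitNormal_graphNormal {κ : ℝ} (τ : ℝ) {u : Coord 2 → ℝ} {p : Coord 2}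
    (hp : p ∈ baseSet κ) (hu : DifferentiableAt ℝ u p) :
    IsUnitNormal (spaceMetric κ τ) (graphMap u) p
      ((lam κ p * slope κ τ u p)⁻¹ • graphNormal κ τ u p) := by
  have hL : 0 < lam κ p := conf_pos hp
  have hV := slope_pos τ u hp
  have hc : conf κ (p 0) (p 1) = lam κ p := rfl
  refine ⟨fun a => ?_, ?_⟩
  · rw [pd_graphMap hu]
    fin_cases a <;>
    · simp [spaceMetric, frameCoeff, Fin.sum_univ_three, graphMap, graphLin_apply, coordVec,
        graphNormal, hc, -mul_eq_mul_left_iff, -mul_eq_mul_right_iff]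
      simp only [gradX, gradY]
      ring
  · have h2 := slope_sq κ τ u p
    simp [spaceMetric, frameCoeff, Fin.sum_univ_three, graphMap, graphNormal, hc]
    field_simp
    rw [h2]
    ring

/-- Only the height has second derivatives, and ∂_z pairs with `graphNormal` to λ²; this gives the
term λ²u_ab. The Christoffel symbols are written through the coframe, since the metric is the sum of
the squares of the coframe and does not depend on z. Everything becomes polynomial in x, y, λ and
the derivatives of u. -/
theorem secondForm_graphMap {κ τ : ℝ} {u : Coord 2 → ℝ} {Ω : Set (Coord 2)} (hΩ : IsOpen Ω)
    (hu : ContDiffOn ℝ 2 u Ω) {p : Coord 2} (hp : p ∈ Ω) (hpb : p ∈ baseSet κ) (c : ℝ)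
    (a b : Fin 2) :
    secondForm (spaceMetric κ τ) (graphMap u) (c • graphNormal κ τ u p) a b p =
      c * (lam κ p ^ 2 * pd a (pd b u) p + ∑ i, ∑ j, ∑ k,
        (1 / 2 * (∑ m, (coframe τ (p 0) (p 1) (lam κ p) m j *
          dcoframe κ τ (p 0) (p 1) (lam κ p) i m k +
        coframe τ (p 0) (p 1) (lam κ p) m k *
          dcoframe κ τ (p 0) (p 1) (lam κ p) i m j) +
        ∑ m, (coframe τ (p 0) (p 1) (lam κ p) m i *
          dcoframe κ τ (p 0) (p 1) (lam κ p) j m k +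
        coframe τ (p 0) (p 1) (lam κ p) m k *
          dcoframe κ τ (p 0) (p 1) (lam κ p) j m i) -
        ∑ m, (coframe τ (p 0) (p 1) (lam κ p) m i *
          dcoframe κ τ (p 0) (p 1) (lam κ p) k m j +
        coframe τ (p 0) (p 1) (lam κ p) m j *
          dcoframe κ τ (p 0) (p 1) (lam κ p) k m i))) *
        (graphLin (coordVec a) + pd a u p • (coordVec 2 : Coord 3)) i *
        (graphLin (coordVec b) + pd b u p • (coordVec 2 : Coord 3)) j *
        graphNormal κ τ u p k) := by
  have hd : DifferentiableAt ℝ u p := (hu.contDiffAt (hΩ.mem_nhds hp)).differentiableAt (by simp)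
  have hps : graphMap u p ∈ spaceSet κ := by
    simpa [graphMap, spaceSet, baseSet] using hpb
  have hc : conf κ (p 0) (p 1) = lam κ p := rfl
  rw [secondForm, pd_pd_graphMap hΩ hu hp, pd_graphMap hd, pd_graphMap hd, mul_add, Finset.mul_sum]
  congr 1
  · simp [spaceMetric, frameCoeff, Fin.sum_univ_three, graphMap, coordVec,
        graphNormal, hc, -mul_eq_mul_left_iff, -mul_eq_mul_right_iff]
    ring
  · refine Finset.sum_congr rfl fun i _ => ?_
    rw [Finset.mul_sum]
    refine Finset.sum_congr rfl fun j _ => ?_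
    rw [Finset.mul_sum]
    refine Finset.sum_congr rfl fun k _ => ?_
    simp only [christoffel, pd_spaceMetric hps]
    simp only [graphMap, PiLp.smul_apply, smul_eq_mul, Matrix.cons_val_zero, Matrix.cons_val_one,
      hc]
    ring

/-- The numerator of the mean curvature of a graph, expressed by the divergence of the flux. -/
theorem numerator_identity (κ τ x y L a b ux uy uxx uxy uyy : ℝ)
    (ha : a = ux + τ * L * y) (hb : b = uy - τ * L * x)
    (S : Fin 2 → Fin 2 → ℝ) (D2 : Fin 2 → Fin 2 → ℝ) (F : Fin 2 → Fin 3 → ℝ) (N : Fin 3 → ℝ)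
    (hD2 : D2 = ![![uxx, uxy], ![uxy, uyy]]) (hF : F = ![![1, 0, ux], ![0, 1, uy]])
    (hN : N = ![-a, -b, L ^ 2 + τ * L * (y * a - x * b)])
    (hS : ∀ r s, S r s = L ^ 2 * D2 r s + ∑ i, ∑ j, ∑ k,
        (1 / 2 * (∑ m, (coframe τ x y L m j * dcoframe κ τ x y L i m k +
          coframe τ x y L m k * dcoframe κ τ x y L i m j) +
        ∑ m, (coframe τ x y L m i * dcoframe κ τ x y L j m k +
          coframe τ x y L m k * dcoframe κ τ x y L j m i) -
        ∑ m, (coframe τ x y L m i * dcoframe κ τ x y L k m j +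
          coframe τ x y L m j * dcoframe κ τ x y L k m i))) *
        F r i * F s j * N k) :
    (L ^ 2 + b ^ 2) * S 0 0 - 2 * (a * b) * S 0 1 + (L ^ 2 + a ^ 2) * S 1 1 =
    L * ((L ^ 2 + a ^ 2 + b ^ 2) * ((-κ / 2 * L ^ 2 * x) * a
        + L * (uxx + τ * (-κ / 2 * L ^ 2 * x) * y)
        + (-κ / 2 * L ^ 2 * y) * b + L * (uyy - τ * (-κ / 2 * L ^ 2 * y) * x))
      - L * (a * (L * (-κ / 2 * L ^ 2 * x) + a * (uxx + τ * (-κ / 2 * L ^ 2 * x) * y)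
          + b * (uxy - τ * (-κ / 2 * L ^ 2 * x * x + L)))
        + b * (L * (-κ / 2 * L ^ 2 * y) + a * (uxy + τ * (-κ / 2 * L ^ 2 * y * y + L))
          + b * (uyy - τ * (-κ / 2 * L ^ 2 * y) * x)))) := by
  have e0 : dlam κ x y L (0 : Fin 3) = -κ / 2 * L ^ 2 * x := by simp [dlam, coordVec]
  have e1 : dlam κ x y L (1 : Fin 3) = -κ / 2 * L ^ 2 * y := by simp [dlam, coordVec]
  have e2 : dlam κ x y L (2 : Fin 3) = 0 := by simp [dlam, coordVec]
  have c : ∀ i j : Fin 3, (coordVec i : Coord 3) j = if j = i then 1 else 0 := fun i j => by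
    simp [coordVec]
  -- Here L is a free variable: of the conformal factor only its derivative, recorded in `dlam`,
  -- enters, so after eliminating the derivatives of u a polynomial identity remains.
  have hux : ux = a - τ * L * y := by rw [ha]; ring
  have huy : uy = b + τ * L * x := by rw [hb]; ring
  clear ha hb
  subst hux huy
  simp only [hS, hD2, hF, hN, Fin.sum_univ_three]
  simp only [coframe, dcoframe, e0, e1, e2, c]
  simp
  ring

theorem pd_mul {n : ℕ} {f g : Coord n → ℝ} {p : Coord n} (hf : DifferentiableAt ℝ f p)
    (hg : DifferentiableAt ℝ g p) (i : Fin n) :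
    pd i (fun q => f q * g q) p = f p * pd i g p + g p * pd i f p := by
  rw [pd, (hf.hasFDerivAt.fun_mul hg.hasFDerivAt).fderiv]
  simp [pd]

theorem pd_add {n : ℕ} {f g : Coord n → ℝ} {p : Coord n} (hf : DifferentiableAt ℝ f p)
    (hg : DifferentiableAt ℝ g p) (i : Fin n) :
    pd i (fun q => f q + g q) p = pd i f p + pd i g p := by
  rw [pd, (hf.hasFDerivAt.fun_add hg.hasFDerivAt).fderiv]
  simp [pd]

theorem pd_const {n : ℕ} (c : ℝ) (p : Coord n) (i : Fin n) : pd i (fun _ => c) p = 0 := by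
  simp [pd]

theorem pd_coord {n : ℕ} (p : Coord n) (i j : Fin n) :
    pd i (fun q : Coord n => q j) p = if j = i then 1 else 0 := by
  rw [pd, (hasFDerivAt_coord j p).fderiv]
  simp [coordVec]

theorem differentiableAt_lam {κ : ℝ} {p : Coord 2} (hp : p ∈ baseSet κ) :
    DifferentiableAt ℝ (lam κ : Coord 2 → ℝ) p :=
  (hasFDerivAt_conf (n := 2) hp).differentiableAt

theorem pd_lam {κ : ℝ} {p : Coord 2} (hp : p ∈ baseSet κ) (i : Fin 2) :
    pd i (lam κ) p = -κ / 2 * lam κ p ^ 2 * p i := by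
  have : pd i (lam κ) p = pd i (fun q : Coord 2 => conf κ (q 0) (q 1)) p := rfl
  rw [this, pd, (hasFDerivAt_conf (n := 2) hp).fderiv]
  fin_cases i <;> simp [coordVec, lam]

theorem contDiffAt_coord {n : ℕ} (j : Fin n) (p : Coord n) {m : WithTop ℕ∞} :
    ContDiffAt ℝ m (fun q : Coord n => q j) p :=
  (EuclideanSpace.proj j : Coord n →L[ℝ] ℝ).contDiff.contDiffAt

theorem contDiffAt_lam {κ : ℝ} {p : Coord 2} (hp : p ∈ baseSet κ) {m : WithTop ℕ∞} :
    ContDiffAt ℝ m (lam κ : Coord 2 → ℝ) p :=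
  (contDiffAt_const.add (contDiffAt_const.mul
    (((contDiffAt_coord 0 p).pow 2).add ((contDiffAt_coord 1 p).pow 2)))).inv (ne_of_gt hp)

theorem contDiffAt_pd {u : Coord 2 → ℝ} {p : Coord 2} (hu : ContDiffAt ℝ 2 u p) (i : Fin 2) :
    ContDiffAt ℝ 1 (pd i u) p :=
  (hu.fderiv_right (m := 1) (by norm_num)).clm_apply contDiffAt_const

theorem contDiffAt_gradX {κ : ℝ} (τ : ℝ) {u : Coord 2 → ℝ} {p : Coord 2} (hp : p ∈ baseSet κ)
    (hu : ContDiffAt ℝ 2 u p) : ContDiffAt ℝ 1 (gradX κ τ u) p :=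
  (contDiffAt_pd hu 0).add ((contDiffAt_const.mul (contDiffAt_lam hp)).mul (contDiffAt_coord 1 p))

theorem contDiffAt_gradY {κ : ℝ} (τ : ℝ) {u : Coord 2 → ℝ} {p : Coord 2} (hp : p ∈ baseSet κ)
    (hu : ContDiffAt ℝ 2 u p) : ContDiffAt ℝ 1 (gradY κ τ u) p :=
  (contDiffAt_pd hu 1).sub ((contDiffAt_const.mul (contDiffAt_lam hp)).mul (contDiffAt_coord 0 p))

theorem contDiffAt_slope {κ : ℝ} (τ : ℝ) {u : Coord 2 → ℝ} {p : Coord 2} (hp : p ∈ baseSet κ)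
    (hu : ContDiffAt ℝ 2 u p) : ContDiffAt ℝ 1 (slope κ τ u) p := by
  have h := slope_pos τ u hp
  exact ((((contDiffAt_lam hp).pow 2).add ((contDiffAt_gradX τ hp hu).pow 2)).add
    ((contDiffAt_gradY τ hp hu).pow 2)).sqrt (Real.sqrt_pos.1 h).ne'

theorem contDiffAt_fluxX {κ : ℝ} (τ : ℝ) {u : Coord 2 → ℝ} {p : Coord 2} (hp : p ∈ baseSet κ)
    (hu : ContDiffAt ℝ 2 u p) : ContDiffAt ℝ 1 (fluxX κ τ u) p :=
  ((contDiffAt_lam hp).mul (contDiffAt_gradX τ hp hu)).div (contDiffAt_slope τ hp hu)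
    (slope_pos τ u hp).ne'

theorem contDiffAt_fluxY {κ : ℝ} (τ : ℝ) {u : Coord 2 → ℝ} {p : Coord 2} (hp : p ∈ baseSet κ)
    (hu : ContDiffAt ℝ 2 u p) : ContDiffAt ℝ 1 (fluxY κ τ u) p :=
  ((contDiffAt_lam hp).mul (contDiffAt_gradY τ hp hu)).div (contDiffAt_slope τ hp hu)
    (slope_pos τ u hp).ne'

theorem isOpen_baseSet (κ : ℝ) : IsOpen (baseSet κ) := by
  unfold baseSet
  exact isOpen_lt continuous_const (by fun_prop)

/-- The minimal surface equation in divergence form. -/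
theorem IsMinimalGraph.div_flux {κ τ : ℝ} {Ω : Set (Coord 2)} {u : Coord 2 → ℝ}
    (h : IsMinimalGraph κ τ Ω u) {p : Coord 2} (hp : p ∈ Ω) :
    pd 0 (fluxX κ τ u) p + pd 1 (fluxY κ τ u) p = 0 := by
  have hpb : p ∈ baseSet κ := h.subset hp
  have hu : ContDiffAt ℝ 2 u p := h.contDiffOn.contDiffAt (h.isOpen.mem_nhds hp)
  have hd : DifferentiableAt ℝ u p := hu.differentiableAt (by simp)
  have hL : 0 < lam κ p := conf_pos hpb
  have hV := slope_pos τ u hpb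
  have hH := h.meanCurvature_eq_zero p hp _ (isUnitNormal_graphNormal τ hpb hd)
  obtain ⟨f00, f01, f11⟩ := firstForm_graphMap κ τ hd
  rw [meanCurvature, gramDet_graphMap κ τ hd, f00, f01, f11,
    div_eq_zero_iff, or_iff_left (by positivity)] at hH
  have hS := secondForm_graphMap (τ := τ) h.isOpen h.contDiffOn hp hpb
  obtain ⟨S, hS'⟩ : ∃ S : Fin 2 → Fin 2 → ℝ, ∀ r s,
    secondForm (spaceMetric κ τ) (graphMap u) ((1 : ℝ) • graphNormal κ τ u p) r s p = S r s :=
    ⟨_, fun _ _ => rfl⟩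
  have hS'' : ∀ (c : ℝ) r s, secondForm (spaceMetric κ τ) (graphMap u)
      (c • graphNormal κ τ u p) r s p = c * S r s := fun c r s => by
    rw [← hS', hS, hS, one_mul]
  have key := numerator_identity κ τ (p 0) (p 1) (lam κ p) (gradX κ τ u p) (gradY κ τ u p)
    (pd 0 u p) (pd 1 u p) (pd 0 (pd 0 u) p) (pd 0 (pd 1 u) p) (pd 1 (pd 1 u) p) rfl rfl
    S (fun r s => pd r (pd s u) p)
    (fun r => graphLin (coordVec r) + pd r u p • (coordVec 2 : Coord 3))
    (graphNormal κ τ u p)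
    (by funext r s; fin_cases r <;> fin_cases s <;> simp [pd_comm hu 1 0])
    (by funext r s; fin_cases r <;> fin_cases s <;> simp [graphLin_apply, coordVec])
    rfl (fun r s => by rw [← hS', hS, one_mul]; rfl)
  rw [hS'', hS'', hS''] at hH
  have hc : (lam κ p * slope κ τ u p)⁻¹ ≠ 0 := by positivity
  have hH2 := (mul_eq_zero.1 (show (lam κ p * slope κ τ u p)⁻¹ *
    ((lam κ p ^ 2 + gradY κ τ u p ^ 2) * S 0 0 - 2 * (gradX κ τ u p * gradY κ τ u p) * S 0 1 +
      (lam κ p ^ 2 + gradX κ τ u p ^ 2) * S 1 1) = 0 by rw [← hH]; ring)).resolve_left hc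
  rw [key] at hH2
  clear hH key hc
  have dl := differentiableAt_lam hpb
  have dX := (contDiffAt_gradX τ hpb hu).differentiableAt one_ne_zero
  have dY := (contDiffAt_gradY τ hpb hu).differentiableAt one_ne_zero
  have dV := (contDiffAt_slope τ hpb hu).differentiableAt one_ne_zero
  have dP := (contDiffAt_fluxX τ hpb hu).differentiableAt one_ne_zero
  have dQ := (contDiffAt_fluxY τ hpb hu).differentiableAt one_ne_zero
  have dc : ∀ j : Fin 2, DifferentiableAt ℝ (fun q : Coord 2 => q j) p :=
    fun j => (hasFDerivAt_coord j p).differentiableAt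
  have hX : ∀ i, pd i (gradX κ τ u) p = pd i (pd 0 u) p +
      τ * (pd i (lam κ) p * p 1 + lam κ p * if (1 : Fin 2) = i then 1 else 0) := by
    intro i
    have e : gradX κ τ u = fun q => pd 0 u q + (fun _ => τ) q * (lam κ q * q 1) := by
      funext q; simp only [gradX]; ring
    rw [e, pd_add (differentiableAt_pd hu 0) ((differentiableAt_const _).fun_mul (dl.fun_mul (dc 1))),
      pd_mul (differentiableAt_const _) (dl.fun_mul (dc 1)), pd_mul dl (dc 1), pd_const, pd_coord]
    ring
  have hY : ∀ i, pd i (gradY κ τ u) p = pd i (pd 1 u) p -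
      τ * (pd i (lam κ) p * p 0 + lam κ p * if (0 : Fin 2) = i then 1 else 0) := by
    intro i
    have e : gradY κ τ u = fun q => pd 1 u q + (fun _ => -τ) q * (lam κ q * q 0) := by
      funext q; simp only [gradY]; ring
    rw [e, pd_add (differentiableAt_pd hu 1) ((differentiableAt_const _).fun_mul (dl.fun_mul (dc 0))),
      pd_mul (differentiableAt_const _) (dl.fun_mul (dc 0)), pd_mul dl (dc 0), pd_const, pd_coord]
    ring
  -- The derivatives of V and of the flux are obtained by differentiating V² and the products PV,
  -- QV, which avoids differentiating a root or a quotient.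
  have hVi : ∀ i, slope κ τ u p * pd i (slope κ τ u) p = lam κ p * pd i (lam κ) p +
      gradX κ τ u p * pd i (gradX κ τ u) p + gradY κ τ u p * pd i (gradY κ τ u) p := by
    intro i
    have e : (fun q => slope κ τ u q * slope κ τ u q) = fun q => (lam κ q * lam κ q +
        gradX κ τ u q * gradX κ τ u q) + gradY κ τ u q * gradY κ τ u q := by
      funext q; rw [← sq, slope_sq]; ring
    have e2 := congrArg (fun f => pd i f p) e
    rw [pd_mul dV dV, pd_add ((dl.fun_mul dl).fun_add (dX.fun_mul dX)) (dY.fun_mul dY),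
      pd_add (dl.fun_mul dl) (dX.fun_mul dX), pd_mul dl dl, pd_mul dX dX, pd_mul dY dY] at e2
    linarith
  have hPV : ∀ q ∈ baseSet κ, fluxX κ τ u q * slope κ τ u q = lam κ q * gradX κ τ u q :=
    fun q hq => div_mul_cancel₀ _ (slope_pos τ u hq).ne'
  have hQV : ∀ q ∈ baseSet κ, fluxY κ τ u q * slope κ τ u q = lam κ q * gradY κ τ u q :=
    fun q hq => div_mul_cancel₀ _ (slope_pos τ u hq).ne'
  have hPi : pd 0 (fun q => fluxX κ τ u q * slope κ τ u q) p =
      pd 0 (fun q => lam κ q * gradX κ τ u q) p := by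
    rw [pd, pd, Filter.EventuallyEq.fderiv_eq
      (eventually_of_mem ((isOpen_baseSet κ).mem_nhds hpb) hPV)]
  have hQi : pd 1 (fun q => fluxY κ τ u q * slope κ τ u q) p =
      pd 1 (fun q => lam κ q * gradY κ τ u q) p := by
    rw [pd, pd, Filter.EventuallyEq.fderiv_eq
      (eventually_of_mem ((isOpen_baseSet κ).mem_nhds hpb) hQV)]
  rw [pd_mul dP dV, pd_mul dl dX] at hPi
  rw [pd_mul dQ dV, pd_mul dl dY] at hQi
  have hP0 := hPV p hpb
  have hQ0 := hQV p hpb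
  have hV2 := slope_sq κ τ u p
  have hX0 := hX 0
  have hY1 := hY 1
  have hV0 := hVi 0
  have hV1 := hVi 1
  rw [hX 0, hY 0] at hV0
  rw [hX 1, hY 1] at hV1
  rw [hX0] at hPi
  rw [hY1] at hQi
  rw [pd_comm hu 1 0] at hV1
  simp only [pd_lam hpb, if_true, mul_one, Fin.isValue, zero_ne_one, one_ne_zero, if_false,
    mul_zero, add_zero] at hPi hQi hV0 hV1
  generalize pd 0 (fluxX κ τ u) p = Px at *
  generalize pd 1 (fluxY κ τ u) p = Qy at *
  generalize pd 0 (slope κ τ u) p = Vx at *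
  generalize pd 1 (slope κ τ u) p = Vy at *
  generalize slope κ τ u p = V at *
  generalize fluxX κ τ u p = P at *
  generalize fluxY κ τ u p = Q at *
  generalize gradX κ τ u p = a at *
  generalize gradY κ τ u p = b at *
  generalize lam κ p = L at *
  rw [← hV2] at hH2
  -- The numerator of the mean curvature is exactly λV³ times the divergence of the flux.
  have hfin : (L * V ^ 3) * (Px + Qy) = 0 := by
    rw [← hH2]
    linear_combination L * V ^ 2 * hPi + L * V ^ 2 * hQi - L * V * Vx * hP0 - L * V * Vy * hQ0
      - L * L * a * hV0 - L * L * b * hV1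
  exact (mul_eq_zero.1 hfin).resolve_left (by positivity)


/-! ### Testing the minimal surface equation -/

theorem continuous_pd {f : Coord 2 → ℝ} (hf : ContDiff ℝ 1 f) (i : Fin 2) :
    Continuous (pd i f) :=
  (hf.continuous_fderiv one_ne_zero).clm_apply continuous_const

theorem integral_pd_eq_zero {f : Coord 2 → ℝ} (hf : ContDiff ℝ 1 f)
    (hs : HasCompactSupport f) (i : Fin 2) : ∫ p, pd i f p = 0 := by
  have h := integral_mul_fderiv_eq_neg_fderiv_mul_of_integrable (μ := volume)
    (f := fun _ : Coord 2 => (1 : ℝ)) (g := f) (v := coordVec i) (by simp)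
    (by
      simp only [one_mul]
      exact (continuous_pd hf i).integrable_of_hasCompactSupport
        (hs.fderiv_apply (𝕜 := ℝ) (coordVec i)))
    (by simpa using hf.continuous.integrable_of_hasCompactSupport hs)
    (fun _ _ => differentiableAt_const _)
    (fun _ _ => (hf.differentiable one_ne_zero).differentiableAt)
  simpa [pd] using h

theorem pd_eq_zero_of_eventually {f : Coord 2 → ℝ} {p : Coord 2} (h : ∀ᶠ q in 𝓝 p, f q = 0)
    (i : Fin 2) : pd i f p = 0 := by
  have : f =ᶠ[𝓝 p] fun _ => 0 := h
  rw [pd, this.fderiv_eq]; simp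

theorem indicator_eventually_zero {O K : Set (Coord 2)} (hK : IsClosed K) {f : Coord 2 → ℝ}
    (h0 : ∀ p ∈ O \ K, f p = 0) {p : Coord 2} (hp : p ∉ K) :
    ∀ᶠ q in 𝓝 p, O.indicator f q = 0 := by
  filter_upwards [hK.isOpen_compl.mem_nhds hp] with q hq
  by_cases hqO : q ∈ O
  · rw [indicator_of_mem hqO, h0 q ⟨hqO, hq⟩]
  · exact indicator_of_notMem hqO f

/-- O and the complement of K are open and cover the plane; the extension by zero agrees with f on
the first and vanishes on the second. -/
theorem contDiff_indicator {O K : Set (Coord 2)} (hO : IsOpen O) (hK : IsClosed K) (hKO : K ⊆ O)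
    {f : Coord 2 → ℝ} (hf : ContDiffOn ℝ 1 f O) (h0 : ∀ p ∈ O \ K, f p = 0) :
    ContDiff ℝ 1 (O.indicator f) := by
  rw [contDiff_iff_contDiffAt]
  intro p
  by_cases hp : p ∈ O
  · refine (hf.contDiffAt (hO.mem_nhds hp)).congr_of_eventuallyEq ?_
    filter_upwards [hO.mem_nhds hp] with q hq using indicator_of_mem hq f
  · exact (contDiffAt_const (c := (0 : ℝ))).congr_of_eventuallyEq
      (indicator_eventually_zero hK h0 fun h => hp (hKO h))

/-- The function need not be defined sensibly outside O, so the divergence theorem is applied to its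
extension by zero. Integrating over the compact K makes integrability automatic. -/
theorem setIntegral_pd_eq_zero {O K : Set (Coord 2)} (hO : IsOpen O) (hK : IsCompact K)
    (hKO : K ⊆ O) {f : Coord 2 → ℝ} (hf : ContDiffOn ℝ 1 f O) (h0 : ∀ p ∈ O \ K, f p = 0)
    (i : Fin 2) : IntegrableOn (pd i f) K ∧ ∫ p in K, pd i f p = 0 := by
  have hc := contDiff_indicator hO hK.isClosed hKO hf h0
  have hs : HasCompactSupport (O.indicator f) := by
    refine HasCompactSupport.intro hK fun p hp => ?_
    exact (indicator_eventually_zero hK.isClosed h0 hp).self_of_nhds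
  have he : ∀ p ∈ K, pd i f p = pd i (O.indicator f) p := by
    intro p hp
    rw [pd, pd, Filter.EventuallyEq.fderiv_eq]
    filter_upwards [hO.mem_nhds (hKO hp)] with q hq using (indicator_of_mem hq f).symm
  constructor
  · exact ((continuous_pd hc i).continuousOn.integrableOn_compact hK).congr_fun
      (fun p hp => (he p hp).symm) hK.measurableSet
  · rw [setIntegral_congr_fun hK.measurableSet he, setIntegral_eq_integral_of_forall_compl_eq_zero,
      integral_pd_eq_zero hc hs]
    exact fun p hp => pd_eq_zero_of_eventually (indicator_eventually_zero hK.isClosed h0 hp) i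

/-- A divergence free field is orthogonal to gradients of compactly supported functions. -/
theorem integral_divFree_eq_zero {O K : Set (Coord 2)} (hO : IsOpen O) (hK : IsCompact K)
    (hKO : K ⊆ O) {P Q ψ : Coord 2 → ℝ} (hP : ContDiffOn ℝ 1 P O) (hQ : ContDiffOn ℝ 1 Q O)
    (hdiv : ∀ p ∈ O, pd 0 P p + pd 1 Q p = 0) (hψ : ContDiffOn ℝ 1 ψ O)
    (h0 : ∀ p ∈ O \ K, ψ p = 0) :
    ∫ p in K, (P p * pd 0 ψ p + Q p * pd 1 ψ p) = 0 := by
  obtain ⟨i1, e1⟩ := setIntegral_pd_eq_zero hO hK hKO (hψ.mul hP)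
    (fun p hp => by simp [h0 p hp]) 0
  obtain ⟨i2, e2⟩ := setIntegral_pd_eq_zero hO hK hKO (hψ.mul hQ)
    (fun p hp => by simp [h0 p hp]) 1
  have e12 := integral_add i1 i2
  rw [e1, e2, add_zero] at e12
  rw [← e12]
  refine setIntegral_congr_fun hK.measurableSet fun p hp => ?_
  have dP := (hP.contDiffAt (hO.mem_nhds (hKO hp))).differentiableAt one_ne_zero
  have dQ := (hQ.contDiffAt (hO.mem_nhds (hKO hp))).differentiableAt one_ne_zero
  have dψ := (hψ.contDiffAt (hO.mem_nhds (hKO hp))).differentiableAt one_ne_zero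
  have a := pd_mul dψ dP 0
  have b := pd_mul dψ dQ 1
  have c := hdiv p (hKO hp)
  rw [a, b]
  linear_combination -ψ p * c

theorem norm_sq_coord (p : Coord 2) : ‖p‖ ^ 2 = p 0 ^ 2 + p 1 ^ 2 := by
  simp [EuclideanSpace.norm_sq_eq]

/-- The flux is λ times the vector (a, b)/V, and a² + b² ≤ V². -/
theorem flux_sq_le {κ : ℝ} (τ : ℝ) (u : Coord 2 → ℝ) {p : Coord 2} (hp : p ∈ baseSet κ) :
    fluxX κ τ u p ^ 2 + fluxY κ τ u p ^ 2 ≤ lam κ p ^ 2 := by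
  have hV := slope_pos τ u hp
  have h := slope_sq κ τ u p
  rw [fluxX, fluxY, div_pow, div_pow, ← add_div, div_le_iff₀ (by positivity), h]
  nlinarith [sq_nonneg (lam κ p ^ 2)]

theorem abs_flux_fderiv_le {κ : ℝ} (τ : ℝ) (u η : Coord 2 → ℝ) {p : Coord 2} (hp : p ∈ baseSet κ) :
    |fluxX κ τ u p * pd 0 η p + fluxY κ τ u p * pd 1 η p| ≤ lam κ p * ‖fderiv ℝ η p‖ := by
  have hL : 0 < lam κ p := conf_pos hp
  have h : fluxX κ τ u p * pd 0 η p + fluxY κ τ u p * pd 1 η p =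
      fderiv ℝ η p (fluxX κ τ u p • coordVec 0 + fluxY κ τ u p • coordVec 1) := by
    simp [pd]
  rw [h, ← Real.norm_eq_abs]
  refine (ContinuousLinearMap.le_opNorm _ _).trans ?_
  rw [mul_comm]
  refine mul_le_mul_of_nonneg_right (abs_le_of_sq_le_sq' ?_ hL.le).2 (norm_nonneg _)
  rw [norm_sq_coord]
  simpa [coordVec] using flux_sq_le τ u hp

/-- Write λV = λV²/V = λ³/V + Pa + Qb with (P, Q) the flux. The first term is at most λ² because V ≥
λ. Replacing a, b by u_x, u_y costs τλ(yP − xQ), at most |τ|λ²‖p‖ by Cauchy–Schwarz. -/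
theorem area_le_flux {κ : ℝ} (τ : ℝ) (u : Coord 2 → ℝ) {p : Coord 2} (hp : p ∈ baseSet κ) :
    lam κ p * slope κ τ u p ≤ fluxX κ τ u p * pd 0 u p + fluxY κ τ u p * pd 1 u p +
      lam κ p ^ 2 * (1 + |τ| * ‖p‖) := by
  have hL : 0 < lam κ p := conf_pos hp
  have hV := slope_pos τ u hp
  have h2 := slope_sq κ τ u p
  have hLV : lam κ p ≤ slope κ τ u p := by
    refine (abs_le_of_sq_le_sq' ?_ hV.le).2
    rw [h2]; nlinarith [sq_nonneg (gradX κ τ u p), sq_nonneg (gradY κ τ u p)]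
  have h3 : lam κ p * slope κ τ u p = lam κ p ^ 3 / slope κ τ u p +
      fluxX κ τ u p * gradX κ τ u p + fluxY κ τ u p * gradY κ τ u p := by
    rw [fluxX, fluxY]
    field_simp
    rw [h2]
  have h4 : lam κ p ^ 3 / slope κ τ u p ≤ lam κ p ^ 2 := by
    rw [div_le_iff₀ hV, pow_succ]
    exact mul_le_mul_of_nonneg_left hLV (by positivity)
  have h5 : |p 1 * fluxX κ τ u p - p 0 * fluxY κ τ u p| ≤ ‖p‖ * lam κ p := by
    refine abs_le_of_sq_le_sq ?_ (by positivity)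
    have h6 := flux_sq_le τ u hp
    rw [mul_pow, norm_sq_coord]
    have h7 := mul_le_mul_of_nonneg_left h6 (add_nonneg (sq_nonneg (p 0)) (sq_nonneg (p 1)))
    -- Lagrange's identity: (yP − xQ)² + (xP + yQ)² = (x² + y²)(P² + Q²).
    nlinarith [sq_nonneg (p 0 * fluxX κ τ u p + p 1 * fluxY κ τ u p)]
  have h8 : τ * lam κ p * (p 1 * fluxX κ τ u p - p 0 * fluxY κ τ u p) ≤
      |τ| * lam κ p * (‖p‖ * lam κ p) := by
    refine (le_abs_self _).trans ?_
    rw [abs_mul, abs_mul, abs_of_pos hL]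
    gcongr
  rw [h3]
  simp only [gradX, gradY]
  nlinarith

/-- The basic area estimate: the result of testing the minimal surface equation with the
function `η T(u)`. -/
theorem area_estimate {κ τ : ℝ} {O K : Set (Coord 2)} {u η : Coord 2 → ℝ} (hO : IsOpen O)
    (hb : O ⊆ baseSet κ) (hu : ContDiffOn ℝ 2 u O)
    (hdiv : ∀ p ∈ O, pd 0 (fluxX κ τ u) p + pd 1 (fluxY κ τ u) p = 0)
    (hη : ContDiffOn ℝ 1 η O) (hη0 : ∀ p ∈ O, 0 ≤ η p) (hη1 : ∀ p ∈ O, η p ≤ 1)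
    {T T' : ℝ → ℝ} {H : ℝ} (hT : ∀ s, HasDerivAt T (T' s) s) (hT' : Continuous T')
    (hT0 : ∀ s, 0 ≤ T' s) (hT1 : ∀ s, T' s ≤ 1) (hTH : ∀ s, |T s| ≤ H)
    (hK : IsCompact K) (hKO : K ⊆ O) (h0 : ∀ p ∈ O \ K, η p * T (u p) = 0) :
    ∫⁻ p in K, ENNReal.ofReal (η p * T' (u p) * (lam κ p * slope κ τ u p)) ≤
      (∫⁻ p in K, ENNReal.ofReal (lam κ p ^ 2 * (1 + |τ| * ‖p‖))) +
        ENNReal.ofReal H * ∫⁻ p in K, ENNReal.ofReal (lam κ p * ‖fderiv ℝ η p‖) := by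
  have hH : 0 ≤ H := (abs_nonneg _).trans (hTH 0)
  have hua : ∀ p ∈ O, ContDiffAt ℝ 2 u p := fun p hp => hu.contDiffAt (hO.mem_nhds hp)
  have hTc : ContDiff ℝ 1 T := contDiff_one_iff_deriv.2
    ⟨fun s => (hT s).differentiableAt, by
      rw [show deriv T = T' from funext fun s => (hT s).deriv]; exact hT'⟩
  have hψ : ContDiffOn ℝ 1 (fun p => η p * T (u p)) O :=
    hη.mul (hTc.comp_contDiffOn (hu.of_le (by norm_num)))
  have key := integral_divFree_eq_zero hO hK hKO
    (fun p hp => (contDiffAt_fluxX τ (hb hp) (hua p hp)).contDiffWithinAt)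
    (fun p hp => (contDiffAt_fluxY τ (hb hp) (hua p hp)).contDiffWithinAt) hdiv hψ h0
  have cη : ContinuousOn (fun p => fderiv ℝ η p) K :=
    (hη.continuousOn_fderiv_of_isOpen hO le_rfl).mono hKO
  have cψ : ContinuousOn (fun p => fderiv ℝ (fun p => η p * T (u p)) p) K :=
    (hψ.continuousOn_fderiv_of_isOpen hO le_rfl).mono hKO
  have cl : ContinuousOn (lam κ : Coord 2 → ℝ) K := fun p hp =>
    (contDiffAt_lam (m := 1) (hb (hKO hp))).continuousAt.continuousWithinAt
  have cV : ContinuousOn (slope κ τ u) K := fun p hp =>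
    (contDiffAt_slope τ (hb (hKO hp)) (hua p (hKO hp))).continuousAt.continuousWithinAt
  have cP : ContinuousOn (fluxX κ τ u) K := fun p hp =>
    (contDiffAt_fluxX τ (hb (hKO hp)) (hua p (hKO hp))).continuousAt.continuousWithinAt
  have cQ : ContinuousOn (fluxY κ τ u) K := fun p hp =>
    (contDiffAt_fluxY τ (hb (hKO hp)) (hua p (hKO hp))).continuousAt.continuousWithinAt
  have cT : ContinuousOn (fun p => T' (u p)) K :=
    hT'.comp_continuousOn (hu.continuousOn.mono hKO)
  have f1 : IntegrableOn (fun p => η p * T' (u p) * (lam κ p * slope κ τ u p)) K :=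
    (((hη.continuousOn.mono hKO).mul cT).mul (cl.mul cV)).integrableOn_compact hK
  have f2 : IntegrableOn (fun p => lam κ p ^ 2 * (1 + |τ| * ‖p‖)) K :=
    ((cl.pow 2).mul (by fun_prop)).integrableOn_compact hK
  have f3 : IntegrableOn (fun p => lam κ p * ‖fderiv ℝ η p‖) K :=
    (cl.mul cη.norm).integrableOn_compact hK
  have f4 : IntegrableOn (fun p => fluxX κ τ u p * pd 0 (fun p => η p * T (u p)) p +
      fluxY κ τ u p * pd 1 (fun p => η p * T (u p)) p) K :=
    ((cP.mul (cψ.clm_apply continuousOn_const)).add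
      (cQ.mul (cψ.clm_apply continuousOn_const))).integrableOn_compact hK
  have main : ∫ p in K, η p * T' (u p) * (lam κ p * slope κ τ u p) ≤
      (∫ p in K, lam κ p ^ 2 * (1 + |τ| * ‖p‖)) +
        H * ∫ p in K, lam κ p * ‖fderiv ℝ η p‖ := by
    -- The integrand `f4` has integral zero by `key`; adding it to the right-hand side reduces the
    -- claim to a pointwise inequality.
    have e1 := integral_add f2 f4
    have e2 := integral_add (f2.add f4) (f3.const_mul H)
    simp only [Pi.add_apply] at e2
    rw [e1, key, add_zero, integral_const_mul] at e2
    rw [← e2]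
    refine setIntegral_mono_on f1 ((f2.add f4).add (f3.const_mul H)) hK.measurableSet
      fun p hp => ?_
    have hpO := hKO hp
    have dη := (hη.contDiffAt (hO.mem_nhds hpO)).differentiableAt one_ne_zero
    have du := (hua p hpO).differentiableAt (by simp)
    have dT : HasFDerivAt (fun p => T (u p)) (T' (u p) • fderiv ℝ u p) p :=
      (hT (u p)).comp_hasFDerivAt p du.hasFDerivAt
    have e : ∀ i, pd i (fun p => η p * T (u p)) p = η p * (T' (u p) * pd i u p) +
        T (u p) * pd i η p := by
      intro i
      rw [pd_mul dη dT.differentiableAt, pd, dT.fderiv]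
      simp [pd]
    have a1 := area_le_flux τ u (hb hpO)
    have a2 := abs_flux_fderiv_le τ u η (hb hpO)
    have a3 : |T (u p)| * |fluxX κ τ u p * pd 0 η p + fluxY κ τ u p * pd 1 η p| ≤
        H * (lam κ p * ‖fderiv ℝ η p‖) :=
      mul_le_mul (hTH _) a2 (abs_nonneg _) hH
    rw [← abs_mul] at a3
    have a4 := neg_abs_le (T (u p) * (fluxX κ τ u p * pd 0 η p + fluxY κ τ u p * pd 1 η p))
    have m0 : 0 ≤ η p * T' (u p) := mul_nonneg (hη0 p hpO) (hT0 _)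
    have m1 : η p * T' (u p) ≤ 1 := mul_le_one₀ (hη1 p hpO) (hT0 _) (hT1 _)
    have a5 := mul_le_mul_of_nonneg_left a1 m0
    have a6 : η p * T' (u p) * (lam κ p ^ 2 * (1 + |τ| * ‖p‖)) ≤
        1 * (lam κ p ^ 2 * (1 + |τ| * ‖p‖)) := mul_le_mul_of_nonneg_right m1 (by positivity)
    rw [e 0, e 1]
    nlinarith
  have n1 : ∀ᵐ p ∂(volume.restrict K), 0 ≤ η p * T' (u p) * (lam κ p * slope κ τ u p) := by
    filter_upwards [ae_restrict_mem hK.measurableSet] with p hp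
    have : 0 < lam κ p := conf_pos (hb (hKO hp))
    have := slope_pos τ u (hb (hKO hp))
    have := hη0 p (hKO hp)
    have := hT0 (u p)
    positivity
  have n2 : ∀ᵐ p ∂(volume.restrict K), 0 ≤ lam κ p ^ 2 * (1 + |τ| * ‖p‖) :=
    .of_forall fun p => by positivity
  have n3 : ∀ᵐ p ∂(volume.restrict K), 0 ≤ lam κ p * ‖fderiv ℝ η p‖ := by
    filter_upwards [ae_restrict_mem hK.measurableSet] with p hp
    have : 0 < lam κ p := conf_pos (hb (hKO hp))
    positivity
  rw [← ofReal_integral_eq_lintegral_ofReal f1 n1, ← ofReal_integral_eq_lintegral_ofReal f2 n2,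
    ← ofReal_integral_eq_lintegral_ofReal f3 n3, ← ENNReal.ofReal_mul hH,
    ← ENNReal.ofReal_add (integral_nonneg_of_ae n2) (mul_nonneg hH (integral_nonneg_of_ae n3))]
  exact ENNReal.ofReal_le_ofReal main


/-! ### Distances -/

/-- The conformal factor at distance `r` from the origin, in coordinates. -/
def radConf (κ r : ℝ) : ℝ := (1 + κ / 4 * r ^ 2)⁻¹

/-- The geodesic distance to the origin of a point at coordinate distance `r`. -/
def radDist (κ r : ℝ) : ℝ := ∫ s in (0 : ℝ)..r, radConf κ s

/-- The admissible coordinate distances. -/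
def radSet (κ : ℝ) : Set ℝ := {r | 0 < 1 + κ / 4 * r ^ 2}

theorem isOpen_radSet (κ : ℝ) : IsOpen (radSet κ) := by
  unfold radSet
  exact isOpen_lt continuous_const (by fun_prop)

theorem radSet_of_sq_le {κ r s : ℝ} (hκ : κ ≤ 0) (hr : r ∈ radSet κ) (h : s ^ 2 ≤ r ^ 2) :
    s ∈ radSet κ := by
  have : 0 < 1 + κ / 4 * r ^ 2 := hr
  show 0 < 1 + κ / 4 * s ^ 2
  nlinarith

theorem mem_baseSet_iff {κ : ℝ} {p : Coord 2} : p ∈ baseSet κ ↔ ‖p‖ ∈ radSet κ := by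
  rw [radSet, baseSet, mem_ofPred_eq, mem_ofPred_eq, norm_sq_coord]

theorem lam_eq_radConf (κ : ℝ) (p : Coord 2) : lam κ p = radConf κ ‖p‖ := by
  rw [lam, conf, radConf, norm_sq_coord]

theorem radConf_pos {κ r : ℝ} (hr : r ∈ radSet κ) : 0 < radConf κ r := inv_pos.2 hr

theorem one_le_radConf {κ r : ℝ} (hκ : κ ≤ 0) (hr : r ∈ radSet κ) : 1 ≤ radConf κ r := by
  refine (one_le_inv₀ hr).2 ?_
  nlinarith [sq_nonneg r]

theorem hasDerivAt_radConf {κ r : ℝ} (hr : r ∈ radSet κ) :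
    HasDerivAt (radConf κ) (-κ / 2 * r * radConf κ r ^ 2) r := by
  have h : HasDerivAt (fun s : ℝ => 1 + κ / 4 * s ^ 2) (κ / 4 * (2 * r)) r := by
    simpa using ((hasDerivAt_pow 2 r).const_mul (κ / 4)).const_add 1
  refine (h.fun_inv (ne_of_gt hr)).congr_deriv ?_
  rw [radConf, div_eq_mul_inv, ← inv_pow]
  ring

theorem continuousOn_radConf (κ : ℝ) : ContinuousOn (radConf κ) (radSet κ) := fun _ hr =>
  (hasDerivAt_radConf hr).continuousAt.continuousWithinAt

theorem uIcc_subset_radSet {κ r : ℝ} (hκ : κ ≤ 0) (hr : r ∈ radSet κ) :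
    uIcc 0 r ⊆ radSet κ := by
  intro s hs
  refine radSet_of_sq_le hκ hr ?_
  rw [sq_le_sq]
  rcases le_total 0 r with h | h
  · rw [uIcc_of_le h] at hs; rw [abs_of_nonneg h, abs_of_nonneg hs.1]; exact hs.2
  · rw [uIcc_of_ge h] at hs; rw [abs_of_nonpos h, abs_of_nonpos hs.2]; linarith [hs.1]

theorem hasDerivAt_radDist {κ r : ℝ} (hκ : κ ≤ 0) (hr : r ∈ radSet κ) :
    HasDerivAt (radDist κ) (radConf κ r) r := by
  refine intervalIntegral.integral_hasDerivAt_right ?_ ?_ ?_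
  · exact ((continuousOn_radConf κ).mono (uIcc_subset_radSet hκ hr)).intervalIntegrable
  · exact (continuousOn_radConf κ).stronglyMeasurableAtFilter (isOpen_radSet κ) r hr
  · exact (hasDerivAt_radConf hr).continuousAt

theorem radDist_zero (κ : ℝ) : radDist κ 0 = 0 := by simp [radDist]

theorem Icc_subset_radSet {κ r s : ℝ} (hκ : κ ≤ 0) (hs : 0 ≤ s) (hr : r ∈ radSet κ) :
    Icc s r ⊆ radSet κ := fun _ ht =>
  radSet_of_sq_le hκ hr (pow_le_pow_left₀ (hs.trans ht.1) ht.2 2)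

/-- For κ ≤ 0 the conformal factor is at least one, so distance minus coordinate radius increases.
Monotonicity and injectivity of the radial distance both follow. -/
theorem radDist_sub_ge {κ r s : ℝ} (hκ : κ ≤ 0) (hs : 0 ≤ s) (hsr : s ≤ r) (hr : r ∈ radSet κ) :
    r - s ≤ radDist κ r - radDist κ s := by
  have hI := Icc_subset_radSet hκ hs hr
  have h : MonotoneOn (fun t => radDist κ t - t) (Icc s r) := by
    refine monotoneOn_of_hasDerivWithinAt_nonneg (f' := fun t => radConf κ t - 1)
      (convex_Icc s r) ?_ ?_ ?_
    · exact fun t ht => ((hasDerivAt_radDist hκ (hI ht)).sub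
        (hasDerivAt_id t)).continuousAt.continuousWithinAt
    · intro t ht
      exact ((hasDerivAt_radDist hκ (hI (interior_subset ht))).sub
        (hasDerivAt_id t)).hasDerivWithinAt
    · intro t ht
      have := one_le_radConf hκ (hI (interior_subset ht))
      linarith
  have := h (left_mem_Icc.2 hsr) (right_mem_Icc.2 hsr) hsr
  simp only at this
  linarith

theorem le_radDist {κ r : ℝ} (hκ : κ ≤ 0) (h : 0 ≤ r) (hr : r ∈ radSet κ) : r ≤ radDist κ r := by
  have := radDist_sub_ge hκ le_rfl h hr
  rw [radDist_zero] at this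
  linarith

theorem radDist_nonneg {κ r : ℝ} (hκ : κ ≤ 0) (h : 0 ≤ r) (hr : r ∈ radSet κ) : 0 ≤ radDist κ r :=
  h.trans (le_radDist hκ h hr)

theorem radDist_mono {κ r s : ℝ} (hκ : κ ≤ 0) (hs : 0 ≤ s) (hsr : s ≤ r) (hr : r ∈ radSet κ) :
    radDist κ s ≤ radDist κ r := by
  have := radDist_sub_ge hκ hs hsr hr
  linarith

theorem radDist_zero_left (r : ℝ) : radDist 0 r = r := by
  simp [radDist, radConf]

/-- For κ < 0 the coordinate disk has radius 2/√(−κ); for κ = 0 the left side vanishes. -/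
theorem sqrt_mul_le_two {κ r : ℝ} (hκ : κ ≤ 0) (hr : r ∈ radSet κ) : √(-κ) * r ≤ 2 := by
  have h1 : √(-κ) ^ 2 = -κ := Real.sq_sqrt (by linarith)
  have h2 : 0 < 1 + κ / 4 * r ^ 2 := hr
  refine (abs_le_of_sq_le_sq' ?_ (by norm_num)).2
  rw [mul_pow, h1]
  linarith

/-- The logarithmic derivative of λ is (−κ/2)rλ ≤ √(−κ)λ, that is, √(−κ) times the derivative of the
distance. This is the source of the exponential rate. -/
theorem radConf_le_exp {κ r : ℝ} (hκ : κ ≤ 0) (h : 0 ≤ r) (hr : r ∈ radSet κ) :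
    radConf κ r ≤ Real.exp (√(-κ) * radDist κ r) := by
  have hI := Icc_subset_radSet hκ le_rfl hr
  have hd : ∀ t ∈ Icc 0 r, HasDerivAt
      (fun t => radConf κ t * Real.exp (-(√(-κ) * radDist κ t)))
      (-κ / 2 * t * radConf κ t ^ 2 * Real.exp (-(√(-κ) * radDist κ t)) +
        radConf κ t * (Real.exp (-(√(-κ) * radDist κ t)) * -(√(-κ) * radConf κ t))) t :=
    fun t ht => (hasDerivAt_radConf (hI ht)).fun_mul
      (((hasDerivAt_radDist hκ (hI ht)).const_mul _).fun_neg.exp)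
  have hanti : AntitoneOn (fun t => radConf κ t * Real.exp (-(√(-κ) * radDist κ t))) (Icc 0 r) := by
    refine antitoneOn_of_hasDerivWithinAt_nonpos (convex_Icc 0 r)
      (fun t ht => (hd t ht).continuousAt.continuousWithinAt)
      (fun t ht => (hd t (interior_subset ht)).hasDerivWithinAt) ?_
    intro t ht
    have h1 := sqrt_mul_le_two hκ (hI (interior_subset ht))
    have h2 : √(-κ) ^ 2 = -κ := Real.sq_sqrt (by linarith)
    have h3 := Real.sqrt_nonneg (-κ)
    have h4 := mul_le_mul_of_nonneg_left h1 h3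
    have h5 : 0 ≤ radConf κ t ^ 2 * Real.exp (-(√(-κ) * radDist κ t)) := by positivity
    have h6 : -κ / 2 * t - √(-κ) ≤ 0 := by
      rw [← mul_assoc, ← sq, h2] at h4
      linarith
    nlinarith [mul_nonneg h5 (neg_nonneg.2 h6)]
  have := hanti (left_mem_Icc.2 h) (right_mem_Icc.2 h) h
  simp only [radDist_zero, mul_zero, neg_zero, Real.exp_zero, mul_one] at this
  rw [Real.exp_neg, ← div_eq_mul_inv, div_le_iff₀ (Real.exp_pos _)] at this
  simpa [radConf] using this

/-- A function with differential bounded by `c` times the metric varies along a curve by at most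
`c` times the length. -/
theorem IsCurveFromTo.abs_sub_le {n : ℕ} {g : MetricField n} {U : Set (Coord n)} {p q : Coord n}
    {γ : ℝ → Coord n} (hγ : IsCurveFromTo U p q γ) {Φ : Coord n → ℝ}
    (hΦ : ∀ t ∈ Icc (0 : ℝ) 1, ContDiffAt ℝ 1 Φ (γ t)) {c L : ℝ} (hc : 0 ≤ c) (hL0 : 0 ≤ L)
    (hL : curveLength g γ ≤ ENNReal.ofReal L)
    (hle : ∀ t ∈ Icc (0 : ℝ) 1, ∀ v, |fderiv ℝ Φ (γ t) v| ≤ c * √(g (γ t) v v))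
    {t : ℝ} (ht : t ∈ Icc (0 : ℝ) 1) : |Φ (γ t) - Φ p| ≤ c * L := by
  have hf : ContDiffOn ℝ 1 (fun s => Φ (γ s)) (Icc 0 1) := fun s hs =>
    (hΦ s hs).comp_contDiffWithinAt s (hγ.contDiffOn s hs)
  have hu := uniqueDiffOn_Icc (zero_lt_one (α := ℝ))
  have hfc : ContinuousOn (derivWithin (fun s => Φ (γ s)) (Icc 0 1)) (Icc 0 1) :=
    hf.continuousOn_derivWithin hu le_rfl
  have hsub : Icc 0 t ⊆ Icc (0 : ℝ) 1 := Icc_subset_Icc_right ht.2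
  have hftc : ∫ s in (0 : ℝ)..t, derivWithin (fun s => Φ (γ s)) (Icc 0 1) s =
      Φ (γ t) - Φ (γ 0) := by
    refine intervalIntegral.integral_eq_sub_of_hasDerivAt_of_le ht.1
      (hf.continuousOn.mono hsub) ?_ ?_
    · intro s hs
      have hs' : s ∈ Icc (0 : ℝ) 1 := hsub (Ioo_subset_Icc_self hs)
      exact ((hf.differentiableOn one_ne_zero s hs').hasDerivWithinAt).hasDerivAt
        (Icc_mem_nhds hs.1 (hs.2.trans_le ht.2))
    · exact (hfc.mono (by rw [uIcc_of_le ht.1]; exact hsub)).intervalIntegrable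
  have hder : ∀ s ∈ Icc (0 : ℝ) 1, derivWithin (fun s => Φ (γ s)) (Icc 0 1) s =
      fderiv ℝ Φ (γ s) (derivWithin γ (Icc 0 1) s) := by
    intro s hs
    have h1 := (hΦ s hs).differentiableAt one_ne_zero
    have h2 := (hγ.contDiffOn.differentiableOn one_ne_zero s hs).hasDerivWithinAt
    exact (h1.hasFDerivAt.comp_hasDerivWithinAt s h2).derivWithin (hu s hs)
  rw [← hγ.source, ← hftc, ← ENNReal.ofReal_le_ofReal_iff (by positivity),
    intervalIntegral.integral_of_le ht.1, ENNReal.ofReal_mul hc]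
  calc ENNReal.ofReal |∫ s in Ioc 0 t, derivWithin (fun s => Φ (γ s)) (Icc 0 1) s|
      = ‖∫ s in Ioc 0 t, derivWithin (fun s => Φ (γ s)) (Icc 0 1) s‖ₑ :=
        (Real.enorm_eq_ofReal_abs _).symm
    _ ≤ ∫⁻ s in Ioc 0 t, ‖derivWithin (fun s => Φ (γ s)) (Icc 0 1) s‖ₑ :=
        enorm_integral_le_lintegral_enorm _
    _ ≤ ∫⁻ s in Icc 0 1, ‖derivWithin (fun s => Φ (γ s)) (Icc 0 1) s‖ₑ :=
        lintegral_mono_set (Ioc_subset_Icc_self.trans hsub)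
    _ ≤ ∫⁻ s in Icc 0 1, ENNReal.ofReal c * ENNReal.ofReal
        (√(g (γ s) (derivWithin γ (Icc 0 1) s) (derivWithin γ (Icc 0 1) s))) := by
        refine setLIntegral_mono' measurableSet_Icc fun s hs => ?_
        rw [hder s hs, Real.enorm_eq_ofReal_abs, ← ENNReal.ofReal_mul hc]
        exact ENNReal.ofReal_le_ofReal (hle s hs _)
    _ = ENNReal.ofReal c * curveLength g γ :=
        lintegral_const_mul' _ _ ENNReal.ofReal_ne_top
    _ ≤ _ := by gcongr

/-- The speed of the segment at time t is λ‖q‖, which is the derivative of `radDist κ (t * ‖q‖)`. -/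
theorem curveLength_radial {κ : ℝ} (hκ : κ ≤ 0) {q : Coord 2} (hq : q ∈ baseSet κ) :
    curveLength (baseMetric κ) (fun t => t • q) = ENNReal.ofReal (radDist κ ‖q‖) := by
  have hq' := mem_baseSet_iff.1 hq
  have hu := uniqueDiffOn_Icc (zero_lt_one (α := ℝ))
  have hmem : ∀ t ∈ Icc (0 : ℝ) 1, t * ‖q‖ ∈ radSet κ := fun t ht => by
    refine radSet_of_sq_le hκ hq' (pow_le_pow_left₀ (mul_nonneg ht.1 (norm_nonneg _)) ?_ 2)
    exact mul_le_of_le_one_left (norm_nonneg _) ht.2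
  have hd : ∀ t ∈ Icc (0 : ℝ) 1, HasDerivAt (fun t => radDist κ (t * ‖q‖))
      (radConf κ (t * ‖q‖) * ‖q‖) t := fun t ht =>
    HasDerivAt.comp (h₂ := radDist κ) (h := fun t => t * ‖q‖) t
      (hasDerivAt_radDist hκ (hmem t ht)) (by simpa using (hasDerivAt_id t).mul_const ‖q‖)
  have hcont : ContinuousOn (fun t => radConf κ (t * ‖q‖) * ‖q‖) (Icc 0 1) :=
    ((continuousOn_radConf κ).comp (by fun_prop) hmem).mul continuousOn_const
  have hi : ∫ t in (0 : ℝ)..1, radConf κ (t * ‖q‖) * ‖q‖ = radDist κ ‖q‖ := by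
    rw [intervalIntegral.integral_eq_sub_of_hasDerivAt (f := fun t => radDist κ (t * ‖q‖))]
    · simp [radDist_zero]
    · rw [uIcc_of_le zero_le_one]; exact hd
    · exact ContinuousOn.intervalIntegrable (by rw [uIcc_of_le zero_le_one]; exact hcont)
  rw [← hi, intervalIntegral.integral_of_le zero_le_one, ← integral_Icc_eq_integral_Ioc,
    ofReal_integral_eq_lintegral_ofReal (hcont.integrableOn_compact isCompact_Icc)]
  · refine setLIntegral_congr_fun measurableSet_Icc fun t ht => ?_
    have h1 : derivWithin (fun t : ℝ => t • q) (Icc 0 1) t = q := by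
      have := ((hasDerivAt_id t).smul_const q).hasDerivWithinAt.derivWithin (hu t ht)
      simpa using this
    have h2 : 0 < radConf κ (t * ‖q‖) := radConf_pos (hmem t ht)
    have h3 : conf κ ((t • q) 0) ((t • q) 1) = radConf κ (t * ‖q‖) := by
      have := lam_eq_radConf κ (t • q)
      rwa [norm_smul, Real.norm_of_nonneg ht.1] at this
    have h4 : baseMetric κ (t • q) q q = (radConf κ (t * ‖q‖) * ‖q‖) ^ 2 := by
      rw [baseMetric, h3, mul_pow, norm_sq_coord]; ring
    simp only
    rw [h1, h4, Real.sqrt_sq (by positivity)]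
  · filter_upwards [ae_restrict_mem measurableSet_Icc] with t ht
    have h2 : 0 < radConf κ (t * ‖q‖) := radConf_pos (hmem t ht)
    positivity

theorem contDiffAt_radDist {κ r : ℝ} (hκ : κ ≤ 0) (hr : r ∈ radSet κ) :
    ContDiffAt ℝ 1 (radDist κ) r := by
  have h : ContDiffOn ℝ 1 (radDist κ) (radSet κ) := by
    rw [show (1 : WithTop ℕ∞) = 0 + 1 from (zero_add 1).symm,
      contDiffOn_succ_iff_deriv_of_isOpen (isOpen_radSet κ)]
    refine ⟨fun s hs => (hasDerivAt_radDist hκ hs).differentiableAt.differentiableWithinAt,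
      by simp, ?_⟩
    rw [contDiffOn_zero]
    exact (continuousOn_radConf κ).congr fun s hs => (hasDerivAt_radDist hκ hs).deriv
  exact h.contDiffAt ((isOpen_radSet κ).mem_nhds hr)

theorem sq_dot_le {a b x y : ℝ} (h : a ^ 2 + b ^ 2 ≤ 1) : (a * x + b * y) ^ 2 ≤ x ^ 2 + y ^ 2 := by
  nlinarith [sq_nonneg (a * y - b * x), mul_nonneg (sub_nonneg.2 h)
    (add_nonneg (sq_nonneg x) (sq_nonneg y))]

/-- Along a curve of length at most `L` the distance of the projection to the origin of `𝕄²(κ)`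
varies by at most `L`, for a metric dominating that of `𝕄²(κ)`. -/
theorem IsCurveFromTo.radDist_le {n : ℕ} [NeZero n] {κ : ℝ} (hκ : κ ≤ 0) {g : MetricField n}
    {U : Set (Coord n)} {p q : Coord n} {γ : ℝ → Coord n} (hγ : IsCurveFromTo U p q γ)
    (hU : ∀ x ∈ U, 0 < 1 + κ / 4 * (x 0 ^ 2 + x 1 ^ 2))
    (hg : ∀ x ∈ U, ∀ v, conf κ (x 0) (x 1) ^ 2 * (v 0 ^ 2 + v 1 ^ 2) ≤ g x v v)
    {L : ℝ} (hL0 : 0 ≤ L) (hL : curveLength g γ ≤ ENNReal.ofReal L)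
    {t : ℝ} (ht : t ∈ Icc (0 : ℝ) 1) :
    radDist κ √(γ t 0 ^ 2 + γ t 1 ^ 2) ≤ radDist κ √(p 0 ^ 2 + p 1 ^ 2) + L := by
  set r := √(γ t 0 ^ 2 + γ t 1 ^ 2) with hr
  have hr2 : r ^ 2 = γ t 0 ^ 2 + γ t 1 ^ 2 := Real.sq_sqrt (by positivity)
  have hp0 := radDist_nonneg hκ (Real.sqrt_nonneg (p 0 ^ 2 + p 1 ^ 2)) (by
    have := hU _ (hγ.mem 0 (by simp))
    rw [hγ.source] at this
    rw [radSet, mem_ofPred_eq, Real.sq_sqrt (by positivity)]; exact this)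
  rcases (Real.sqrt_nonneg (γ t 0 ^ 2 + γ t 1 ^ 2)).eq_or_lt with h0 | h0
  · rw [hr, ← h0, radDist_zero]; positivity
  -- The distance to the origin is not smooth there. It is replaced by `radDist` of the signed
  -- projection onto the direction (a, b) of the point γ t: this is smooth, agrees with the distance
  -- at γ t, and does not exceed it at p. It is 1-Lipschitz for the metric because λ grows with the
  -- radius and the projection shortens it.
  obtain ⟨a, ha⟩ : ∃ a, a = γ t 0 / r := ⟨_, rfl⟩
  obtain ⟨b, hb⟩ : ∃ b, b = γ t 1 / r := ⟨_, rfl⟩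
  have hab : a ^ 2 + b ^ 2 = 1 := by
    rw [ha, hb, div_pow, div_pow, ← add_div, hr2, div_self]
    rw [← hr2]; positivity
  have hsq : ∀ x : Coord n, (a * x 0 + b * x 1) ^ 2 ≤ x 0 ^ 2 + x 1 ^ 2 := fun x =>
    sq_dot_le hab.le
  have hmem : ∀ x ∈ U, a * x 0 + b * x 1 ∈ radSet κ := fun x hx => by
    have := hU x hx
    have := hsq x
    show 0 < 1 + κ / 4 * (a * x 0 + b * x 1) ^ 2
    nlinarith
  let ℓ : Coord n →L[ℝ] ℝ := a • EuclideanSpace.proj 0 + b • EuclideanSpace.proj 1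
  have hℓ : ∀ x, ℓ x = a * x 0 + b * x 1 := fun x => by simp [ℓ]
  have hΦ : ∀ x ∈ U, HasFDerivAt (fun x => radDist κ (ℓ x)) (radConf κ (ℓ x) • ℓ) x :=
    fun x hx => (hasDerivAt_radDist hκ (by rw [hℓ]; exact hmem x hx)).comp_hasFDerivAt x
      ℓ.hasFDerivAt
  have key := hγ.abs_sub_le (Φ := fun x => radDist κ (ℓ x)) (c := 1)
    (fun s hs => (contDiffAt_radDist hκ (by rw [hℓ]; exact hmem _ (hγ.mem s hs))).comp _
      ℓ.contDiff.contDiffAt) zero_le_one hL0 hL (fun s hs v => by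
      have hU' := hU _ (hγ.mem s hs)
      rw [(hΦ _ (hγ.mem s hs)).fderiv, one_mul]
      refine Real.le_sqrt_of_sq_le ((le_trans ?_ (hg _ (hγ.mem s hs) v)))
      have hc : 0 < conf κ (γ s 0) (γ s 1) := conf_pos hU'
      have h1 : 0 < radConf κ (ℓ (γ s)) := radConf_pos (by rw [hℓ]; exact hmem _ (hγ.mem s hs))
      have h2 : radConf κ (ℓ (γ s)) ≤ conf κ (γ s 0) (γ s 1) := by
        refine inv_anti₀ hU' ?_
        have := hsq (γ s)
        rw [hℓ]
        nlinarith
      rw [sq_abs, smul_apply, smul_eq_mul, mul_pow, hℓ v]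
      exact mul_le_mul (pow_le_pow_left₀ h1.le h2 2) (hsq v) (sq_nonneg _) (sq_nonneg _)) ht
  have e1 : ℓ (γ t) = r := by
    rw [hℓ, ha, hb]
    field_simp
    rw [← hr2]
    field_simp
  have e2 : radDist κ (ℓ p) ≤ radDist κ √(p 0 ^ 2 + p 1 ^ 2) := by
    have hpU : p ∈ U := by rw [← hγ.source]; exact hγ.mem 0 (by simp)
    have hmem' : √(p 0 ^ 2 + p 1 ^ 2) ∈ radSet κ := by
      rw [radSet, mem_ofPred_eq, Real.sq_sqrt (by positivity)]; exact hU p hpU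
    rcases le_total 0 (ℓ p) with h | h
    · refine radDist_mono hκ h (Real.le_sqrt_of_sq_le ?_) hmem'
      rw [hℓ]; exact hsq p
    -- A negative projection has nonpositive `radDist`.
    · refine le_trans ?_ hp0
      rw [radDist, intervalIntegral.integral_symm, neg_nonpos]
      refine intervalIntegral.integral_nonneg h fun s hs => ?_
      have hps : ℓ p ∈ radSet κ := by rw [hℓ]; exact hmem p hpU
      exact (radConf_pos (uIcc_subset_radSet hκ hps (by rw [uIcc_of_ge h]; exact hs))).le
  rw [e1, one_mul] at key
  have := (abs_le.1 key).2
  linarith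

theorem norm_eq_sqrt (p : Coord 2) : ‖p‖ = √(p 0 ^ 2 + p 1 ^ 2) := by
  rw [← norm_sq_coord, Real.sqrt_sq (norm_nonneg _)]

/-- The geodesic disk in coordinates. -/
theorem mem_disk_iff {κ R : ℝ} (hκ : κ ≤ 0) {q : Coord 2} :
    q ∈ disk κ R ↔ q ∈ baseSet κ ∧ radDist κ ‖q‖ < R := by
  refine and_congr_right fun hq => ?_
  have hnn := radDist_nonneg hκ (norm_nonneg q) (mem_baseSet_iff.1 hq)
  have h0 : (0 : Coord 2) ∈ baseSet κ := by simp [baseSet]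
  constructor
  · intro h
    rw [riemDist, iInf_lt_iff] at h
    obtain ⟨γ, h⟩ := h
    rw [iInf_lt_iff] at h
    obtain ⟨hγ, h⟩ := h
    have hfin : curveLength (baseMetric κ) γ ≠ ⊤ := (h.trans ENNReal.ofReal_lt_top).ne
    have key := hγ.radDist_le (g := baseMetric κ) (L := (curveLength (baseMetric κ) γ).toReal) hκ
      (fun x hx => hx) (fun x _ v => le_of_eq (by rw [baseMetric]; ring))
      ENNReal.toReal_nonneg (by rw [ENNReal.ofReal_toReal hfin]) (right_mem_Icc.2 zero_le_one)
    rw [hγ.target, ← norm_eq_sqrt] at key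
    simp only [PiLp.zero_apply, ne_eq, OfNat.ofNat_ne_zero, not_false_eq_true, zero_pow, add_zero,
      Real.sqrt_zero, radDist_zero, zero_add] at key
    exact key.trans_lt ((ENNReal.lt_ofReal_iff_toReal_lt hfin).1 h)
  · intro h
    have hγ : IsCurveFromTo (baseSet κ) 0 q (fun t : ℝ => t • q) :=
      { contDiffOn := by fun_prop
        mem := fun t ht => by
          rw [mem_baseSet_iff, norm_smul]
          refine radSet_of_sq_le hκ (mem_baseSet_iff.1 hq) (pow_le_pow_left₀ (by positivity) ?_ 2)
          exact mul_le_of_le_one_left (norm_nonneg _) (by rw [Real.norm_of_nonneg ht.1]; exact ht.2)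
        source := zero_smul _ _
        target := one_smul _ _ }
    refine lt_of_le_of_lt (iInf₂_le (fun t : ℝ => t • q) hγ) ?_
    rw [curveLength_radial hκ hq]
    exact (ENNReal.ofReal_lt_ofReal_iff (hnn.trans_lt h)).2 h

/-- The region of `𝔼(κ,τ)` in which a geodesic ball is contained. -/
theorem ball_subset {κ τ : ℝ} (hκ : κ ≤ 0) {p q : Coord 3} {R ρ : ℝ} (hR : 0 ≤ R)
    (hq : q ∈ ball κ τ p R)
    (hρ : ∀ r, 0 ≤ r → r ∈ radSet κ → radDist κ r ≤ radDist κ √(p 0 ^ 2 + p 1 ^ 2) + R → r ≤ ρ) :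
    radDist κ √(q 0 ^ 2 + q 1 ^ 2) ≤ radDist κ √(p 0 ^ 2 + p 1 ^ 2) + R ∧
      |q 2| ≤ |p 2| + (1 + |τ| * ρ) * R := by
  obtain ⟨hqs, h⟩ := hq
  rw [riemDist, iInf_lt_iff] at h
  obtain ⟨γ, h⟩ := h
  rw [iInf_lt_iff] at h
  obtain ⟨hγ, h⟩ := h
  have hform : ∀ x v : Coord 3, spaceMetric κ τ x v v = conf κ (x 0) (x 1) ^ 2 *
      (v 0 ^ 2 + v 1 ^ 2) + (v 2 + τ * conf κ (x 0) (x 1) * (x 1 * v 0 - x 0 * v 1)) ^ 2 := by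
    intro x v
    simp [spaceMetric, frameCoeff, Fin.sum_univ_three]
    ring
  have key := fun t (ht : t ∈ Icc (0 : ℝ) 1) => hγ.radDist_le (g := spaceMetric κ τ) (L := R) hκ
      (fun x hx => hx) (fun x _ v => by
        rw [hform]; exact le_add_of_nonneg_right (sq_nonneg _)) hR h.le ht
  refine ⟨by simpa [hγ.target] using key 1 (right_mem_Icc.2 zero_le_one), ?_⟩
  have hmem : ∀ t ∈ Icc (0 : ℝ) 1, √(γ t 0 ^ 2 + γ t 1 ^ 2) ∈ radSet κ := fun t ht => by
    rw [radSet, mem_ofPred_eq, Real.sq_sqrt (by positivity)]; exact hγ.mem t ht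
  have hρt : ∀ t ∈ Icc (0 : ℝ) 1, √(γ t 0 ^ 2 + γ t 1 ^ 2) ≤ ρ := fun t ht =>
    hρ _ (Real.sqrt_nonneg _) (hmem t ht) (key t ht)
  have hρ0 : 0 ≤ ρ := (Real.sqrt_nonneg _).trans (hρt 0 (by simp))
  -- The form dz is the third coframe form minus τλ(y dx − x dy). By Cauchy–Schwarz the latter is at
  -- most |τ| times the coordinate radius times the horizontal length, and that radius stays below ρ
  -- along the whole curve.
  have hz := hγ.abs_sub_le (Φ := fun x => x 2) (c := 1 + |τ| * ρ)
    (fun t _ => contDiffAt_coord 2 _) (by positivity) hR h.le (fun t ht v => by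
      rw [(hasFDerivAt_coord (2 : Fin 3) (γ t)).fderiv]
      rw [PiLp.proj_apply]
      have hc : 0 < conf κ (γ t 0) (γ t 1) := conf_pos (hγ.mem t ht)
      have hf := hform (γ t) v
      set x := γ t
      set S := √(spaceMetric κ τ x v v) with hS
      have hS2 : S ^ 2 = spaceMetric κ τ x v v := Real.sq_sqrt (by rw [hf]; positivity)
      have h1 : |v 2 + τ * conf κ (x 0) (x 1) * (x 1 * v 0 - x 0 * v 1)| ≤ S := by
        refine Real.le_sqrt_of_sq_le ?_
        rw [hf, sq_abs]
        exact le_add_of_nonneg_left (by positivity)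
      have h2 : |conf κ (x 0) (x 1) * (x 1 * v 0 - x 0 * v 1)| ≤ ρ * S := by
        refine abs_le_of_sq_le_sq ?_ (mul_nonneg hρ0 (Real.sqrt_nonneg _))
        have h3 : x 0 ^ 2 + x 1 ^ 2 ≤ ρ ^ 2 := by
          have := pow_le_pow_left₀ (Real.sqrt_nonneg _) (hρt t ht) 2
          rwa [Real.sq_sqrt (by positivity)] at this
        have h4 : conf κ (x 0) (x 1) ^ 2 * (v 0 ^ 2 + v 1 ^ 2) ≤ S ^ 2 := by
          rw [hS2, hf]; exact le_add_of_nonneg_right (sq_nonneg _)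
        rw [mul_pow ρ]
        refine le_trans ?_ (mul_le_mul h3 h4 (by positivity) (sq_nonneg _))
        have : 0 ≤ conf κ (x 0) (x 1) ^ 2 * (x 0 * v 0 + x 1 * v 1) ^ 2 := by positivity
        nlinarith
      have h5 : v 2 = (v 2 + τ * conf κ (x 0) (x 1) * (x 1 * v 0 - x 0 * v 1)) -
          τ * (conf κ (x 0) (x 1) * (x 1 * v 0 - x 0 * v 1)) := by ring
      rw [h5]
      refine (abs_sub _ _).trans ?_
      rw [abs_mul]
      have := mul_le_mul_of_nonneg_left h2 (abs_nonneg τ)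
      linarith) (right_mem_Icc.2 zero_le_one)
  simp only [hγ.target] at hz
  have := abs_sub_abs_le_abs_sub (q 2) (p 2)
  linarith


/-! ### Disks and circles of `𝕄²(κ)` -/

theorem continuousOn_radDist_norm {κ : ℝ} (hκ : κ ≤ 0) :
    ContinuousOn (fun p : Coord 2 => radDist κ ‖p‖) (baseSet κ) := fun _ hp =>
  (ContinuousAt.comp (g := radDist κ) (f := fun p : Coord 2 => ‖p‖)
    (hasDerivAt_radDist hκ (mem_baseSet_iff.1 hp)).continuousAt
    continuous_norm.continuousAt).continuousWithinAt

theorem isOpen_disk {κ : ℝ} (hκ : κ ≤ 0) (R : ℝ) : IsOpen (disk κ R) := by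
  have h := (continuousOn_radDist_norm hκ).isOpen_inter_preimage (isOpen_baseSet κ)
    (isOpen_Iio (a := R))
  convert h using 1
  ext p
  rw [mem_disk_iff hκ]
  rfl

theorem bdry_disk_subset {κ R : ℝ} (hκ : κ ≤ 0) {p : Coord 2} (hp : p ∈ bdry κ (disk κ R)) :
    radDist κ ‖p‖ = R := by
  obtain ⟨⟨hc, hi⟩, hb⟩ := hp
  rw [(isOpen_disk hκ R).interior_eq, mem_disk_iff hκ, not_and, not_lt] at hi
  refine le_antisymm ?_ (hi hb)
  have hca := (continuousOn_radDist_norm hκ).continuousAt ((isOpen_baseSet κ).mem_nhds hb)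
  obtain ⟨v, hv, hlim⟩ := mem_closure_iff_seq_limit.1 hc
  exact le_of_tendsto (hca.tendsto.comp hlim)
    (.of_forall fun n => ((mem_disk_iff hκ).1 (hv n)).2.le)

theorem radDist_injective {κ r s : ℝ} (hκ : κ ≤ 0) (hr0 : 0 ≤ r) (hs0 : 0 ≤ s)
    (hr : r ∈ radSet κ) (hs : s ∈ radSet κ) (h : radDist κ r = radDist κ s) : r = s := by
  rcases le_total r s with h1 | h1
  · have := radDist_sub_ge hκ hr0 h1 hs
    linarith
  · have := radDist_sub_ge hκ hs0 h1 hr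
    linarith

/-- The angular parametrization of an interval of length 2π is r-Lipschitz because a chord is no
longer than its arc, that is, 1 − cos s ≤ s²/2. -/
theorem hausdorffMeasure_sphere_le {r : ℝ} (hr : 0 ≤ r) :
    Measure.hausdorffMeasure 1 (Metric.sphere (0 : Coord 2) r) ≤
      ENNReal.ofReal (2 * Real.pi * r) := by
  let f : ℝ → Coord 2 := fun t => !₂[r * Real.cos t, r * Real.sin t]
  have hf : LipschitzWith r.toNNReal f := by
    refine LipschitzWith.of_dist_le_mul fun s t => ?_
    rw [Real.coe_toNNReal r hr, EuclideanSpace.dist_eq, Real.dist_eq]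
    refine Real.sqrt_le_iff.2 ⟨by positivity, ?_⟩
    have h := Real.one_sub_sq_div_two_le_cos (x := s - t)
    rw [Real.cos_sub] at h
    have h1 := Real.sin_sq_add_cos_sq s
    have h2 := Real.sin_sq_add_cos_sq t
    simp only [f, Fin.sum_univ_two, Real.dist_eq, sq_abs, mul_pow, Matrix.cons_val_zero,
      Matrix.cons_val_one]
    have h3 : (Real.cos s - Real.cos t) ^ 2 + (Real.sin s - Real.sin t) ^ 2 ≤ (s - t) ^ 2 := by
      nlinarith
    nlinarith [mul_le_mul_of_nonneg_left h3 (sq_nonneg r)]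
  have hsub : Metric.sphere (0 : Coord 2) r ⊆ f '' Icc (-Real.pi) Real.pi := by
    intro p hp
    have hp' : ‖p‖ = r := by simpa using hp
    let z : ℂ := ⟨p 0, p 1⟩
    have hz : ‖z‖ = r := by
      rw [← hp', Complex.norm_eq_sqrt_sq_add_sq, norm_eq_sqrt]
    refine ⟨z.arg, ⟨(Complex.neg_pi_lt_arg z).le, Complex.arg_le_pi z⟩, ?_⟩
    have h1 := Complex.norm_mul_cos_arg z
    have h2 := Complex.norm_mul_sin_arg z
    rw [hz] at h1 h2
    ext i
    fin_cases i
    · simpa [f] using h1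
    · simpa [f] using h2
  calc Measure.hausdorffMeasure 1 (Metric.sphere (0 : Coord 2) r)
      ≤ Measure.hausdorffMeasure 1 (f '' Icc (-Real.pi) Real.pi) := measure_mono hsub
    _ ≤ (r.toNNReal : ℝ≥0∞) ^ (1 : ℝ) * Measure.hausdorffMeasure 1 (Icc (-Real.pi) Real.pi) :=
        hf.hausdorffMeasure_image_le zero_le_one _
    _ = ENNReal.ofReal (2 * Real.pi * r) := by
        rw [MeasureTheory.hausdorffMeasure_real, Real.volume_Icc, ENNReal.rpow_one,
          mul_comm, mul_comm _ r, ENNReal.ofReal_mul hr, mul_comm]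
        congr 2
        ring

/-- The length of a geodesic circle. -/
theorem baseLength_bdry_disk_le {κ R ρ : ℝ} (hκ : κ ≤ 0)
    (hρ : ∀ r, 0 ≤ r → r ∈ radSet κ → radDist κ r ≤ R → r ≤ ρ) :
    baseLength κ (bdry κ (disk κ R)) ≤
      ENNReal.ofReal (2 * Real.pi * ρ * Real.exp (√(-κ) * R)) := by
  rcases (bdry κ (disk κ R)).eq_empty_or_nonempty with h | ⟨p, hp⟩
  · simp [baseLength, h]
  have hpr := bdry_disk_subset hκ hp
  have hpS := mem_baseSet_iff.1 hp.2
  have hpρ := hρ _ (norm_nonneg p) hpS hpr.le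
  have hsub : bdry κ (disk κ R) ⊆ Metric.sphere 0 ‖p‖ := fun q hq => by
    rw [mem_sphere_zero_iff_norm]
    exact radDist_injective hκ (norm_nonneg q) (norm_nonneg p) (mem_baseSet_iff.1 hq.2) hpS
      ((bdry_disk_subset hκ hq).trans hpr.symm)
  calc baseLength κ (bdry κ (disk κ R))
      ≤ ∫⁻ q in Metric.sphere (0 : Coord 2) ‖p‖, ENNReal.ofReal (conf κ (q 0) (q 1))
          ∂(Measure.hausdorffMeasure 1) := lintegral_mono_set hsub
    _ ≤ ∫⁻ q in Metric.sphere (0 : Coord 2) ‖p‖, ENNReal.ofReal (Real.exp (√(-κ) * R))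
          ∂(Measure.hausdorffMeasure 1) := by
        refine setLIntegral_mono' Metric.isClosed_sphere.measurableSet fun q hq => ?_
        rw [mem_sphere_zero_iff_norm] at hq
        refine ENNReal.ofReal_le_ofReal ?_
        have := radConf_le_exp hκ (norm_nonneg p) hpS
        rw [hpr, ← hq, ← lam_eq_radConf] at this
        exact this
    _ = ENNReal.ofReal (Real.exp (√(-κ) * R)) *
          Measure.hausdorffMeasure 1 (Metric.sphere (0 : Coord 2) ‖p‖) := by
        rw [setLIntegral_const]
    _ ≤ ENNReal.ofReal (Real.exp (√(-κ) * R)) * ENNReal.ofReal (2 * Real.pi * ρ) := by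
        gcongr
        refine (hausdorffMeasure_sphere_le (norm_nonneg p)).trans (ENNReal.ofReal_le_ofReal ?_)
        gcongr
    _ = _ := by
        rw [← ENNReal.ofReal_mul (Real.exp_pos _).le, mul_comm]

/-- The points where the conformal factor is at most `Λ`, for `κ < 0`. -/
def confSublevel (κ Λ : ℝ) : Set (Coord 2) := {p | Λ⁻¹ ≤ 1 + κ / 4 * ‖p‖ ^ 2}

theorem confSublevel_subset {κ Λ : ℝ} (hΛ : 0 < Λ) : confSublevel κ Λ ⊆ baseSet κ := fun _ hp =>
  mem_baseSet_iff.2 (lt_of_lt_of_le (inv_pos.2 hΛ) hp)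

theorem mem_confSublevel_iff {κ Λ : ℝ} (hΛ : 0 < Λ) {p : Coord 2} (hp : p ∈ baseSet κ) :
    p ∈ confSublevel κ Λ ↔ lam κ p ≤ Λ := by
  have h : 0 < 1 + κ / 4 * ‖p‖ ^ 2 := mem_baseSet_iff.1 hp
  rw [lam_eq_radConf, radConf, confSublevel, mem_ofPred_eq]
  exact inv_le_comm₀ hΛ h

theorem isClosed_confSublevel (κ Λ : ℝ) : IsClosed (confSublevel κ Λ) :=
  isClosed_le continuous_const (by fun_prop)

theorem confSublevel_eq_closedBall {κ Λ : ℝ} (hκ : κ < 0) (hΛ : 1 ≤ Λ) :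
    ∃ ρ, 0 ≤ ρ ∧ ρ ∈ radSet κ ∧ radConf κ ρ = Λ ∧ confSublevel κ Λ = Metric.closedBall 0 ρ := by
  have h0 : 0 < Λ := by linarith
  have hne : κ ≠ 0 := hκ.ne
  have h1 : Λ⁻¹ ≤ 1 := inv_le_one_of_one_le₀ hΛ
  have h2 : 0 ≤ (1 - Λ⁻¹) * (4 / -κ) := mul_nonneg (by linarith)
    (div_nonneg (by norm_num) (by linarith))
  have h3 : √((1 - Λ⁻¹) * (4 / -κ)) ^ 2 = (1 - Λ⁻¹) * (4 / -κ) := Real.sq_sqrt h2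
  have h4 : 1 + κ / 4 * √((1 - Λ⁻¹) * (4 / -κ)) ^ 2 = Λ⁻¹ := by
    rw [h3]
    field_simp
    ring
  -- This radius solves 1 + κρ²/4 = 1/Λ.
  refine ⟨√((1 - Λ⁻¹) * (4 / -κ)), Real.sqrt_nonneg _, ?_, ?_, ?_⟩
  · rw [radSet, mem_ofPred_eq, h4]; positivity
  · rw [radConf, h4, inv_inv]
  · ext p
    rw [mem_closedBall_zero_iff, confSublevel, mem_ofPred_eq,
      ← sq_le_sq₀ (norm_nonneg p) (Real.sqrt_nonneg _)]
    generalize √((1 - Λ⁻¹) * (4 / -κ)) = ρ at *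
    rw [← h4]
    constructor <;> intro h <;> nlinarith

theorem isCompact_confSublevel {κ Λ : ℝ} (hκ : κ < 0) (hΛ : 1 ≤ Λ) :
    IsCompact (confSublevel κ Λ) := by
  obtain ⟨ρ, -, -, -, h⟩ := confSublevel_eq_closedBall hκ hΛ
  rw [h]; exact isCompact_closedBall _ _

/-- By `radConf_le_exp`. For κ < 0 the sublevel sets of λ serve as compact neighbourhoods of the
disks, since λ is explicit and smooth. -/
theorem disk_subset_confSublevel {κ R : ℝ} (hκ : κ ≤ 0) :
    disk κ R ⊆ confSublevel κ (Real.exp (√(-κ) * R)) := fun p hp => by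
  obtain ⟨hb, hp⟩ := (mem_disk_iff hκ).1 hp
  rw [mem_confSublevel_iff (Real.exp_pos _) hb, lam_eq_radConf]
  refine (radConf_le_exp hκ (norm_nonneg p) (mem_baseSet_iff.1 hb)).trans ?_
  gcongr

theorem finrank_coord : Module.finrank ℝ (Coord 2) = 2 := by simp

theorem continuousOn_lam {κ : ℝ} : ContinuousOn (lam κ : Coord 2 → ℝ) (baseSet κ) := fun _ hp =>
  (contDiffAt_lam (m := 1) hp).continuousAt.continuousWithinAt

/-- The area of a disk for `κ < 0`. -/
theorem area_confSublevel_le {κ Λ : ℝ} (hκ : κ < 0) (hΛ : 1 ≤ Λ) :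
    ∫⁻ p in confSublevel κ Λ, ENNReal.ofReal (lam κ p ^ 2) ≤
      ENNReal.ofReal (4 * Real.pi / -κ * Λ) := by
  obtain ⟨ρ, hρ0, hρ, hρΛ, hS⟩ := confSublevel_eq_closedBall hκ hΛ
  have hI := Icc_subset_radSet hκ.le le_rfl hρ
  have hint : IntegrableOn (fun p : Coord 2 => lam κ p ^ 2) (confSublevel κ Λ) :=
    (((continuousOn_lam (κ := κ)).pow 2).mono
      (confSublevel_subset (by linarith))).integrableOn_compact (isCompact_confSublevel hκ hΛ)
  rw [← ofReal_integral_eq_lintegral_ofReal hint (.of_forall fun p => sq_nonneg _)]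
  refine ENNReal.ofReal_le_ofReal ?_
  have e1 : ∫ p in confSublevel κ Λ, lam κ p ^ 2 =
      ∫ p : Coord 2, (Iic ρ).indicator (fun r => radConf κ r ^ 2) ‖p‖ := by
    rw [hS, ← integral_indicator Metric.isClosed_closedBall.measurableSet]
    congr 1
    funext p
    by_cases hp : ‖p‖ ≤ ρ
    · rw [indicator_of_mem (by simpa using hp), indicator_of_mem (by exact hp), lam_eq_radConf]
    · rw [indicator_of_notMem (by simpa using hp), indicator_of_notMem (by exact hp)]
  -- In polar coordinates the area density rλ² is the derivative of (2/−κ)λ, so the area is exactly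
  -- (4π/−κ)(Λ − 1).
  have hder : ∀ r ∈ Icc 0 ρ, HasDerivAt (fun r => (2 / -κ) * radConf κ r)
      (r * radConf κ r ^ 2) r := fun r hr => by
    have hne : κ ≠ 0 := hκ.ne
    refine ((hasDerivAt_radConf (hI hr)).const_mul (2 / -κ)).congr_deriv ?_
    field_simp
  have e2 : ∫ r in Ioi (0 : ℝ), r ^ (2 - 1) • (Iic ρ).indicator (fun r => radConf κ r ^ 2) r =
      (2 / -κ) * (Λ - 1) := by
    have : (fun r : ℝ => r ^ (2 - 1) • (Iic ρ).indicator (fun r => radConf κ r ^ 2) r) =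
        (Iic ρ).indicator (fun r => r * radConf κ r ^ 2) := by
      funext r
      by_cases hr : r ∈ Iic ρ
      · simp [indicator_of_mem hr]
      · simp [indicator_of_notMem hr]
    rw [this, setIntegral_indicator measurableSet_Iic, Ioi_inter_Iic,
      ← intervalIntegral.integral_of_le hρ0, intervalIntegral.integral_eq_sub_of_hasDerivAt
        (f := fun r => (2 / -κ) * radConf κ r)]
    · simp only [hρΛ]
      simp [radConf]
      ring
    · rw [uIcc_of_le hρ0]; exact hder
    · refine ContinuousOn.intervalIntegrable ?_
      rw [uIcc_of_le hρ0]
      exact continuousOn_id.mul (((continuousOn_radConf κ).mono hI).pow 2)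
  rw [e1, integral_fun_norm_addHaar, finrank_coord, e2]
  have e3 : (volume : Measure (Coord 2)).real (Metric.ball 0 1) = Real.pi := by
    rw [Measure.real, EuclideanSpace.volume_ball_fin_two]
    simp [Real.pi_pos.le]
  rw [e3]
  have : 0 < -κ := by linarith
  simp only [smul_eq_mul, nsmul_eq_mul]
  have h5 : 0 ≤ 4 * Real.pi / -κ := by positivity
  push_cast
  have : 2 * (Real.pi * (2 / -κ * (Λ - 1))) = 4 * Real.pi / -κ * (Λ - 1) := by ring
  rw [this]
  gcongr
  linarith


/-! ### Truncations -/

/-- The primitive has slope at most one on [−h, h] and is constant on either side of it. -/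
theorem abs_primitive_le {φ : ℝ → ℝ} {h : ℝ} (hφ : Continuous φ) (h0 : ∀ s, 0 ≤ φ s)
    (h1 : ∀ s, φ s ≤ 1) (hh : 0 ≤ h) (hz : ∀ s, h ≤ |s| → φ s = 0) (s : ℝ) :
    |∫ t in (0 : ℝ)..s, φ t| ≤ h := by
  have hb : ∀ a, |a| ≤ h → |∫ t in (0 : ℝ)..a, φ t| ≤ h := fun a ha => by
    have := intervalIntegral.norm_integral_le_of_norm_le_const (a := 0) (b := a) (C := 1)
      (f := φ) (fun t _ => by rw [Real.norm_of_nonneg (h0 t)]; exact h1 t)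
    rw [one_mul, sub_zero] at this
    exact this.trans ha
  have hsplit : ∀ a, (∀ t ∈ uIcc a s, h ≤ |t|) → |a| ≤ h → |∫ t in (0 : ℝ)..s, φ t| ≤ h := by
    intro a ht ha
    rw [← intervalIntegral.integral_add_adjacent_intervals (hφ.intervalIntegrable 0 a)
      (hφ.intervalIntegrable a s), intervalIntegral.integral_congr (g := fun _ => 0)
      (fun t h' => hz t (ht t h'))]
    simpa using hb a ha
  rcases le_total (|s|) h with hs | hs
  · exact hb s hs
  · rcases le_total 0 s with h' | h'
    · rw [abs_of_nonneg h'] at hs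
      refine hsplit h (fun t ht => ?_) (abs_of_nonneg hh).le
      rw [uIcc_of_le hs] at ht
      exact ht.1.trans (le_abs_self t)
    · rw [abs_of_nonpos h'] at hs
      refine hsplit (-h) (fun t ht => ?_) (by rw [abs_neg, abs_of_nonneg hh])
      rw [uIcc_of_ge (by linarith)] at ht
      exact (le_neg.2 ht.2).trans (neg_le_abs t)

/-- A `C¹` function with values in `[-2h, 2h]` which has slope one on `[-h, h]`. -/
theorem exists_truncation {h : ℝ} (hh : 0 < h) : ∃ T T' : ℝ → ℝ, (∀ s, HasDerivAt T (T' s) s) ∧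
    Continuous T' ∧ (∀ s, 0 ≤ T' s) ∧ (∀ s, T' s ≤ 1) ∧ (∀ s, |T s| ≤ 2 * h) ∧
    ∀ s, |s| ≤ h → T' s = 1 := by
  -- A trapezoid: one on [−h, h], linear down to zero at ±2h. Its primitive is therefore bounded by
  -- 2h.
  let φ : ℝ → ℝ := fun s => max 0 (min 1 (2 - |s| / h))
  have hφ : Continuous φ := by fun_prop
  have h0 : ∀ s, 0 ≤ φ s := fun s => le_max_left _ _
  have h1 : ∀ s, φ s ≤ 1 := fun s => max_le zero_le_one (min_le_left _ _)
  refine ⟨fun s => ∫ t in (0 : ℝ)..s, φ t, φ, fun s => hφ.integral_hasStrictDerivAt 0 s |>.hasDerivAt,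
    hφ, h0, h1, abs_primitive_le hφ h0 h1 (by positivity) fun s hs => ?_, fun s hs => ?_⟩
  · have : 2 ≤ |s| / h := (le_div_iff₀ hh).2 hs
    exact max_eq_left ((min_le_right _ _).trans (by linarith))
  · have : |s| / h ≤ 1 := (div_le_one hh).2 hs
    simp only [φ]
    rw [min_eq_left (by linarith), max_eq_right zero_le_one]

/-- A `C¹` function with values in `[-2h, 2h]` which has slope one on `[-h, h]` away from zero,
and vanishes near zero. -/
theorem exists_truncation_away {h ε : ℝ} (hh : 0 < h) (hε : 0 < ε) :
    ∃ T T' : ℝ → ℝ, (∀ s, HasDerivAt T (T' s) s) ∧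
    Continuous T' ∧ (∀ s, 0 ≤ T' s) ∧ (∀ s, T' s ≤ 1) ∧ (∀ s, |T s| ≤ 2 * h) ∧
    (∀ s, 2 * ε ≤ |s| → |s| ≤ h → T' s = 1) ∧ ∀ s, |s| ≤ ε → T s = 0 := by
  -- The second factor vanishes for |s| ≤ ε and is one for |s| ≥ 2ε.
  let φ : ℝ → ℝ := fun s => max 0 (min 1 (2 - |s| / h)) * max 0 (min 1 (|s| / ε - 1))
  have hφ : Continuous φ := by fun_prop
  have h0 : ∀ s, 0 ≤ φ s := fun s => mul_nonneg (le_max_left _ _) (le_max_left _ _)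
  have h1 : ∀ s, φ s ≤ 1 := fun s => mul_le_one₀ (max_le zero_le_one (min_le_left _ _))
    (le_max_left _ _) (max_le zero_le_one (min_le_left _ _))
  refine ⟨fun s => ∫ t in (0 : ℝ)..s, φ t, φ, fun s => hφ.integral_hasStrictDerivAt 0 s |>.hasDerivAt,
    hφ, h0, h1, abs_primitive_le hφ h0 h1 (by positivity) fun s hs => ?_, fun s hs hs' => ?_,
    fun s hs => ?_⟩
  · have : 2 ≤ |s| / h := (le_div_iff₀ hh).2 hs
    simp only [φ]
    rw [max_eq_left ((min_le_right _ _).trans (by linarith)), zero_mul]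
  · have : |s| / h ≤ 1 := (div_le_one hh).2 hs'
    have : 2 ≤ |s| / ε := (le_div_iff₀ hε).2 hs
    simp only [φ]
    rw [min_eq_left (by linarith), max_eq_right zero_le_one, min_eq_left (by linarith),
      max_eq_right zero_le_one, one_mul]
  · have hz : ∀ t ∈ uIcc 0 s, φ t = 0 := fun t ht => by
      have ht' : |t| ≤ |s| := by simpa using abs_sub_left_of_mem_uIcc ht
      have : |t| / ε ≤ 1 := (div_le_one hε).2 (ht'.trans hs)
      simp only [φ]
      rw [max_eq_left (a := (0 : ℝ)) (b := min 1 (|t| / ε - 1))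
        ((min_le_right _ _).trans (by linarith)), mul_zero]
    simp only
    rw [intervalIntegral.integral_congr (g := fun _ => 0) hz]
    simp

/-! ### Graphs with zero boundary values -/

theorem measurableSet_inter_preimage {Ω : Set (Coord 2)} {u : Coord 2 → ℝ} (hΩ : IsOpen Ω)
    (hu : ContinuousOn u Ω) {s : Set ℝ} (hs : IsClosed s) : MeasurableSet (Ω ∩ u ⁻¹' s) := by
  have h := hu.isOpen_inter_preimage hΩ hs.isOpen_compl
  have : Ω ∩ u ⁻¹' s = Ω \ (Ω ∩ u ⁻¹' sᶜ) := by
    ext p; simp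
  rw [this]
  exact hΩ.measurableSet.diff h.measurableSet

/-- The differential vanishes almost everywhere on a zero set. -/
theorem ae_fderiv_eq_zero {Ω : Set (Coord 2)} {u : Coord 2 → ℝ} (hΩ : IsOpen Ω)
    (hu : ContDiffOn ℝ 1 u Ω) :
    ∀ᵐ p ∂(volume.restrict (Ω ∩ u ⁻¹' {0})), fderiv ℝ u p = 0 := by
  have hm := measurableSet_inter_preimage hΩ hu.continuousOn (isClosed_singleton (x := (0 : ℝ)))
  -- On its zero set u is approximated by the zero map with error constant 0, which forces the
  -- derivative to vanish almost everywhere there. The result used concerns maps of a space to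
  -- itself, so u is multiplied by a fixed nonzero vector.
  have happ : ApproximatesLinearOn (fun p => u p • (coordVec 0 : Coord 2))
      (0 : Coord 2 →L[ℝ] Coord 2) (Ω ∩ u ⁻¹' {0}) 0 := by
    intro x hx y hy
    have hx' : u x = 0 := hx.2
    have hy' : u y = 0 := hy.2
    simp [hx', hy']
  filter_upwards [happ.norm_fderiv_sub_le volume hm
    (fun p => (fderiv ℝ u p).smulRight (coordVec 0 : Coord 2)) fun p hp =>
      (((hu.contDiffAt (hΩ.mem_nhds hp.1)).differentiableAt one_ne_zero).hasFDerivAt.smul_const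
        _).hasFDerivWithinAt] with p hp
  have h0 : fderiv ℝ u p = 0 ∨ (coordVec 0 : Coord 2) = 0 := by simpa using hp
  exact h0.resolve_right (by simp [coordVec])

/-- A limit point outside Ω lies in K₀, hence in 𝕄²(κ), so it is a boundary point at which u tends
to zero; this contradicts |u| ≥ ε. -/
theorem isCompact_of_zeroBoundary {κ : ℝ} {Ω K₀ : Set (Coord 2)} {u : Coord 2 → ℝ}
    (hΩ : IsOpen Ω) (hu : ContinuousOn u Ω) (h0 : HasZeroBoundaryValues κ Ω u)
    (hK₀ : IsCompact K₀) (hb : K₀ ⊆ baseSet κ) {ε : ℝ} (hε : 0 < ε) :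
    IsCompact {p | p ∈ Ω ∧ p ∈ K₀ ∧ ε ≤ |u p|} := by
  refine hK₀.of_isClosed_subset (isClosed_of_closure_subset fun p hp => ?_) fun p hp => hp.2.1
  obtain ⟨v, hv, hlim⟩ := mem_closure_iff_seq_limit.1 hp
  have hpK : p ∈ K₀ := hK₀.isClosed.mem_of_tendsto hlim (.of_forall fun n => (hv n).2.1)
  by_cases hpΩ : p ∈ Ω
  · refine ⟨hpΩ, hpK, ge_of_tendsto (((hu.continuousAt (hΩ.mem_nhds hpΩ)).abs.tendsto).comp hlim)
      (.of_forall fun n => (hv n).2.2)⟩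
  · have hfr : p ∈ bdry κ Ω := by
      refine ⟨⟨mem_closure_iff_seq_limit.2 ⟨v, fun n => (hv n).1, hlim⟩, ?_⟩, hb hpK⟩
      rwa [hΩ.interior_eq]
    have hlim' : Tendsto v atTop (𝓝[Ω] p) :=
      tendsto_nhdsWithin_iff.2 ⟨hlim, .of_forall fun n => (hv n).1⟩
    have h2 := ge_of_tendsto (((h0 p hfr).abs).comp hlim') (.of_forall fun n => (hv n).2.2)
    rw [abs_zero] at h2
    linarith

/-- The area of the part of a minimal graph with zero boundary values over a set `D` where
`|u| ≤ h`, in terms of a cutoff function `η` for `D`. -/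
theorem area_le_of_zeroBoundary {κ τ : ℝ} {Ω D K₀ : Set (Coord 2)} {u η : Coord 2 → ℝ}
    (hu : IsMinimalGraph κ τ Ω u) (h0 : HasZeroBoundaryValues κ Ω u)
    (hη : ContDiffOn ℝ 1 η (baseSet κ)) (hη0 : ∀ p ∈ baseSet κ, 0 ≤ η p)
    (hη1 : ∀ p ∈ baseSet κ, η p ≤ 1) (hK₀ : IsCompact K₀) (hb : K₀ ⊆ baseSet κ)
    (hηK : ∀ p ∈ baseSet κ \ K₀, η p = 0) (hD : MeasurableSet D) (hDK : D ⊆ K₀)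
    (hηD : ∀ p ∈ D, η p = 1) {h : ℝ} (hh : 0 < h) {ρ : ℝ} (hρ : ∀ p ∈ K₀, ‖p‖ ≤ ρ) :
    ∫⁻ p in {p | p ∈ Ω ∧ p ∈ D ∧ |u p| ≤ h}, ENNReal.ofReal (lam κ p * slope κ τ u p) ≤
      2 * (ENNReal.ofReal (1 + |τ| * ρ) * ∫⁻ p in K₀, ENNReal.ofReal (lam κ p ^ 2)) +
        ENNReal.ofReal (2 * h) * ∫⁻ p in K₀, ENNReal.ofReal (lam κ p * ‖fderiv ℝ η p‖) := by
  have huc := hu.contDiffOn.continuousOn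
  have hKm := hK₀.measurableSet
  -- These sets increase to the part where u ≠ 0 and |u| ≤ h. On each of them the truncation with ε
  -- = 1/(n + 1) has slope one, and the bound is independent of n.
  let A : ℕ → Set (Coord 2) := fun n =>
    (Ω ∩ u ⁻¹' {s | 2 * (1 / ((n : ℝ) + 1)) ≤ |s| ∧ |s| ≤ h}) ∩ D
  have hAm : ∀ n, MeasurableSet (A n) := fun n => by
    refine (measurableSet_inter_preimage hu.isOpen huc ?_).inter hD
    exact (isClosed_le continuous_const continuous_abs).inter
      (isClosed_le continuous_abs continuous_const)
  have hmono : Monotone A := by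
    intro m n hmn p hp
    refine ⟨⟨hp.1.1, le_trans ?_ hp.1.2.1, hp.1.2.2⟩, hp.2⟩
    have : (m : ℝ) ≤ n := by exact_mod_cast hmn
    gcongr
  have hsub : {p | p ∈ Ω ∧ p ∈ D ∧ |u p| ≤ h} ⊆ (Ω ∩ u ⁻¹' {0}) ∩ D ∪ ⋃ n, A n := by
    rintro p ⟨hpΩ, hpD, hph⟩
    by_cases hp0 : u p = 0
    · exact Or.inl ⟨⟨hpΩ, hp0⟩, hpD⟩
    · right
      obtain ⟨n, hn⟩ := exists_nat_one_div_lt (half_pos (abs_pos.2 hp0))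
      exact mem_iUnion.2 ⟨n, ⟨hpΩ, by linarith, hph⟩, hpD⟩
  have hlamK : ∀ K : Set (Coord 2), MeasurableSet K → K ⊆ K₀ →
      ∫⁻ p in K, ENNReal.ofReal (lam κ p ^ 2 * (1 + |τ| * ‖p‖)) ≤
        ENNReal.ofReal (1 + |τ| * ρ) * ∫⁻ p in K₀, ENNReal.ofReal (lam κ p ^ 2) := by
    intro K hKm hKK
    rw [← lintegral_const_mul' _ _ ENNReal.ofReal_ne_top]
    refine (setLIntegral_mono' hKm fun p hp => ?_).trans (lintegral_mono_set hKK)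
    rw [mul_comm, ENNReal.ofReal_mul (by positivity)]
    gcongr
    exact hρ p (hKK hp)
  -- On the zero set ∇u = 0 almost everywhere, so a = τλy, b = −τλx and V ≤ λ(1 + |τ|‖p‖). This part
  -- and the limit over n together account for the factor 2.
  have hpart0 : ∫⁻ p in (Ω ∩ u ⁻¹' {0}) ∩ D, ENNReal.ofReal (lam κ p * slope κ τ u p) ≤
      ENNReal.ofReal (1 + |τ| * ρ) * ∫⁻ p in K₀, ENNReal.ofReal (lam κ p ^ 2) := by
    have hm := (measurableSet_inter_preimage hu.isOpen huc
      (isClosed_singleton (x := (0 : ℝ)))).inter hD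
    refine le_trans ?_ (hlamK _ hm fun p hp => hDK hp.2)
    refine lintegral_mono_ae ?_
    have hae := ae_restrict_of_ae_restrict_of_subset (inter_subset_left (t := D))
      (ae_fderiv_eq_zero hu.isOpen (hu.contDiffOn.of_le (by norm_num)))
    filter_upwards [hae, ae_restrict_mem hm] with p hp hpm
    have hL : 0 < lam κ p := conf_pos (hu.subset hpm.1.1)
    refine ENNReal.ofReal_le_ofReal ?_
    have hs : slope κ τ u p ≤ lam κ p * (1 + |τ| * ‖p‖) := by
      refine Real.sqrt_le_iff.2 ⟨by positivity, ?_⟩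
      simp only [gradX, gradY, pd, hp]
      have h1 := norm_sq_coord p
      have h2 := sq_abs τ
      have h3 : 0 ≤ lam κ p ^ 2 * (|τ| * ‖p‖) := by positivity
      simp only [zero_apply]
      have : (lam κ p * (1 + |τ| * ‖p‖)) ^ 2 = lam κ p ^ 2 + 2 * (lam κ p ^ 2 * (|τ| * ‖p‖)) +
        lam κ p ^ 2 * (|τ| ^ 2 * ‖p‖ ^ 2) := by ring
      rw [this, h2, h1]
      nlinarith
    nlinarith
  have hpart : ∀ n, ∫⁻ p in A n, ENNReal.ofReal (lam κ p * slope κ τ u p) ≤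
      ENNReal.ofReal (1 + |τ| * ρ) * (∫⁻ p in K₀, ENNReal.ofReal (lam κ p ^ 2)) +
        ENNReal.ofReal (2 * h) * ∫⁻ p in K₀, ENNReal.ofReal (lam κ p * ‖fderiv ℝ η p‖) := by
    intro n
    have hε : 0 < 1 / ((n : ℝ) + 1) := by positivity
    obtain ⟨T, T', hT, hTc, hT0, hT1, hTH, hTe, hTz⟩ := exists_truncation_away hh hε
    -- T(u) vanishes where |u| ≤ ε and η vanishes off K₀, so the test function is supported in this
    -- compact part of Ω.
    have hKc := isCompact_of_zeroBoundary hu.isOpen huc h0 hK₀ hb hε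
    have key := area_estimate hu.isOpen hu.subset hu.contDiffOn (fun p hp => hu.div_flux hp)
      (hη.mono hu.subset) (fun p hp => hη0 p (hu.subset hp)) (fun p hp => hη1 p (hu.subset hp))
      hT hTc hT0 hT1 hTH hKc (fun p hp => hp.1) (fun p hp => by
        by_cases hpK : p ∈ K₀
        · have : |u p| ≤ 1 / ((n : ℝ) + 1) := by
            by_contra hcon
            exact hp.2 ⟨hp.1, hpK, (not_le.1 hcon).le⟩
          rw [hTz _ this, mul_zero]
        · rw [hηK p ⟨hu.subset hp.1, hpK⟩, zero_mul])
    refine le_trans ?_ (key.trans (add_le_add (hlamK _ hKc.measurableSet fun p hp => hp.2.1) ?_))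
    · refine le_trans (setLIntegral_mono' (hAm n) fun p hp => ?_) (lintegral_mono_set
        fun p hp => (⟨hp.1.1, hDK hp.2, ?_⟩ : p ∈ Ω ∧ p ∈ K₀ ∧ 1 / ((n : ℝ) + 1) ≤ |u p|))
      · rw [hηD p hp.2, hTe _ hp.1.2.1 hp.1.2.2, one_mul, one_mul]
      · have := hp.1.2.1
        linarith
    · gcongr
      exact fun p hp => hp.2.1
  calc ∫⁻ p in {p | p ∈ Ω ∧ p ∈ D ∧ |u p| ≤ h}, ENNReal.ofReal (lam κ p * slope κ τ u p)
      ≤ ∫⁻ p in (Ω ∩ u ⁻¹' {0}) ∩ D ∪ ⋃ n, A n, ENNReal.ofReal (lam κ p * slope κ τ u p) :=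
        lintegral_mono_set hsub
    _ ≤ _ := lintegral_union_le _ _ _
    _ ≤ ENNReal.ofReal (1 + |τ| * ρ) * (∫⁻ p in K₀, ENNReal.ofReal (lam κ p ^ 2)) +
        (ENNReal.ofReal (1 + |τ| * ρ) * (∫⁻ p in K₀, ENNReal.ofReal (lam κ p ^ 2)) +
        ENNReal.ofReal (2 * h) * ∫⁻ p in K₀, ENNReal.ofReal (lam κ p * ‖fderiv ℝ η p‖)) := by
        refine add_le_add hpart0 ?_
        rw [setLIntegral_iUnion_of_directed _ (hmono.directed_le)]
        exact iSup_le hpart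
    _ = _ := by rw [← add_assoc, ← two_mul]


/-! ### Coverings of sets of finite length -/

/-- The Hausdorff measure is a supremum over scales, so the infimum over covers at scale δ is at
most the measure. -/
theorem exists_cover_of_hausdorffMeasure {X : Type*} [EMetricSpace X] [MeasurableSpace X]
    [BorelSpace X] {S : Set X} (hS : Measure.hausdorffMeasure 1 S ≠ ∞) {δ ε : ℝ≥0∞} (hδ : 0 < δ)
    (hε : ε ≠ 0) : ∃ t : ℕ → Set X, S ⊆ ⋃ n, t n ∧ (∀ n, Metric.ediam (t n) ≤ δ) ∧
      ∑' n, ⨆ _ : (t n).Nonempty, Metric.ediam (t n) ≤ Measure.hausdorffMeasure 1 S + ε := by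
  have h := ENNReal.lt_add_right hS hε
  rw [Measure.hausdorffMeasure_apply] at h
  have h2 := lt_of_le_of_lt (le_iSup₂ (f := fun (r : ℝ≥0∞) (_ : 0 < r) =>
    ⨅ (t : ℕ → Set X) (_ : S ⊆ ⋃ n, t n) (_ : ∀ n, Metric.ediam (t n) ≤ r),
      ∑' n, ⨆ _ : (t n).Nonempty, Metric.ediam (t n) ^ (1 : ℝ)) δ hδ) h
  rw [← Measure.hausdorffMeasure_apply] at h2
  simp only [iInf_lt_iff] at h2
  obtain ⟨t, ht, hd, hlt⟩ := h2
  refine ⟨t, ht, hd, ?_⟩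
  simpa only [ENNReal.rpow_one] using hlt.le

/-- Cut S into the dyadic level sets 2^k ≤ w < 2^(k+1) and cover each with total diameter close to
its Hausdorff measure. On a piece w varies by a factor of at most two, hence the 2L; the
approximation errors are the 1. Each covering set is replaced by a ball centred at one of its points
in the piece, and compactness leaves finitely many. -/
theorem exists_weighted_cover {S : Set (Coord 2)} (hS : IsCompact S) {w : Coord 2 → ℝ}
    (hw : Measurable w) (hw1 : ∀ x ∈ S, 1 ≤ w x) {L : ℝ} (hL : 0 ≤ L)
    (hSL : ∫⁻ x in S, ENNReal.ofReal (w x) ∂(Measure.hausdorffMeasure 1) ≤ ENNReal.ofReal L)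
    {δ : ℝ} (hδ : 0 < δ) : ∃ (s : Finset (ℕ × ℕ)) (x : ℕ × ℕ → Coord 2) (r : ℕ × ℕ → ℝ),
      (∀ i ∈ s, x i ∈ S ∧ 0 < r i ∧ r i ≤ δ) ∧ S ⊆ ⋃ i ∈ s, Metric.ball (x i) (r i) ∧
      ∑ i ∈ s, w (x i) * r i ≤ 2 * L + 1 := by
  let P : ℕ → Set (Coord 2) := fun k => S ∩ w ⁻¹' Ico (2 ^ k) (2 ^ (k + 1))
  have hPm : ∀ k, MeasurableSet (P k) := fun k => hS.measurableSet.inter (hw measurableSet_Ico)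
  have hPd : Pairwise (Function.onFun Disjoint P) := by
    have key : ∀ i j, i < j → Disjoint (P i) (P j) := fun i j hij => by
      rw [Set.disjoint_left]
      intro x hx hx'
      have h1 : w x < 2 ^ (i + 1) := hx.2.2
      have h2 : (2 : ℝ) ^ j ≤ w x := hx'.2.1
      have h3 : (2 : ℝ) ^ (i + 1) ≤ 2 ^ j := pow_le_pow_right₀ one_le_two hij
      linarith
    intro i j hij
    rcases lt_or_gt_of_ne hij with h | h
    · exact key i j h
    · exact (key j i h).symm
  have hPS : ⋃ k, P k = S := by
    refine Subset.antisymm (iUnion_subset fun k => inter_subset_left) fun x hx => ?_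
    obtain ⟨k, hk1, hk2⟩ := exists_nat_pow_near (hw1 x hx) one_lt_two
    exact mem_iUnion.2 ⟨k, hx, hk1, hk2⟩
  have hsum : ∑' k, 2 ^ k * Measure.hausdorffMeasure 1 (P k) ≤ ENNReal.ofReal L := by
    refine le_trans ?_ hSL
    rw [← hPS, lintegral_iUnion hPm hPd]
    refine ENNReal.tsum_le_tsum fun k => ?_
    rw [← setLIntegral_const]
    refine setLIntegral_mono' (hPm k) fun x hx => ?_
    have : ENNReal.ofReal (2 ^ k) ≤ ENNReal.ofReal (w x) := ENNReal.ofReal_le_ofReal hx.2.1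
    rwa [ENNReal.ofReal_pow (by norm_num), ENNReal.ofReal_ofNat] at this
  have hfin : ∀ k, Measure.hausdorffMeasure 1 (P k) ≠ ∞ := fun k hk => by
    have := (ENNReal.le_tsum (f := fun k => 2 ^ k * Measure.hausdorffMeasure 1 (P k)) k).trans hsum
    simp only [hk] at this
    rw [ENNReal.mul_top (by positivity)] at this
    exact absurd this (by simp)
  -- Two families of errors, each of sum below 1/2: c for the total diameters of the covers and e
  -- for the enlargement of the radii.
  obtain ⟨c, hc0, hc⟩ := ENNReal.exists_pos_sum_of_countable
    (ε := ENNReal.ofReal (1 / 2)) (by simp) ℕ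
  obtain ⟨e, he0, he⟩ := ENNReal.exists_pos_sum_of_countable
    (ε := ENNReal.ofReal (1 / 2)) (by simp) (ℕ × ℕ)
  have h2k : ∀ k : ℕ, (2 : ℝ≥0∞) ^ k ≠ 0 := fun k => by positivity
  have h2t : ∀ k : ℕ, (2 : ℝ≥0∞) ^ k ≠ ∞ := fun k => ENNReal.pow_ne_top (by simp)
  choose t htS htd hts using fun k => exists_cover_of_hausdorffMeasure (hfin k)
    (δ := ENNReal.ofReal (δ / 2)) (ε := c k / 2 ^ (k + 1)) (by simpa using hδ)
    (ENNReal.div_ne_zero.2 ⟨by simpa using (hc0 k).ne', h2t _⟩)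
  let I : Set (ℕ × ℕ) := {i | (t i.1 i.2 ∩ P i.1).Nonempty}
  have hch : ∀ i : ℕ × ℕ, ∃ x, i ∈ I → x ∈ t i.1 i.2 ∩ P i.1 := fun i => by
    by_cases hi : i ∈ I
    · exact ⟨hi.some, fun _ => hi.some_mem⟩
    · exact ⟨0, fun h => absurd h hi⟩
  choose x hx using hch
  -- The enlargement puts the covering set inside an open ball. It is at most δ/2 to keep the radius
  -- below δ, and at most e i / 2^(k+1) because the weight at the centre is below 2^(k+1).
  let r : ℕ × ℕ → ℝ := fun i => (Metric.ediam (t i.1 i.2)).toReal + min (δ / 2) (e i / 2 ^ (i.1 + 1))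
  have hdt : ∀ i : ℕ × ℕ, Metric.ediam (t i.1 i.2) ≠ ∞ := fun i =>
    ((htd i.1 i.2).trans_lt ENNReal.ofReal_lt_top).ne
  have hm0 : ∀ i : ℕ × ℕ, 0 < min (δ / 2) ((e i : ℝ) / 2 ^ (i.1 + 1)) := fun i => by
    have : (0 : ℝ) < e i := by exact_mod_cast he0 i
    exact lt_min (by positivity) (by positivity)
  have hr0 : ∀ i, 0 < r i := fun i => add_pos_of_nonneg_of_pos ENNReal.toReal_nonneg (hm0 i)
  have hcov : S ⊆ ⋃ i : I, Metric.ball (x i) (r i) := fun y hy => by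
    rw [← hPS] at hy
    obtain ⟨k, hk⟩ := mem_iUnion.1 hy
    obtain ⟨n, hn⟩ := mem_iUnion.1 (htS k hk)
    have hi : (k, n) ∈ I := ⟨y, hn, hk⟩
    refine mem_iUnion.2 ⟨⟨(k, n), hi⟩, ?_⟩
    have h1 := Metric.edist_le_ediam_of_mem hn (hx (k, n) hi).1
    have h2 : dist y (x (k, n)) ≤ (Metric.ediam (t k n)).toReal := by
      rw [dist_edist]
      exact ENNReal.toReal_mono (hdt (k, n)) h1
    exact lt_of_le_of_lt h2 (lt_add_of_pos_right _ (hm0 (k, n)))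
  obtain ⟨s', hs'⟩ := hS.elim_finite_subcover _ (fun i : I => Metric.isOpen_ball) hcov
  refine ⟨s'.map (Function.Embedding.subtype _), x, r, ?_, ?_, ?_⟩
  · intro i hi
    obtain ⟨j, hj, rfl⟩ := Finset.mem_map.1 hi
    refine ⟨(hx _ j.2).2.1, hr0 _, ?_⟩
    have h1 : (Metric.ediam (t j.1.1 j.1.2)).toReal ≤ δ / 2 :=
      ENNReal.toReal_le_of_le_ofReal (by positivity) (htd _ _)
    have h2 := min_le_left (δ / 2) ((e j : ℝ) / 2 ^ (j.1.1 + 1))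
    show (Metric.ediam (t j.1.1 j.1.2)).toReal + min (δ / 2) (e j / 2 ^ (j.1.1 + 1)) ≤ δ
    linarith
  · intro y hy
    obtain ⟨j, hj, hyj⟩ := mem_iUnion₂.1 (hs' hy)
    exact mem_iUnion₂.2 ⟨j, Finset.mem_map_of_mem _ hj, hyj⟩
  · rw [← ENNReal.ofReal_le_ofReal_iff (by positivity), Finset.sum_map]
    have hterm : ∀ j : I, ENNReal.ofReal (w (x j) * r j) ≤
        2 ^ (j.1.1 + 1) * (⨆ _ : (t j.1.1 j.1.2).Nonempty, Metric.ediam (t j.1.1 j.1.2)) + e j := by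
      intro j
      have hj := hx _ j.2
      have hne : (t j.1.1 j.1.2).Nonempty := ⟨_, hj.1⟩
      have hwj : w (x j) ≤ 2 ^ (j.1.1 + 1) := hj.2.2.2.le
      rw [iSup_pos hne]
      have h1 : w (x j) * r j ≤ 2 ^ (j.1.1 + 1) * (Metric.ediam (t j.1.1 j.1.2)).toReal + e j := by
        have h2 := min_le_right (δ / 2) ((e j : ℝ) / 2 ^ (j.1.1 + 1))
        have h3 : (2 : ℝ) ^ (j.1.1 + 1) * min (δ / 2) ((e j : ℝ) / 2 ^ (j.1.1 + 1)) ≤ e j := by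
          have := mul_le_mul_of_nonneg_left h2 (by positivity : (0 : ℝ) ≤ 2 ^ (j.1.1 + 1))
          rwa [mul_div_cancel₀ _ (by positivity)] at this
        have h4 := mul_le_mul_of_nonneg_right hwj (hr0 j).le
        have h5 : (2 : ℝ) ^ (j.1.1 + 1) * r j = 2 ^ (j.1.1 + 1) *
          (Metric.ediam (t j.1.1 j.1.2)).toReal +
          2 ^ (j.1.1 + 1) * min (δ / 2) ((e j : ℝ) / 2 ^ (j.1.1 + 1)) := mul_add _ _ _
        linarith
      refine (ENNReal.ofReal_le_ofReal h1).trans ?_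
      rw [ENNReal.ofReal_add (by positivity) (by positivity), ENNReal.ofReal_mul (by positivity),
        ENNReal.ofReal_toReal (hdt _), ENNReal.ofReal_pow (by norm_num), ENNReal.ofReal_ofNat,
        ENNReal.ofReal_coe_nnreal]
    have hnn : ∀ j ∈ s', 0 ≤ w (x j) * r j := fun j _ =>
      mul_nonneg (zero_le_one.trans (hw1 _ (hx _ j.2).2.1)) (hr0 _).le
    simp only [Function.Embedding.subtype_apply]
    rw [ENNReal.ofReal_sum_of_nonneg hnn]
    let F : ℕ × ℕ → ℝ≥0∞ := fun i =>
      2 ^ (i.1 + 1) * (⨆ _ : (t i.1 i.2).Nonempty, Metric.ediam (t i.1 i.2)) + e i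
    calc ∑ j ∈ s', ENNReal.ofReal (w (x j) * r j) ≤ ∑ j ∈ s', F j :=
          Finset.sum_le_sum fun j _ => hterm j
      _ ≤ ∑' j : I, F j := ENNReal.sum_le_tsum _
      _ ≤ ∑' i, F i := ENNReal.tsum_comp_le_tsum_of_injective Subtype.val_injective _
      _ = ∑' k, ∑' n, 2 ^ (k + 1) * (⨆ _ : (t k n).Nonempty, Metric.ediam (t k n)) +
          ∑' i, (e i : ℝ≥0∞) := by
          simp only [F]
          rw [ENNReal.tsum_add, ENNReal.tsum_prod (f := fun k n => 2 ^ (k + 1) *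
            (⨆ _ : (t k n).Nonempty, Metric.ediam (t k n)))]
      _ ≤ ∑' k, (2 * (2 ^ k * Measure.hausdorffMeasure 1 (P k)) + c k) +
          ENNReal.ofReal (1 / 2) := by
          refine add_le_add (ENNReal.tsum_le_tsum fun k => ?_) he.le
          rw [ENNReal.tsum_mul_left]
          refine (mul_le_mul_right (hts k) _).trans (le_of_eq ?_)
          rw [mul_add, ENNReal.mul_div_cancel (h2k _) (h2t _), pow_succ]
          ring
      _ ≤ 2 * ENNReal.ofReal L + ENNReal.ofReal (1 / 2) + ENNReal.ofReal (1 / 2) := by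
          rw [ENNReal.tsum_add, ENNReal.tsum_mul_left]
          gcongr
      _ = _ := by
          rw [add_assoc, ← ENNReal.ofReal_add (by norm_num) (by norm_num),
            ENNReal.ofReal_add (p := 2 * L) (q := 1) (by positivity) (by norm_num),
            ENNReal.ofReal_mul (by norm_num), ENNReal.ofReal_ofNat]
          norm_num


/-! ### Cutoff functions -/

/-- A smooth transition from `0` to `1` on the interval `[1, 4]`. -/
def transition (s : ℝ) : ℝ := Real.smoothTransition ((s - 1) / 3)

theorem contDiff_transition : ContDiff ℝ 1 transition :=
  Real.smoothTransition.contDiff.comp (by fun_prop)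

theorem transition_nonneg (s : ℝ) : 0 ≤ transition s := Real.smoothTransition.nonneg _

theorem transition_le_one (s : ℝ) : transition s ≤ 1 := Real.smoothTransition.le_one _

theorem transition_eq_zero {s : ℝ} (h : s ≤ 1) : transition s = 0 :=
  Real.smoothTransition.zero_of_nonpos (by linarith)

theorem transition_eq_one {s : ℝ} (h : 4 ≤ s) : transition s = 1 :=
  Real.smoothTransition.one_of_one_le (by linarith)

theorem deriv_transition_eq_zero {s : ℝ} (h : 4 < s) : deriv transition s = 0 := by
  have : transition =ᶠ[𝓝 s] fun _ => 1 := by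
    filter_upwards [Ioi_mem_nhds h] with t ht using transition_eq_one (le_of_lt ht)
  rw [this.deriv_eq, deriv_const]

theorem deriv_transition_eq_zero_of_lt {s : ℝ} (h : s < 1) : deriv transition s = 0 := by
  have : transition =ᶠ[𝓝 s] fun _ => 0 := by
    filter_upwards [Iio_mem_nhds h] with t ht using transition_eq_zero (le_of_lt ht)
  rw [this.deriv_eq, deriv_const]

theorem exists_deriv_transition_le : ∃ C, 0 < C ∧ ∀ s, |deriv transition s| ≤ C := by
  have hs : HasCompactSupport (deriv transition) :=
    HasCompactSupport.intro (isCompact_Icc (a := (1 : ℝ)) (b := 4)) fun s hs => by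
      rw [mem_Icc, not_and_or, not_le, not_le] at hs
      exact hs.elim deriv_transition_eq_zero_of_lt deriv_transition_eq_zero
  obtain ⟨C, hC⟩ := hs.exists_bound_of_continuous (contDiff_transition.continuous_deriv le_rfl)
  exact ⟨max C 1, by positivity, fun s => (hC s).trans (le_max_left _ _)⟩

/-- A bound for the derivative of `transition`. -/
def transitionBound : ℝ := exists_deriv_transition_le.choose

theorem transitionBound_pos : 0 < transitionBound := exists_deriv_transition_le.choose_spec.1

theorem abs_deriv_transition_le (s : ℝ) : |deriv transition s| ≤ transitionBound :=
  exists_deriv_transition_le.choose_spec.2 s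

/-- The cutoff function which vanishes on the ball of radius `r` and is one outside that of
radius `2 r`. -/
def ballCutoff (c : Coord 2) (r : ℝ) (p : Coord 2) : ℝ := transition (‖p - c‖ ^ 2 / r ^ 2)

theorem ballCutoff_nonneg (c : Coord 2) (r : ℝ) (p : Coord 2) : 0 ≤ ballCutoff c r p :=
  transition_nonneg _

theorem ballCutoff_le_one (c : Coord 2) (r : ℝ) (p : Coord 2) : ballCutoff c r p ≤ 1 :=
  transition_le_one _

theorem contDiff_ballCutoff (c : Coord 2) (r : ℝ) : ContDiff ℝ 1 (ballCutoff c r) :=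
  contDiff_transition.comp (((contDiff_id.sub contDiff_const).norm_sq ℝ).div_const _)

theorem ballCutoff_eq_zero {c : Coord 2} {r : ℝ} (hr : 0 < r) {p : Coord 2}
    (hp : ‖p - c‖ ≤ r) : ballCutoff c r p = 0 := by
  refine transition_eq_zero ((div_le_one (by positivity)).2 ?_)
  gcongr

theorem ballCutoff_eq_one {c : Coord 2} {r : ℝ} (hr : 0 < r) {p : Coord 2}
    (hp : 2 * r ≤ ‖p - c‖) : ballCutoff c r p = 1 := by
  refine transition_eq_one ((le_div_iff₀ (by positivity)).2 ?_)
  nlinarith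

/-- The transition is constant beyond 4, that is, beyond distance 2r; within it the gradient of ‖p −
c‖²/r² has norm 2‖p − c‖/r² ≤ 4/r. -/
theorem norm_fderiv_ballCutoff_le {c : Coord 2} {r : ℝ} (hr : 0 < r) (p : Coord 2) :
    ‖fderiv ℝ (ballCutoff c r) p‖ ≤
      (Metric.closedBall c (2 * r)).indicator (fun _ => 4 * transitionBound / r) p := by
  have h1 : HasFDerivAt (fun p : Coord 2 => ‖p - c‖ ^ 2 * (r ^ 2)⁻¹)
      ((r ^ 2)⁻¹ • (2 • (innerSL ℝ (p - c)))) p := by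
    have := ((hasFDerivAt_id p).sub_const c).norm_sq.mul_const ((r ^ 2)⁻¹)
    simpa using this
  have h2 : HasFDerivAt (ballCutoff c r) (deriv transition (‖p - c‖ ^ 2 / r ^ 2) •
      ((r ^ 2)⁻¹ • (2 • (innerSL ℝ (p - c))))) p :=
    ((contDiff_transition.differentiable one_ne_zero _).hasDerivAt).comp_hasFDerivAt p h1
  rw [h2.fderiv, norm_smul, norm_smul, ← Nat.cast_smul_eq_nsmul ℝ, norm_smul, innerSL_apply_norm]
  by_cases hp : p ∈ Metric.closedBall c (2 * r)
  · rw [indicator_of_mem hp]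
    rw [Metric.mem_closedBall, dist_eq_norm] at hp
    have h3 := abs_deriv_transition_le (‖p - c‖ ^ 2 / r ^ 2)
    have hC := transitionBound_pos
    rw [Real.norm_eq_abs, norm_inv, norm_pow, Real.norm_of_nonneg hr.le]
    calc |deriv transition (‖p - c‖ ^ 2 / r ^ 2)| * ((r ^ 2)⁻¹ * (‖((2 : ℕ) : ℝ)‖ * ‖p - c‖))
        ≤ transitionBound * ((r ^ 2)⁻¹ * (‖((2 : ℕ) : ℝ)‖ * (2 * r))) := by gcongr
      _ = 4 * transitionBound / r := by
        simp
        field_simp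
        ring
  · rw [indicator_of_notMem hp]
    rw [Metric.mem_closedBall, dist_eq_norm, not_le] at hp
    rw [deriv_transition_eq_zero, norm_zero, zero_mul]
    rw [lt_div_iff₀ (by positivity)]
    nlinarith

/-- The product of the cutoff functions of finitely many balls. -/
def coverCutoff {ι : Type*} (s : Finset ι) (x : ι → Coord 2) (r : ι → ℝ) (p : Coord 2) : ℝ :=
  ∏ i ∈ s, ballCutoff (x i) (r i) p

theorem contDiff_coverCutoff {ι : Type*} (s : Finset ι) (x : ι → Coord 2) (r : ι → ℝ) :
    ContDiff ℝ 1 (coverCutoff s x r) :=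
  contDiff_prod fun i _ => contDiff_ballCutoff (x i) (r i)

theorem coverCutoff_nonneg {ι : Type*} (s : Finset ι) (x : ι → Coord 2) (r : ι → ℝ)
    (p : Coord 2) : 0 ≤ coverCutoff s x r p :=
  Finset.prod_nonneg fun _ _ => ballCutoff_nonneg _ _ _

theorem coverCutoff_le_one {ι : Type*} (s : Finset ι) (x : ι → Coord 2) (r : ι → ℝ)
    (p : Coord 2) : coverCutoff s x r p ≤ 1 :=
  Finset.prod_le_one (fun _ _ => ballCutoff_nonneg _ _ _) fun _ _ => ballCutoff_le_one _ _ _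

/-- In the product rule the remaining factors lie in [0, 1]. -/
theorem norm_fderiv_coverCutoff_le {ι : Type*} (s : Finset ι) (x : ι → Coord 2) (r : ι → ℝ)
    (p : Coord 2) :
    ‖fderiv ℝ (coverCutoff s x r) p‖ ≤ ∑ i ∈ s, ‖fderiv ℝ (ballCutoff (x i) (r i)) p‖ := by
  classical
  have h := HasFDerivAt.finsetProd (u := s) (g := fun i => ballCutoff (x i) (r i)) (x := p)
    (g' := fun i => fderiv ℝ (ballCutoff (x i) (r i)) p) fun i _ =>
      ((contDiff_ballCutoff (x i) (r i)).differentiable one_ne_zero p).hasFDerivAt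
  have h' : HasFDerivAt (coverCutoff s x r) _ p := h
  rw [h'.fderiv]
  refine (norm_sum_le _ _).trans (Finset.sum_le_sum fun i _ => ?_)
  rw [norm_smul]
  refine mul_le_of_le_one_left (norm_nonneg _) ?_
  rw [Real.norm_of_nonneg (Finset.prod_nonneg fun _ _ => ballCutoff_nonneg _ _ _)]
  exact Finset.prod_le_one (fun _ _ => ballCutoff_nonneg _ _ _) fun _ _ => ballCutoff_le_one _ _ _

/-- The energy of the cutoff function of a covering. -/
theorem lintegral_coverCutoff_le {ι : Type*} {κ : ℝ} {K : Set (Coord 2)} (hK : MeasurableSet K)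
    (s : Finset ι) (x : ι → Coord 2) (r : ι → ℝ) (hr : ∀ i ∈ s, 0 < r i)
    (h : ∀ i ∈ s, ∀ p ∈ K, ‖p - x i‖ ≤ 2 * r i → lam κ p ≤ 2 * lam κ (x i))
    (hpos : ∀ p ∈ K, 0 ≤ lam κ p) (hposx : ∀ i ∈ s, 0 ≤ lam κ (x i)) :
    ∫⁻ p in K, ENNReal.ofReal (lam κ p * ‖fderiv ℝ (coverCutoff s x r) p‖) ≤
      ENNReal.ofReal (32 * Real.pi * transitionBound * ∑ i ∈ s, lam κ (x i) * r i) := by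
  have hC := transitionBound_pos
  calc ∫⁻ p in K, ENNReal.ofReal (lam κ p * ‖fderiv ℝ (coverCutoff s x r) p‖)
      ≤ ∫⁻ p in K, ∑ i ∈ s, (Metric.closedBall (x i) (2 * r i)).indicator
          (fun _ => ENNReal.ofReal (8 * transitionBound * lam κ (x i) / r i)) p := by
        refine setLIntegral_mono' hK fun p hp => ?_
        have h1 : lam κ p * ‖fderiv ℝ (coverCutoff s x r) p‖ ≤ ∑ i ∈ s, lam κ p *
            (Metric.closedBall (x i) (2 * r i)).indicator
              (fun _ => 4 * transitionBound / r i) p := by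
          rw [← Finset.mul_sum]
          refine mul_le_mul_of_nonneg_left ?_ (hpos p hp)
          exact (norm_fderiv_coverCutoff_le s x r p).trans
            (Finset.sum_le_sum fun i hi => norm_fderiv_ballCutoff_le (hr i hi) p)
        refine (ENNReal.ofReal_le_ofReal h1).trans ?_
        rw [ENNReal.ofReal_sum_of_nonneg fun i hi => mul_nonneg (hpos p hp)
          (indicator_nonneg (fun _ _ => by have := hr i hi; positivity) p)]
        refine Finset.sum_le_sum fun i hi => ?_
        have hri := hr i hi
        by_cases hpb : p ∈ Metric.closedBall (x i) (2 * r i)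
        · rw [indicator_of_mem hpb, indicator_of_mem hpb]
          refine ENNReal.ofReal_le_ofReal ?_
          have h2 := h i hi p hp (by rwa [Metric.mem_closedBall, dist_eq_norm] at hpb)
          calc lam κ p * (4 * transitionBound / r i)
              ≤ 2 * lam κ (x i) * (4 * transitionBound / r i) := by gcongr
            _ = 8 * transitionBound * lam κ (x i) / r i := by ring
        · rw [indicator_of_notMem hpb, mul_zero, ENNReal.ofReal_zero]
          exact zero_le
    _ ≤ ∫⁻ p, ∑ i ∈ s, (Metric.closedBall (x i) (2 * r i)).indicator
          (fun _ => ENNReal.ofReal (8 * transitionBound * lam κ (x i) / r i)) p :=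
        setLIntegral_le_lintegral _ _
    _ = ∑ i ∈ s, ENNReal.ofReal (8 * transitionBound * lam κ (x i) / r i) *
          volume (Metric.closedBall (x i) (2 * r i)) := by
        rw [lintegral_finsetSum]
        · refine Finset.sum_congr rfl fun i _ => ?_
          rw [lintegral_indicator_const Metric.isClosed_closedBall.measurableSet]
        · exact fun i _ => measurable_const.indicator Metric.isClosed_closedBall.measurableSet
    -- A ball of radius 2r has area 4πr², and the integrand 8Cλ/r already contains the factor 2 of
    -- the comparison of λ with its value at the centre.
    _ = ∑ i ∈ s, ENNReal.ofReal (32 * Real.pi * transitionBound * (lam κ (x i) * r i)) := by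
        refine Finset.sum_congr rfl fun i hi => ?_
        have hri := hr i hi
        have hxi := hposx i hi
        rw [EuclideanSpace.volume_closedBall_fin_two, ← ENNReal.ofReal_pow (by positivity),
          ← NNReal.coe_real_pi,
          ← ENNReal.ofReal_mul (by positivity), ← ENNReal.ofReal_mul (by positivity)]
        congr 1
        field_simp
        ring
    _ = _ := by
        rw [← ENNReal.ofReal_sum_of_nonneg fun i hi => ?_, Finset.mul_sum]
        have := hr i hi
        have := hposx i hi
        have := Real.pi_pos
        positivity


/-! ### Graphs over domains with boundary of finite length -/

theorem measurable_lam (κ : ℝ) : Measurable (lam κ : Coord 2 → ℝ) := by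
  unfold lam conf
  fun_prop

theorem one_le_lam {κ : ℝ} (hκ : κ ≤ 0) {p : Coord 2} (hp : p ∈ baseSet κ) : 1 ≤ lam κ p := by
  rw [lam_eq_radConf]
  exact one_le_radConf hκ (mem_baseSet_iff.1 hp)

/-- The area of the part of a minimal graph where `|u| ≤ h`, in terms of the length of the
boundary of the domain. -/
theorem area_le_of_length {κ τ : ℝ} (hκ : κ ≤ 0) {O K₀ : Set (Coord 2)} {u : Coord 2 → ℝ}
    (hO : IsOpen O) (hu : ContDiffOn ℝ 2 u O)
    (hdiv : ∀ p ∈ O, pd 0 (fluxX κ τ u) p + pd 1 (fluxY κ τ u) p = 0)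
    (hK₀ : IsCompact K₀) (hb : K₀ ⊆ baseSet κ) (hOK : O ⊆ K₀) {L : ℝ} (hL0 : 0 ≤ L)
    (hL : ∫⁻ p in frontier O, ENNReal.ofReal (lam κ p) ∂(Measure.hausdorffMeasure 1) ≤
      ENNReal.ofReal L)
    {h : ℝ} (hh : 0 < h) {ρ : ℝ} (hρ : ∀ p ∈ K₀, ‖p‖ ≤ ρ) :
    ∫⁻ p in {p | p ∈ O ∧ |u p| ≤ h}, ENNReal.ofReal (lam κ p * slope κ τ u p) ≤
      ENNReal.ofReal (1 + |τ| * ρ) * (∫⁻ p in K₀, ENNReal.ofReal (lam κ p ^ 2)) +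
        ENNReal.ofReal (2 * h) *
          ENNReal.ofReal (32 * Real.pi * transitionBound * (2 * L + 1)) := by
  have hC := transitionBound_pos
  have hcl : closure O ⊆ K₀ := closure_minimal hOK hK₀.isClosed
  have hfr : frontier O ⊆ K₀ := frontier_subset_closure.trans hcl
  have hfrc : IsCompact (frontier O) := hK₀.of_isClosed_subset isClosed_frontier hfr
  -- At scale δ₀ the factor λ oscillates by less than 1 ≤ λ, so λ at most doubles within the balls
  -- of radius 2r ≤ δ₀/2 used below.
  obtain ⟨δ₀, hδ₀, hunif⟩ := Metric.uniformContinuousOn_iff.1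
    (hK₀.uniformContinuousOn_of_continuous ((continuousOn_lam (κ := κ)).mono hb)) 1 one_pos
  let δ : ℕ → ℝ := fun n => δ₀ / 4 / (n + 1)
  have hδ : ∀ n, 0 < δ n := fun n => by positivity
  have hδ4 : ∀ n, δ n ≤ δ₀ / 4 := fun n =>
    div_le_self (by positivity) (by have : (0 : ℝ) ≤ n := n.cast_nonneg
                                    linarith)
  have hδm : ∀ m n : ℕ, m ≤ n → δ n ≤ δ m := fun m n hmn => by
    have : (m : ℝ) ≤ n := by exact_mod_cast hmn
    simp only [δ]
    gcongr
  -- Points at distance at least 2δ_n from the boundary: there every cutoff of a ball of radius at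
  -- most δ_n centred on the boundary equals one.
  let A : ℕ → Set (Coord 2) := fun n =>
    (O ∩ u ⁻¹' {s | |s| ≤ h}) ∩ ⋂ x ∈ frontier O, {p | 2 * δ n ≤ ‖p - x‖}
  have hAm : ∀ n, MeasurableSet (A n) := fun n => by
    refine (measurableSet_inter_preimage hO hu.continuousOn
      (isClosed_le continuous_abs continuous_const)).inter (IsClosed.measurableSet ?_)
    exact isClosed_biInter fun x _ => isClosed_le continuous_const (by fun_prop)
  have hmono : Monotone A := by
    intro m n hmn p hp
    refine ⟨hp.1, mem_iInter₂.2 fun x hx => ?_⟩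
    have h1 : 2 * δ m ≤ ‖p - x‖ := mem_iInter₂.1 hp.2 x hx
    show 2 * δ n ≤ ‖p - x‖
    linarith [hδm m n hmn]
  have hsub : {p | p ∈ O ∧ |u p| ≤ h} ⊆ ⋃ n, A n := by
    rintro p ⟨hpO, hph⟩
    obtain ⟨d, hd, hball⟩ := Metric.isOpen_iff.1 hO p hpO
    obtain ⟨n, hn⟩ := exists_nat_one_div_lt (show 0 < d / δ₀ by positivity)
    refine mem_iUnion.2 ⟨n, ⟨hpO, hph⟩, mem_iInter₂.2 fun x hx => ?_⟩
    have hxd : d ≤ ‖p - x‖ := by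
      by_contra hcon
      have hxO : x ∈ O := hball (by
        rw [Metric.mem_ball, dist_comm, dist_eq_norm]; exact not_le.1 hcon)
      rw [hO.frontier_eq] at hx
      exact hx.2 hxO
    refine le_trans ?_ hxd
    rw [lt_div_iff₀ hδ₀] at hn
    have : δ n = (1 / (n + 1) * δ₀) / 4 := by simp only [δ]; ring
    linarith
  have hpart : ∀ n, ∫⁻ p in A n, ENNReal.ofReal (lam κ p * slope κ τ u p) ≤
      ENNReal.ofReal (1 + |τ| * ρ) * (∫⁻ p in K₀, ENNReal.ofReal (lam κ p ^ 2)) +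
        ENNReal.ofReal (2 * h) *
          ENNReal.ofReal (32 * Real.pi * transitionBound * (2 * L + 1)) := by
    intro n
    obtain ⟨s, x, r, hs, hcov, hsum⟩ := exists_weighted_cover hfrc (measurable_lam κ)
      (fun x hx => one_le_lam hκ (hb (hfr hx))) hL0 hL (hδ n)
    obtain ⟨T, T', hT, hTc, hT0, hT1, hTH, hTe⟩ := exists_truncation hh
    -- Removing balls that cover the frontier leaves a compact subset of O, and the cutoff vanishes
    -- on the rest of O. Hence T need not vanish near zero here.
    let K : Set (Coord 2) := closure O \ ⋃ i ∈ s, Metric.ball (x i) (r i)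
    have hKc : IsCompact K := (hK₀.of_isClosed_subset isClosed_closure hcl).diff
      (isOpen_biUnion fun i _ => Metric.isOpen_ball)
    have hKO : K ⊆ O := fun p hp => by
      by_contra hpO
      exact hp.2 (hcov (by rw [hO.frontier_eq]; exact ⟨hp.1, hpO⟩))
    have hKK : K ⊆ K₀ := hKO.trans hOK
    have hη0 : ∀ p ∈ O \ K, coverCutoff s x r p = 0 := fun p hp => by
      have : p ∈ ⋃ i ∈ s, Metric.ball (x i) (r i) := by
        by_contra hcon
        exact hp.2 ⟨subset_closure hp.1, hcon⟩
      obtain ⟨i, hi, hpi⟩ := mem_iUnion₂.1 this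
      rw [Metric.mem_ball, dist_eq_norm] at hpi
      exact Finset.prod_eq_zero hi (ballCutoff_eq_zero (hs i hi).2.1 hpi.le)
    have hη1 : ∀ p ∈ A n, coverCutoff s x r p = 1 := fun p hp =>
      Finset.prod_eq_one fun i hi => ballCutoff_eq_one (hs i hi).2.1 (by
        have h1 : 2 * δ n ≤ ‖p - x i‖ := mem_iInter₂.1 hp.2 (x i) (hs i hi).1
        linarith [(hs i hi).2.2])
    have key := area_estimate hO (hOK.trans hb) hu hdiv (contDiff_coverCutoff s x r).contDiffOn
      (fun p _ => coverCutoff_nonneg s x r p) (fun p _ => coverCutoff_le_one s x r p)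
      hT hTc hT0 hT1 hTH hKc hKO fun p hp => by rw [hη0 p hp, zero_mul]
    refine le_trans ?_ (key.trans (add_le_add ?_ (mul_le_mul_right ?_ _)))
    · refine le_trans (setLIntegral_mono' (hAm n) fun p hp => ?_) (lintegral_mono_set
        fun p hp => ?_)
      · rw [hη1 p hp, hTe _ hp.1.2, one_mul, one_mul]
      · by_contra hcon
        have := hη0 p ⟨hp.1.1, hcon⟩
        rw [hη1 p hp] at this
        exact one_ne_zero this
    · rw [← lintegral_const_mul' _ _ ENNReal.ofReal_ne_top]
      refine (setLIntegral_mono' hKc.measurableSet fun p hp => ?_).trans (lintegral_mono_set hKK)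
      rw [mul_comm, ENNReal.ofReal_mul (by positivity)]
      gcongr
      exact hρ p (hKK hp)
    · have hpos : ∀ p ∈ K₀, 0 ≤ lam κ p := fun p hp => zero_le_one.trans (one_le_lam hκ (hb hp))
      refine (lintegral_coverCutoff_le hKc.measurableSet s x r (fun i hi => (hs i hi).2.1)
        (fun i hi p hp hpx => ?_) (fun p hp => hpos p (hKK hp))
        fun i hi => hpos _ (hfr (hs i hi).1)).trans (ENNReal.ofReal_le_ofReal ?_)
      · have h1 := hunif p (hKK hp) (x i) (hfr (hs i hi).1) (by
          rw [dist_eq_norm]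
          linarith [(hs i hi).2.2, hδ4 n])
        rw [Real.dist_eq] at h1
        have h2 := (abs_lt.1 h1).2
        have h3 := one_le_lam hκ (hb (hfr (hs i hi).1))
        linarith
      · have := Real.pi_pos
        gcongr
  calc ∫⁻ p in {p | p ∈ O ∧ |u p| ≤ h}, ENNReal.ofReal (lam κ p * slope κ τ u p)
      ≤ ∫⁻ p in ⋃ n, A n, ENNReal.ofReal (lam κ p * slope κ τ u p) := lintegral_mono_set hsub
    _ ≤ _ := by
        rw [setLIntegral_iUnion_of_directed _ (hmono.directed_le)]
        exact iSup_le hpart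


/-! ### Exhaustions -/

/-- Around every disk of radius `R > 0` there is a cutoff function supported in a compact set; the
coordinate radius, the area, the energy of the cutoff function and the length of the circle are
at most `c` times `ρ R`, `a R`, `l R` and `l R`. -/
def HasExhaustion (κ c : ℝ) (ρ a l : ℝ → ℝ) : Prop :=
  ∀ R, 0 < R → ∃ (K₀ : Set (Coord 2)) (η : Coord 2 → ℝ), IsCompact K₀ ∧ K₀ ⊆ baseSet κ ∧
    disk κ R ⊆ K₀ ∧ ContDiffOn ℝ 1 η (baseSet κ) ∧ (∀ p ∈ baseSet κ, 0 ≤ η p) ∧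
    (∀ p ∈ baseSet κ, η p ≤ 1) ∧ (∀ p ∈ baseSet κ \ K₀, η p = 0) ∧ (∀ p ∈ disk κ R, η p = 1) ∧
    (∀ p ∈ K₀, ‖p‖ ≤ c * ρ R) ∧
    ∫⁻ p in K₀, ENNReal.ofReal (lam κ p ^ 2) ≤ ENNReal.ofReal (c * a R) ∧
    ∫⁻ p in K₀, ENNReal.ofReal (lam κ p * ‖fderiv ℝ η p‖) ≤ ENNReal.ofReal (c * l R) ∧
    baseLength κ (bdry κ (disk κ R)) ≤ ENNReal.ofReal (c * l R)

theorem lam_zero (p : Coord 2) : lam 0 p = 1 := by simp [lam, conf]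

theorem baseSet_zero : baseSet 0 = univ := by ext p; simp [baseSet]

theorem disk_zero (R : ℝ) : disk 0 R = Metric.ball 0 R := by
  ext p
  rw [mem_disk_iff le_rfl, baseSet_zero, radDist_zero_left, mem_ball_zero_iff]
  simp

theorem hasExhaustion_zero :
    ∃ c, 1 ≤ c ∧ HasExhaustion 0 c (fun R => R) (fun R => R ^ 2) (fun R => R) := by
  have hC := transitionBound_pos
  have hπ := Real.pi_pos
  have hvol : ∀ R : ℝ, 0 < R → volume (Metric.closedBall (0 : Coord 2) (2 * R)) =
      ENNReal.ofReal (4 * Real.pi * R ^ 2) := fun R hR => by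
    rw [EuclideanSpace.volume_closedBall_fin_two, ← ENNReal.ofReal_pow (by positivity),
      ← NNReal.coe_real_pi, ← ENNReal.ofReal_mul (by positivity)]
    congr 1
    ring
  -- The summands bound the coordinate radius 2R, the area 4πR² and the energy (4C/R)·4πR² of the
  -- cutoff.
  refine ⟨2 + 4 * Real.pi + 16 * Real.pi * transitionBound, by nlinarith [mul_pos hπ hC],
    fun R hR => ?_⟩
  refine ⟨Metric.closedBall 0 (2 * R), fun p => 1 - ballCutoff 0 R p, isCompact_closedBall _ _,
    by rw [baseSet_zero]; exact subset_univ _, ?_, ?_, ?_, ?_, ?_, ?_, ?_, ?_, ?_, ?_⟩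
  · rw [disk_zero]
    exact Metric.ball_subset_closedBall.trans (Metric.closedBall_subset_closedBall (by linarith))
  · exact (contDiff_const.sub (contDiff_ballCutoff 0 R)).contDiffOn
  · exact fun p _ => sub_nonneg.2 (ballCutoff_le_one _ _ _)
  · exact fun p _ => sub_le_self _ (ballCutoff_nonneg _ _ _)
  · intro p hp
    have h : 2 * R < ‖p‖ := by simpa using hp.2
    simp only
    rw [ballCutoff_eq_one hR (by rw [sub_zero]; exact h.le), sub_self]
  · intro p hp
    rw [disk_zero, mem_ball_zero_iff] at hp
    simp only
    rw [ballCutoff_eq_zero hR (by rw [sub_zero]; exact hp.le), sub_zero]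
  · intro p hp
    rw [mem_closedBall_zero_iff] at hp
    have : 0 ≤ (4 * Real.pi + 16 * Real.pi * transitionBound) * R := by positivity
    linarith
  · simp only [lam_zero, one_pow, ENNReal.ofReal_one]
    rw [setLIntegral_one, hvol R hR]
    refine ENNReal.ofReal_le_ofReal ?_
    gcongr
    have : 0 < Real.pi * transitionBound := by positivity
    linarith
  · calc ∫⁻ p in Metric.closedBall 0 (2 * R),
          ENNReal.ofReal (lam 0 p * ‖fderiv ℝ (fun p => 1 - ballCutoff 0 R p) p‖)
        ≤ ∫⁻ p in Metric.closedBall (0 : Coord 2) (2 * R),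
          ENNReal.ofReal (4 * transitionBound / R) := by
          refine setLIntegral_mono' Metric.isClosed_closedBall.measurableSet fun p hp => ?_
          refine ENNReal.ofReal_le_ofReal ?_
          have h := norm_fderiv_ballCutoff_le (c := 0) hR p
          rw [indicator_of_mem hp] at h
          rw [lam_zero, one_mul, fderiv_const_sub, norm_neg]
          exact h
      _ = ENNReal.ofReal (16 * Real.pi * transitionBound * R) := by
          rw [setLIntegral_const, hvol R hR, ← ENNReal.ofReal_mul (by positivity)]
          congr 1
          field_simp
          ring
      _ ≤ _ := by
          refine ENNReal.ofReal_le_ofReal ?_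
          gcongr
          linarith
  · refine (baseLength_bdry_disk_le (ρ := R) le_rfl fun r _ _ h => by
      rwa [radDist_zero_left] at h).trans (ENNReal.ofReal_le_ofReal ?_)
    rw [neg_zero, Real.sqrt_zero, zero_mul, Real.exp_zero, mul_one]
    gcongr
    have : 0 < Real.pi * transitionBound := by positivity
    linarith

theorem norm_le_of_mem_baseSet {κ : ℝ} (hκ : κ < 0) {p : Coord 2} (hp : p ∈ baseSet κ) :
    ‖p‖ ≤ 2 / √(-κ) := by
  have h := sqrt_mul_le_two hκ.le (mem_baseSet_iff.1 hp)
  rw [le_div_iff₀ (Real.sqrt_pos.2 (by linarith))]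
  linarith

/-- The gradient of λ is (−κ/2)λ²p, and √(−κ)‖p‖ ≤ 2. -/
theorem norm_fderiv_lam_le {κ : ℝ} (hκ : κ ≤ 0) {p : Coord 2} (hp : p ∈ baseSet κ) :
    ‖fderiv ℝ (lam κ : Coord 2 → ℝ) p‖ ≤ √(-κ) * lam κ p ^ 2 := by
  have hL : 0 < lam κ p := conf_pos hp
  have h := hasFDerivAt_conf (n := 2) hp
  have h' : HasFDerivAt (lam κ : Coord 2 → ℝ) _ p := h
  rw [h'.fderiv]
  have hs := sqrt_mul_le_two hκ (mem_baseSet_iff.1 hp)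
  have hsq : √(-κ) ^ 2 = -κ := Real.sq_sqrt (by linarith)
  refine ContinuousLinearMap.opNorm_le_bound _ (by positivity) fun v => ?_
  have h1 : |p 0 * v 0 + p 1 * v 1| ≤ ‖p‖ * ‖v‖ := by
    refine abs_le_of_sq_le_sq ?_ (by positivity)
    rw [mul_pow, norm_sq_coord, norm_sq_coord]
    nlinarith [sq_nonneg (p 0 * v 1 - p 1 * v 0)]
  have e : ((-κ / 2 * conf κ (p 0) (p 1) ^ 2) •
        (p 0 • (EuclideanSpace.proj 0 : Coord 2 →L[ℝ] ℝ) +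
          p 1 • (EuclideanSpace.proj 1 : Coord 2 →L[ℝ] ℝ))) v =
      (-κ / 2 * lam κ p ^ 2) * (p 0 * v 0 + p 1 * v 1) := by
    simp [lam]
    ring
  rw [e, Real.norm_eq_abs, abs_mul, abs_of_nonneg (by
    have : 0 ≤ -κ := by linarith
    positivity)]
  have h2 : -κ * ‖p‖ ≤ 2 * √(-κ) := by
    have := mul_le_mul_of_nonneg_left hs (Real.sqrt_nonneg (-κ))
    rw [← mul_assoc, ← sq, hsq] at this
    linarith
  calc -κ / 2 * lam κ p ^ 2 * |p 0 * v 0 + p 1 * v 1|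
      ≤ -κ / 2 * lam κ p ^ 2 * (‖p‖ * ‖v‖) := by
        have : 0 ≤ -κ := by linarith
        gcongr
    _ = (-κ * ‖p‖) * (lam κ p ^ 2 * ‖v‖ / 2) := by ring
    _ ≤ (2 * √(-κ)) * (lam κ p ^ 2 * ‖v‖ / 2) := by gcongr
    _ = _ := by ring

theorem hasExhaustion_neg {κ : ℝ} (hκ : κ < 0) : ∃ c, 1 ≤ c ∧ HasExhaustion κ c (fun _ => 1)
    (fun R => Real.exp (√(-κ) * R)) (fun R => Real.exp (√(-κ) * R)) := by
  have hC := transitionBound_pos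
  have hπ := Real.pi_pos
  have hk : 0 < √(-κ) := Real.sqrt_pos.2 (by linarith)
  have hk' : 0 < -κ := by linarith
  set c₁ := 2 / √(-κ) with hc₁
  set c₂ := 16 * Real.pi / -κ with hc₂
  set c₃ := 4 * transitionBound * √(-κ) * c₂ with hc₃
  set c₄ := 2 * Real.pi * c₁ with hc₄
  have p₁ : 0 < c₁ := by positivity
  have p₂ : 0 < c₂ := by positivity
  have p₃ : 0 < c₃ := by positivity
  have p₄ : 0 < c₄ := by positivity
  refine ⟨1 + c₁ + c₂ + c₃ + c₄, by linarith, fun R hR => ?_⟩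
  set Λ := Real.exp (√(-κ) * R) with hΛ
  have hΛ1 : 1 ≤ Λ := Real.one_le_exp (by positivity)
  have hΛ0 : 0 < Λ := by linarith
  have h4Λ : 1 ≤ 4 * Λ := by linarith
  have hsub := confSublevel_subset (κ := κ) (by linarith : 0 < 4 * Λ)
  have harea : ∫⁻ p in confSublevel κ (4 * Λ), ENNReal.ofReal (lam κ p ^ 2) ≤
      ENNReal.ofReal (c₂ * Λ) := by
    refine (area_confSublevel_le hκ h4Λ).trans_eq ?_
    congr 1
    rw [hc₂]; ring
  have hη : ∀ p ∈ baseSet κ, HasFDerivAt (fun p => 1 - transition (lam κ p / Λ))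
      (-(deriv transition (lam κ p / Λ) • (Λ⁻¹ • fderiv ℝ (lam κ : Coord 2 → ℝ) p))) p :=
    fun p hp => by
    have h1 := (differentiableAt_lam hp).hasFDerivAt.mul_const Λ⁻¹
    have h2 := ((contDiff_transition.differentiable one_ne_zero
      (lam κ p / Λ)).hasDerivAt).comp_hasFDerivAt p h1
    exact h2.const_sub 1
  -- The cutoff is a function of λ/Λ: one on D_R, where λ ≤ Λ, and zero where λ ≥ 4Λ. Its energy
  -- density is at most a constant times λ·√(−κ)λ²/Λ ≤ 4√(−κ)λ², so the energy is bounded by the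
  -- area, which has the same exponential order as the length.
  refine ⟨confSublevel κ (4 * Λ), fun p => 1 - transition (lam κ p / Λ),
    isCompact_confSublevel hκ h4Λ, hsub, ?_, ?_, ?_, ?_, ?_, ?_, ?_, ?_, ?_, ?_⟩
  · intro p hp
    have h1 := disk_subset_confSublevel hκ.le hp
    have hb := ((mem_disk_iff hκ.le).1 hp).1
    rw [mem_confSublevel_iff hΛ0 hb] at h1
    rw [mem_confSublevel_iff (by linarith) hb]
    linarith
  · intro p hp
    exact (contDiffAt_const.sub (contDiff_transition.contDiffAt.comp p
      ((contDiffAt_lam hp).div_const Λ))).contDiffWithinAt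
  · exact fun p _ => sub_nonneg.2 (transition_le_one _)
  · exact fun p _ => sub_le_self _ (transition_nonneg _)
  · intro p hp
    have h1 := hp.2
    rw [mem_confSublevel_iff (by linarith) hp.1, not_le] at h1
    simp only
    rw [transition_eq_one ((le_div_iff₀ hΛ0).2 h1.le), sub_self]
  · intro p hp
    have h1 := disk_subset_confSublevel hκ.le hp
    rw [mem_confSublevel_iff hΛ0 ((mem_disk_iff hκ.le).1 hp).1] at h1
    simp only
    rw [transition_eq_zero ((div_le_one hΛ0).2 h1), sub_zero]
  · intro p hp
    refine (norm_le_of_mem_baseSet hκ (hsub hp)).trans ?_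
    rw [← hc₁]
    linarith
  · refine harea.trans (ENNReal.ofReal_le_ofReal ?_)
    gcongr
    linarith
  · calc ∫⁻ p in confSublevel κ (4 * Λ),
          ENNReal.ofReal (lam κ p * ‖fderiv ℝ (fun p => 1 - transition (lam κ p / Λ)) p‖)
        ≤ ∫⁻ p in confSublevel κ (4 * Λ),
          ENNReal.ofReal (4 * transitionBound * √(-κ)) * ENNReal.ofReal (lam κ p ^ 2) := by
          refine setLIntegral_mono' (isClosed_confSublevel _ _).measurableSet fun p hp => ?_
          have hb := hsub hp
          have hL : 0 < lam κ p := conf_pos hb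
          rw [mem_confSublevel_iff (by linarith) hb] at hp
          rw [← ENNReal.ofReal_mul (by positivity), (hη p hb).fderiv, norm_neg, norm_smul,
            norm_smul, Real.norm_eq_abs, norm_inv, Real.norm_of_nonneg hΛ0.le]
          refine ENNReal.ofReal_le_ofReal ?_
          have h1 := abs_deriv_transition_le (lam κ p / Λ)
          have h2 := norm_fderiv_lam_le hκ.le hb
          calc lam κ p * (|deriv transition (lam κ p / Λ)| *
                (Λ⁻¹ * ‖fderiv ℝ (lam κ : Coord 2 → ℝ) p‖))
              ≤ 4 * Λ * (transitionBound * (Λ⁻¹ * (√(-κ) * lam κ p ^ 2))) := by gcongr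
            _ = 4 * transitionBound * √(-κ) * lam κ p ^ 2 := by field_simp
      _ = ENNReal.ofReal (4 * transitionBound * √(-κ)) *
          ∫⁻ p in confSublevel κ (4 * Λ), ENNReal.ofReal (lam κ p ^ 2) :=
          lintegral_const_mul' _ _ ENNReal.ofReal_ne_top
      _ ≤ ENNReal.ofReal (4 * transitionBound * √(-κ)) * ENNReal.ofReal (c₂ * Λ) := by gcongr
      _ = ENNReal.ofReal (c₃ * Λ) := by
          rw [← ENNReal.ofReal_mul (by positivity), hc₃]
          congr 1
          ring
      _ ≤ _ := by
          refine ENNReal.ofReal_le_ofReal ?_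
          gcongr
          linarith
  · refine (baseLength_bdry_disk_le (ρ := c₁) hκ.le fun r hr0 hr _ => ?_).trans
      (ENNReal.ofReal_le_ofReal ?_)
    · rw [hc₁, le_div_iff₀ hk]
      have := sqrt_mul_le_two hκ.le hr
      linarith
    · gcongr
      linarith


/-! ### Area growth -/

/-- The area of the part of the graph over a disk where `|u| ≤ h`. -/
theorem exists_area_le {κ τ c : ℝ} (hκ : κ ≤ 0) {Ω : Set (Coord 2)} {u : Coord 2 → ℝ}
    (hu : IsMinimalGraph κ τ Ω u)
    (hbd : HasZeroBoundaryValues κ Ω u ∨ HasControlledBoundaryLength κ Ω) (hc : 1 ≤ c)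
    {ρ a l : ℝ → ℝ} (hex : HasExhaustion κ c ρ a l) (hρ : ∀ R, 0 < R → 0 ≤ ρ R)
    (ha : ∀ R, 0 < R → 0 ≤ a R) (hl : ∀ R, 0 < R → 0 ≤ l R) :
    ∃ M, 0 ≤ M ∧ ∀ᶠ R in atTop, ∀ h, 0 < h →
      ∫⁻ p in {p | p ∈ Ω ∧ p ∈ disk κ R ∧ |u p| ≤ h}, ENNReal.ofReal (lam κ p * slope κ τ u p) ≤
        ENNReal.ofReal (M * ((1 + |τ| * ρ R) * a R + h * (l R + 1))) := by
  have hC := transitionBound_pos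
  have hπ := Real.pi_pos
  have hc0 : 0 < c := by linarith
  have hτ : ∀ R, 0 < R → 1 + |τ| * (c * ρ R) ≤ c * (1 + |τ| * ρ R) := fun R _ => by nlinarith
  rcases hbd with h0 | ⟨N, hN, hlen⟩
  · refine ⟨2 * c ^ 2 + 2 * c, by positivity, ?_⟩
    filter_upwards [eventually_gt_atTop 0] with R hR h hh
    obtain ⟨K₀, η, hK, hKb, hDK, hη, hη0, hη1, hηK, hηD, hKρ, hKa, hKl, -⟩ := hex R hR
    have := hρ R hR
    have := ha R hR
    have := hl R hR
    calc ∫⁻ p in {p | p ∈ Ω ∧ p ∈ disk κ R ∧ |u p| ≤ h},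
          ENNReal.ofReal (lam κ p * slope κ τ u p)
        ≤ 2 * (ENNReal.ofReal (1 + |τ| * (c * ρ R)) *
            ∫⁻ p in K₀, ENNReal.ofReal (lam κ p ^ 2)) +
          ENNReal.ofReal (2 * h) * ∫⁻ p in K₀, ENNReal.ofReal (lam κ p * ‖fderiv ℝ η p‖) :=
          area_le_of_zeroBoundary hu h0 hη hη0 hη1 hK hKb hηK (isOpen_disk hκ R).measurableSet hDK
            hηD hh hKρ
      _ ≤ ENNReal.ofReal 2 * (ENNReal.ofReal (c * (1 + |τ| * ρ R)) * ENNReal.ofReal (c * a R)) +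
          ENNReal.ofReal (2 * h) * ENNReal.ofReal (c * l R) := by
          rw [ENNReal.ofReal_ofNat]
          gcongr
          exact hτ R hR
      _ = ENNReal.ofReal (2 * (c * (1 + |τ| * ρ R) * (c * a R)) + 2 * h * (c * l R)) := by
          rw [← ENNReal.ofReal_mul (by positivity), ← ENNReal.ofReal_mul (by positivity),
            ← ENNReal.ofReal_mul (by positivity), ← ENNReal.ofReal_add (by positivity)
            (by positivity)]
      _ ≤ _ := by
          refine ENNReal.ofReal_le_ofReal ?_
          have e1 : 0 ≤ 2 * c * ((1 + |τ| * ρ R) * a R) := by positivity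
          have e2 : 0 ≤ 2 * c ^ 2 * (h * (l R + 1)) := by positivity
          have e3 : 0 ≤ 2 * c * h := by positivity
          nlinarith
  -- The second summand comes from 2h·32πC(2Ncl + 1) ≤ 64πC(2Nc + 1)·h(l + 1); the 1 added to l
  -- absorbs the error of the covering.
  · refine ⟨c ^ 2 + 64 * Real.pi * transitionBound * (2 * N * c + 1), by positivity, ?_⟩
    filter_upwards [eventually_gt_atTop 0, hlen] with R hR hlenR h hh
    obtain ⟨K₀, η, hK, hKb, hDK, -, -, -, -, -, hKρ, hKa, -, hlc⟩ := hex R hR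
    have := hρ R hR
    have := ha R hR
    have hl0 := hl R hR
    have hO : IsOpen (Ω ∩ disk κ R) := hu.isOpen.inter (isOpen_disk hκ R)
    have hOK : Ω ∩ disk κ R ⊆ K₀ := inter_subset_right.trans hDK
    -- The closure of Ω ∩ D_R lies in the compact K₀ ⊆ 𝕄²(κ), so the relative boundary is the whole
    -- frontier.
    have hfr : frontier (Ω ∩ disk κ R) = bdry κ (Ω ∩ disk κ R) := by
      refine (inter_eq_left.2 ?_).symm
      exact (frontier_subset_closure.trans (closure_minimal hOK hK.isClosed)).trans hKb
    have hL : ∫⁻ p in frontier (Ω ∩ disk κ R), ENNReal.ofReal (lam κ p)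
        ∂(Measure.hausdorffMeasure 1) ≤ ENNReal.ofReal (N * (c * l R)) := by
      rw [hfr, ENNReal.ofReal_mul hN.le]
      exact hlenR.trans (by gcongr)
    have hset : {p | p ∈ Ω ∧ p ∈ disk κ R ∧ |u p| ≤ h} =
        {p | p ∈ Ω ∩ disk κ R ∧ |u p| ≤ h} := by
      ext p
      simp [and_assoc]
    rw [hset]
    calc ∫⁻ p in {p | p ∈ Ω ∩ disk κ R ∧ |u p| ≤ h},
          ENNReal.ofReal (lam κ p * slope κ τ u p)
        ≤ ENNReal.ofReal (1 + |τ| * (c * ρ R)) * (∫⁻ p in K₀, ENNReal.ofReal (lam κ p ^ 2)) +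
          ENNReal.ofReal (2 * h) * ENNReal.ofReal
            (32 * Real.pi * transitionBound * (2 * (N * (c * l R)) + 1)) :=
          area_le_of_length hκ hO (hu.contDiffOn.mono inter_subset_left)
            (fun p hp => hu.div_flux hp.1) hK hKb hOK (by positivity) hL hh hKρ
      _ ≤ ENNReal.ofReal (c * (1 + |τ| * ρ R)) * ENNReal.ofReal (c * a R) +
          ENNReal.ofReal (2 * h) * ENNReal.ofReal
            (32 * Real.pi * transitionBound * (2 * (N * (c * l R)) + 1)) := by
          gcongr
          exact hτ R hR
      _ = ENNReal.ofReal (c * (1 + |τ| * ρ R) * (c * a R) +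
          2 * h * (32 * Real.pi * transitionBound * (2 * (N * (c * l R)) + 1))) := by
          rw [← ENNReal.ofReal_mul (by positivity), ← ENNReal.ofReal_mul (by positivity),
            ← ENNReal.ofReal_add (by positivity) (by positivity)]
      _ ≤ _ := by
          refine ENNReal.ofReal_le_ofReal ?_
          have e1 : 2 * (N * (c * l R)) + 1 ≤ (2 * N * c + 1) * (l R + 1) := by
            have : 0 ≤ N * c := by positivity
            nlinarith
          have e2 := mul_le_mul_of_nonneg_left e1
            (by positivity : 0 ≤ 64 * Real.pi * transitionBound * h)
          have e3 : 0 ≤ 64 * Real.pi * transitionBound * (2 * N * c + 1) *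
            ((1 + |τ| * ρ R) * a R) := by positivity
          have e4 : 0 ≤ c ^ 2 * (h * (l R + 1)) := by positivity
          linarith

theorem sqrt_gramDet_graphMap {κ τ : ℝ} {Ω : Set (Coord 2)} {u : Coord 2 → ℝ}
    (hu : IsMinimalGraph κ τ Ω u) {p : Coord 2} (hp : p ∈ Ω) :
    √(gramDet (spaceMetric κ τ) (graphMap u) p) = lam κ p * slope κ τ u p := by
  have hb := hu.subset hp
  have hL : 0 < lam κ p := conf_pos hb
  have hV := slope_pos τ u hb
  rw [gramDet_graphMap κ τ
    ((hu.contDiffOn.contDiffAt (hu.isOpen.mem_nhds hp)).differentiableAt (by simp)),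
    Real.sqrt_sq (by positivity)]

/-- By `ball_subset`, points of the graph in the ball project into the disk and have bounded height.
The strict inequality for R' is needed because the disk is open. -/
theorem surfaceArea_ball_le {κ τ : ℝ} (hκ : κ ≤ 0) {Ω : Set (Coord 2)} {u : Coord 2 → ℝ}
    (hu : IsMinimalGraph κ τ Ω u) {p₀ : Coord 3} {R R' σ : ℝ} (hR : 0 ≤ R)
    (hR' : radDist κ √(p₀ 0 ^ 2 + p₀ 1 ^ 2) + R < R') (hσ : ∀ p ∈ disk κ R', ‖p‖ ≤ σ) :
    surfaceArea (spaceMetric κ τ) Ω (graphMap u) (ball κ τ p₀ R) ≤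
      ∫⁻ p in {p | p ∈ Ω ∧ p ∈ disk κ R' ∧ |u p| ≤ |p₀ 2| + (1 + |τ| * σ) * R},
        ENNReal.ofReal (lam κ p * slope κ τ u p) := by
  set h := |p₀ 2| + (1 + |τ| * σ) * R
  have hm : MeasurableSet {p | p ∈ Ω ∧ p ∈ disk κ R' ∧ |u p| ≤ h} := by
    have : {p | p ∈ Ω ∧ p ∈ disk κ R' ∧ |u p| ≤ h} =
        (Ω ∩ u ⁻¹' {s | |s| ≤ h}) ∩ disk κ R' := by
      ext p
      simp [and_assoc, and_comm]
    rw [this]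
    exact (measurableSet_inter_preimage hu.isOpen hu.contDiffOn.continuousOn
      (isClosed_le continuous_abs continuous_const)).inter (isOpen_disk hκ R').measurableSet
  have hsub : {p | p ∈ Ω ∧ graphMap u p ∈ ball κ τ p₀ R} ⊆
      {p | p ∈ Ω ∧ p ∈ disk κ R' ∧ |u p| ≤ h} := by
    rintro p ⟨hpΩ, hpB⟩
    have hr : ∀ r, 0 ≤ r → r ∈ radSet κ →
        radDist κ r ≤ radDist κ √(p₀ 0 ^ 2 + p₀ 1 ^ 2) + R → r ≤ σ := by
      intro r hr0 hr hle
      -- Every admissible radius is realized by a point on the first axis, so the bound σ on the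
      -- disk bounds radii.
      have hn : ‖(r • coordVec 0 : Coord 2)‖ = r := by
        simp [norm_smul, coordVec, abs_of_nonneg hr0]
      have := hσ (r • coordVec 0) ((mem_disk_iff hκ).2
        ⟨mem_baseSet_iff.2 (by rwa [hn]), by rw [hn]; exact hle.trans_lt hR'⟩)
      rwa [hn] at this
    obtain ⟨h1, h2⟩ := ball_subset hκ hR hpB hr
    have e0 : graphMap u p 0 = p 0 := rfl
    have e1 : graphMap u p 1 = p 1 := rfl
    have e2 : graphMap u p 2 = u p := rfl
    rw [e0, e1, ← norm_eq_sqrt] at h1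
    rw [e2] at h2
    exact ⟨hpΩ, (mem_disk_iff hκ).2 ⟨hu.subset hpΩ, h1.trans_lt hR'⟩, h2⟩
  refine (lintegral_mono_set hsub).trans_eq (setLIntegral_congr_fun hm fun p hp => ?_)
  rw [sqrt_gramDet_graphMap hu hp.1]

/-- The area growth of a minimal graph in terms of an exhaustion of `𝕄²(κ)`. -/
theorem extrinsicAreaGrowthAtMost {κ τ c : ℝ} (hκ : κ ≤ 0) {Ω : Set (Coord 2)} {u : Coord 2 → ℝ}
    (hu : IsMinimalGraph κ τ Ω u)
    (hbd : HasZeroBoundaryValues κ Ω u ∨ HasControlledBoundaryLength κ Ω) (hc : 1 ≤ c)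
    {ρ a l f : ℝ → ℝ} (hex : HasExhaustion κ c ρ a l) (hρ : ∀ R, 0 < R → 0 ≤ ρ R)
    (ha : ∀ R, 0 < R → 0 ≤ a R) (hl : ∀ R, 0 < R → 0 ≤ l R)
    (hf : ∀ d z : ℝ, 0 ≤ d → 0 ≤ z → ∃ N, 0 ≤ N ∧ ∀ᶠ R in atTop,
      (1 + |τ| * ρ (R + d)) * a (R + d) +
        (z + (1 + |τ| * (c * ρ (R + d))) * R) * (l (R + d) + 1) ≤ N * f R) :
    ExtrinsicAreaGrowthAtMost κ τ Ω u f := by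
  intro p₀ hp₀
  obtain ⟨M, hM, hev⟩ := exists_area_le hκ hu hbd hc hex hρ ha hl
  set r₀ := √(p₀ 0 ^ 2 + p₀ 1 ^ 2) with hr₀
  have hr₀S : r₀ ∈ radSet κ := by
    rw [radSet, mem_ofPred_eq, Real.sq_sqrt (by positivity)]; exact hp₀
  have hd0 := radDist_nonneg hκ (Real.sqrt_nonneg _) hr₀S
  -- The added 1 makes the inclusion in the disk of radius R + d strict.
  set d := radDist κ r₀ + 1 with hd
  obtain ⟨N, hN, hNev⟩ := hf d |p₀ 2| (by positivity) (abs_nonneg _)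
  refine lt_of_le_of_lt (limsup_le_of_le (by isBoundedDefault) ?_)
    (ENNReal.ofReal_lt_top (r := M * N))
  filter_upwards [(tendsto_atTop_add_const_right atTop d tendsto_id).eventually hev, hNev,
    eventually_gt_atTop 0] with R h1 h2 hR
  have hR' : 0 < R + d := by positivity
  obtain ⟨K₀, η, -, -, hDK, -, -, -, -, -, hKρ, -, -, -⟩ := hex (R + d) hR'
  have hρ' := hρ _ hR'
  have hh : 0 < |p₀ 2| + (1 + |τ| * (c * ρ (R + d))) * R := by
    have hc0 : 0 < c := by linarith
    positivity
  have h3 := surfaceArea_ball_le (σ := c * ρ (R + d)) hκ hu (p₀ := p₀) hR.le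
    (by rw [hd]; linarith : radDist κ √(p₀ 0 ^ 2 + p₀ 1 ^ 2) + R < R + d)
    fun p hp => hKρ p (hDK hp)
  refine ENNReal.div_le_of_le_mul ?_
  rw [← ENNReal.ofReal_mul (by positivity)]
  refine (h3.trans (h1 _ hh)).trans (ENNReal.ofReal_le_ofReal ?_)
  rw [mul_assoc]
  exact mul_le_mul_of_nonneg_left h2 hM

end EKT

end

/-! ### The three growth rates -/

theorem mainTheorem1 (κ τ : ℝ) (hκ : κ ≤ 0) (Ω : Set (EKT.Coord 2)) (u : EKT.Coord 2 → ℝ)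
    (hu : EKT.IsMinimalGraph κ τ Ω u)
    (h : EKT.HasZeroBoundaryValues κ Ω u ∨ EKT.HasControlledBoundaryLength κ Ω) :
    (κ = 0 → τ = 0 → EKT.ExtrinsicAreaGrowthAtMost κ τ Ω u (fun R => R ^ 2)) ∧
    (κ = 0 → τ ≠ 0 → EKT.ExtrinsicAreaGrowthAtMost κ τ Ω u (fun R => R ^ 3)) ∧
    (κ < 0 → EKT.ExtrinsicAreaGrowthAtMost κ τ Ω u (fun R => R * Real.exp (R * √(-κ)))) := by
  refine ⟨?_, ?_, fun hneg => ?_⟩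
  -- Without twist the height is O(R), so height times length is of the same order R² as the area of
  -- the disk.
  · rintro rfl rfl
    obtain ⟨c, hc, hex⟩ := EKT.hasExhaustion_zero
    refine EKT.extrinsicAreaGrowthAtMost hκ hu h hc hex (fun R hR => hR.le)
      (fun R _ => sq_nonneg R) (fun R hR => hR.le) fun d z hd hz => ⟨4 + (z + 1) * 3,
        by positivity, ?_⟩
    filter_upwards [eventually_ge_atTop 1, eventually_ge_atTop d] with R hR hRd
    simp only [abs_zero, zero_mul, add_zero, one_mul]
    have h1 : (R + d) ^ 2 ≤ (2 * R) ^ 2 := by gcongr; linarith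
    have h2 : z + R ≤ (z + 1) * R := by nlinarith
    have h3 : (z + R) * (R + d + 1) ≤ (z + 1) * R * (3 * R) := by
      gcongr
      linarith
    nlinarith
  -- The coordinate radius enters twice: the weight 1 + |τ|ρ turns the area R² into R³, and the
  -- height becomes O(R²), multiplied by a length O(R).
  · rintro rfl -
    obtain ⟨c, hc, hex⟩ := EKT.hasExhaustion_zero
    have hc0 : 0 < c := by linarith
    refine EKT.extrinsicAreaGrowthAtMost hκ hu h hc hex (fun R hR => hR.le)
      (fun R _ => sq_nonneg R) (fun R hR => hR.le) fun d z hd hz =>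
        ⟨(1 + 2 * |τ|) * 4 + (z + 1 + 2 * |τ| * c) * 3, by positivity, ?_⟩
    filter_upwards [eventually_ge_atTop 1, eventually_ge_atTop d] with R hR hRd
    have hR0 : 0 < R := by linarith
    have hR2 : R ≤ R ^ 2 := by nlinarith
    have h0 : 1 + |τ| * (R + d) ≤ (1 + 2 * |τ|) * R := by nlinarith [abs_nonneg τ]
    have h1 : (1 + |τ| * (R + d)) * (R + d) ^ 2 ≤ (1 + 2 * |τ|) * R * (2 * R) ^ 2 := by
      gcongr
      linarith
    have h2 : z + (1 + |τ| * (c * (R + d))) * R ≤ (z + 1 + 2 * |τ| * c) * R ^ 2 := by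
      have e1 : z * 1 ≤ z * R ^ 2 := by gcongr; nlinarith
      have e2 : |τ| * c * ((R + d) * R) ≤ |τ| * c * (2 * R ^ 2) :=
        mul_le_mul_of_nonneg_left (by nlinarith) (by positivity)
      linarith
    have h3 : (z + (1 + |τ| * (c * (R + d))) * R) * (R + d + 1) ≤
        (z + 1 + 2 * |τ| * c) * R ^ 2 * (3 * R) := by
      gcongr
      linarith
    linarith
  -- The coordinate radius is bounded, so the height is O(R) whatever τ is. The shift by d only
  -- costs the constant e^{√(−κ)d}.
  · obtain ⟨c, hc, hex⟩ := EKT.hasExhaustion_neg hneg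
    have hc0 : 0 < c := by linarith
    refine EKT.extrinsicAreaGrowthAtMost hκ hu h hc hex (fun R _ => zero_le_one)
      (fun R _ => (Real.exp_pos _).le) (fun R _ => (Real.exp_pos _).le) fun d z hd hz =>
        ⟨(1 + |τ|) * Real.exp (√(-κ) * d) + (z + 1 + |τ| * c) * (2 * Real.exp (√(-κ) * d)),
          by positivity, ?_⟩
    filter_upwards [eventually_ge_atTop 1] with R hR
    have hR0 : 0 < R := by linarith
    have hE : 1 ≤ Real.exp (√(-κ) * (R + d)) := Real.one_le_exp (by positivity)
    have hE2 : Real.exp (√(-κ) * (R + d)) = Real.exp (√(-κ) * d) * Real.exp (R * √(-κ)) := by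
      rw [← Real.exp_add]
      congr 1
      ring
    simp only [mul_one]
    have h1 : (1 + |τ|) * Real.exp (√(-κ) * (R + d)) ≤
        (1 + |τ|) * Real.exp (√(-κ) * (R + d)) * R :=
      le_mul_of_one_le_right (by positivity) hR
    have h2 : z + (1 + |τ| * c) * R ≤ (z + 1 + |τ| * c) * R := by nlinarith
    have h3 : (z + (1 + |τ| * c) * R) * (Real.exp (√(-κ) * (R + d)) + 1) ≤
        (z + 1 + |τ| * c) * R * (2 * Real.exp (√(-κ) * (R + d))) := by
      gcongr
      linarith
    refine (add_le_add h1 h3).trans_eq ?_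
    rw [hE2]
    ring
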